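/- **Conventions.** Let $\Lambda=\mathbb Z[c]=\mathbb Z[c_1,c_2,\dots]$, with $c_0=1$ and $c_k=0$ for $k<0$, and let $x_i,y_i$ $(i\in\mathbb Z)$ be variables. For a partition $\mu$ let $S_\mu(c)=\det(c_{\mu_k+l-k})_{1\le k,l\le \ell(\mu)}$, and let the Littlewood–Richardson coefficients be defined by $S_\mu(c)\,S_\nu(c)=\sum_\lambda c^\lambda_{\mu\nu}S_\lambda(c)$. Let $\mathfrak S_w(x,y)$ be the classical double Schubert polynomials: $\mathfrak S_w=\prod_{i+j\le n}(x_i-y_j)$ if $w$ is the longest element of the symmetric group $S_n$, and $\mathfrak S_{ws_k}=(\mathfrak S_w-s_k\mathfrak S_w)/(x_k-x_{k+1})$ if $w(k)>w(k+1)$, where $s_k$ interchanges $x_k$ and $x_{k+1}$. For a permutation $w$ of $\mathbb Z$ of finite support, the enriched (back-stable) Schubert polynomial $S_w(c,x,y)\in\Lambda[x,y]$ is the polynomial such that, for every $m\ge 0$ for which $w$ fixes all $i\le -m$, the substitution $1+\sum_{k\ge1} c_kt^k=\prod_{-m<i\le 0}\frac{1+y_it}{1-x_it}$ maps $S_w$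 to $\mathfrak S_{1^m\times w}(x_{1-m},x_{2-m},\dots;-y_{1-m},-y_{2-m},\dots)$, where $(1^m\times w)(i)=w(i-m)+m$. **Tableaux.** Let $\lambda\supset\mu$ be weakly decreasing sequences of $n$ integers, i.e. $\lambda_i\ge\mu_i$ for all $i$; the boxes of $\lambda/\mu$ in row $i$ lie in the columns $j$ with $\mu_i<j\le\lambda_i$. Let $P_i,Q_i\ge 0$ $(1\le i\le n)$ be integers. A *tableau* on $\lambda/\mu$ with bounds $P,Q$ is a filling of the boxes by plain integers $k$, primed integers $l'$, or pairs $(k,l')$ such that: every $k$ (resp. $l'$) in row $i$ satisfies $1\le k\le P_i$ (resp. $1\le l\le Q_i$); plain integers are weakly increasing along rows and strictly increasing down columns; primed integers are strictly increasing along rows and weakly increasing down columns; every box to the right of or below a box containing a plain (resp. primed) integer contains a plain (resp. primed) integer; and the entry immediately to the right of (resp. immediately below) a pair $(k,l')$ has the form $(k+m,(l+m+1)')$ (resp. $(k+m+1,(l+m)')$) with $m\ge0$. A *dual tableau* satisfies the same bounds and all the other conditions with the orderings reversed (exchange right with left and below with above). In the situation below no pairs occur, since $P_i=0$ or $Q_i=0$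 for each $i$. **Theorem.** Let $w$ be a $321$-avoiding permutation of $\mathbb Z$ of finite support. Let $p_1>\dots>p_n$ be the integers $a$ with $w(a)>a$, and let $q_i=w(p_i)-1$. Put $\kappa_i=q_i+1+i$ and $\rho_i=p_i+i$ for $1\le i\le n$. Then $$S_w(c,x,y)=\sum c^{\lambda}_{\mu\nu}\,\mathrm{wt}(T)\,\mathrm{wt}(T')\,S_\mu(c),$$ the sum over all partitions $\mu$, all weakly decreasing integer sequences $\lambda,\nu$ of length $n$ with $\kappa\supset\lambda\supset\nu\supset\rho$, all tableaux $T$ on $\kappa/\lambda$ with bounds $P_i=\max(-q_i,0)$, $Q_i=\max(q_i,0)$, and all dual tableaux $T'$ on $\nu/\rho$ with bounds $P_i=\max(p_i,0)$, $Q_i=\max(-p_i,0)$. Here $\mathrm{wt}(T)$ is the product over the entries of $T$ of $-y_{1-k}$ for each $k$ and $y_l$ for each $l'$; $\mathrm{wt}(T')$ is the product over the entries of $T'$ of $x_k$ for each $k$ and $-x_{1-l}$ for each $l'$; and $c^\lambda_{\mu\nu}$ means $c^{\lambda+t}_{\mu,\,\nu+t}$ for any integer $t$ with $\rho_i+t\ge0$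 for all $i$, where $t$ is added to every term. In particular, if moreover $w(i)=i$ for all $i\le 0$, then $$\mathfrak S_w(x,-y)=\sum \mathrm{wt}(T)\,\mathrm{wt}(T'),$$ the sum over all weakly decreasing $\lambda$ with $\kappa\supset\lambda\supset\rho$, all tableaux $T$ on $\kappa/\lambda$ and all dual tableaux $T'$ on $\lambda/\rho$, with bounds and weights as above. -/

import Mathlib

open MvPolynomial

/-! ### Polynomial rings and Chern series -/

/-- The index set of the variables `x_i`, `y_i` (`i ∈ ℤ`): `Sum.inl i` stands for `x_i`
and `Sum.inr i` for `y_i`. -/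
abbrev XY : Type := ℤ ⊕ ℤ

/-- The ring `Λ = ℤ[c] = ℤ[c_1, c_2, …]`. -/
abbrev CRing : Type := MvPolynomial ℕ+ ℤ

/-- The ring `Λ[x, y]`, in which enriched Schubert polynomials live. -/
abbrev LambdaXY : Type := MvPolynomial XY CRing

/-- The ring `ℤ[x, y]`, in which double Schubert polynomials live. -/
abbrev ZXY : Type := MvPolynomial XY ℤ

/-- The variable `x_i`, over any ring of coefficients. -/
noncomputable def xVar (A : Type) [CommRing A] (i : ℤ) : MvPolynomial XY A := X (Sum.inl i)

/-- The variable `y_i`, over any ring of coefficients. -/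
noncomputable def yVar (A : Type) [CommRing A] (i : ℤ) : MvPolynomial XY A := X (Sum.inr i)

/-- The universal Chern series `c = 1 + c_1 t + c_2 t² + ⋯`. -/
noncomputable def chernSeries : PowerSeries CRing :=
  PowerSeries.mk fun k => if h : 0 < k then X (⟨k, h⟩ : ℕ+) else 1

/-- The coefficient of `t^m` for an integer `m`, which is `0` for `m < 0`. -/
noncomputable def coeffInt {A : Type} [CommRing A] (f : PowerSeries A) (m : ℤ) : A :=
  if m < 0 then 0 else PowerSeries.coeff m.toNat f

/-! ### Schur determinants and Littlewood–Richardson coefficients -/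

/-- The Schur determinant `S_μ(c) = det (c_{μ_k + l - k})`, of size the length of `μ`. -/
noncomputable def schurDet {A : Type} [CommRing A] (c : PowerSeries A) (mu : YoungDiagram) : A :=
  Matrix.det (Matrix.of fun k l : Fin (mu.colLen 0) =>
    coeffInt c ((mu.rowLen k : ℤ) + (l : ℤ) - (k : ℤ)))

/-- The Schur polynomial `S_μ(c)` in `Λ = ℤ[c]`. -/
noncomputable def schurC (mu : YoungDiagram) : CRing := schurDet chernSeries mu

open Classical in
/-- The Littlewood–Richardson coefficient `c^lam_{mu, nu}`: the structure constants of `Λ` in its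
basis of Schur polynomials, `S_mu(c) S_nu(c) = ∑_lam c^lam_{mu, nu} S_lam(c)`. -/
noncomputable def lrCoeff (lam mu nu : YoungDiagram) : ℤ :=
  if h : ∃ f : YoungDiagram →₀ ℤ, schurC mu * schurC nu = f.sum fun k a => a • schurC k
  then h.choose lam else 0

/-- The partition with parts `lam 0 ≥ lam 1 ≥ ⋯ ≥ lam (n-1) ≥ 0`, as a Young diagram
(see `mem_diagramOf`). -/
def diagramOf {n : ℕ} (lam : Fin n → ℤ) : YoungDiagram where
  cells := (Finset.range n ×ˢ Finset.range (∑ i, (lam i).toNat)).filter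
    fun b => ∀ i : Fin n, (i : ℕ) ≤ b.1 → (b.2 : ℤ) < lam i
  isLowerSet := by
    intro a b hba ha
    simp only [Finset.coe_filter, Finset.mem_product, Finset.mem_range, Set.mem_ofPred_eq] at ha ⊢
    obtain ⟨h1, h2⟩ := Prod.le_def.mp hba
    refine ⟨⟨by omega, by omega⟩, fun i hi => ?_⟩
    have := ha.2 i (by omega)
    omega

theorem mem_diagramOf {n : ℕ} {lam : Fin n → ℤ} (hlam : Antitone lam) (i j : ℕ) :
    (i, j) ∈ diagramOf lam ↔ ∃ h : i < n, (j : ℤ) < lam ⟨i, h⟩ := by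
  rw [← YoungDiagram.mem_cells]
  simp only [diagramOf, Finset.mem_filter, Finset.mem_product, Finset.mem_range]
  constructor
  · rintro ⟨⟨h, -⟩, h2⟩
    exact ⟨h, h2 ⟨i, h⟩ le_rfl⟩
  · rintro ⟨h, hj⟩
    refine ⟨⟨h, ?_⟩, fun k hk => lt_of_lt_of_le hj (hlam (Fin.mk_le_mk.mpr hk))⟩
    have : (lam ⟨i, h⟩).toNat ≤ ∑ i, (lam i).toNat :=
      Finset.single_le_sum (f := fun i => (lam i).toNat) (fun _ _ => Nat.zero_le _)
        (Finset.mem_univ _)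
    omega

/-! ### Classical double Schubert polynomials -/

/-- The automorphism `s_k` of `ℤ[x, y]` which interchanges `x_k` and `x_{k+1}`. -/
noncomputable def swapX (k : ℤ) : ZXY →ₐ[ℤ] ZXY :=
  rename (Sum.map (Equiv.swap k (k + 1)) id)

theorem exists_dividedDifference (k : ℤ) (f : ZXY) :
    ∃ g : ZXY, (xVar ℤ k - xVar ℤ (k + 1)) * g = f - swapX k f := by
  suffices h : (xVar ℤ k - xVar ℤ (k + 1)) ∣ f - swapX k f by
    obtain ⟨g, hg⟩ := h
    exact ⟨g, hg.symm⟩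
  induction f using MvPolynomial.induction_on with
  | C a => simp [swapX]
  | add f g hf hg =>
    rw [map_add, add_sub_add_comm]
    exact dvd_add hf hg
  | mul_X f v hf =>
    have hv : (xVar ℤ k - xVar ℤ (k + 1)) ∣ X v - swapX k (X v) := by
      rcases v with i | i
      · by_cases h1 : i = k
        · subst h1
          simp [swapX, xVar]
        · by_cases h2 : i = k + 1
          · subst h2
            rw [← neg_dvd]
            simp [swapX, xVar]
          · simp [swapX, Equiv.swap_apply_of_ne_of_ne h1 h2]
      · simp [swapX]
    have h3 : f * X v - swapX k (f * X v)
        = (f - swapX k f) * X v + swapX k f * (X v - swapX k (X v)) := by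
      rw [map_mul]
      ring
    rw [h3]
    exact dvd_add (Dvd.dvd.mul_right hf _) (Dvd.dvd.mul_left hv _)

/-- The divided difference operator `∂_k f = (f - s_k f) / (x_k - x_{k+1})` on `ℤ[x, y]`. -/
noncomputable def dividedDifference (k : ℤ) (f : ZXY) : ZXY :=
  (exists_dividedDifference k f).choose

/-- The longest element of the symmetric group `S_n`: it maps `i` to `n + 1 - i` for `1 ≤ i ≤ n`,
and fixes all other integers. -/
def longestPerm (n : ℕ) : Equiv.Perm ℤ :=
  Function.Involutive.toPerm (fun i => if 1 ≤ i ∧ i ≤ (n : ℤ) then (n : ℤ) + 1 - i else i) (by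
    intro i
    by_cases h : 1 ≤ i ∧ i ≤ (n : ℤ)
    · have h' : 1 ≤ (n : ℤ) + 1 - i ∧ (n : ℤ) + 1 - i ≤ n := by omega
      simp only [if_pos h, if_pos h']
      omega
    · simp only [if_neg h])

/-- `IsDoubleSchubert w f` says that `f` is the double Schubert polynomial `𝔖_w(x, y)` of the
permutation `w` of the positive integers: `𝔖_w = ∏_{i + j ≤ n} (x_i - y_j)` if `w` is the longest
element of `S_n`, and `𝔖_{w s_k} = ∂_k 𝔖_w` if `w(k) > w(k + 1)`. -/
inductive IsDoubleSchubert : Equiv.Perm ℤ → ZXY → Prop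
  | longest (n : ℕ) : IsDoubleSchubert (longestPerm n)
      (∏ b ∈ (Finset.Icc 1 n ×ˢ Finset.Icc 1 n).filter (fun b : ℕ × ℕ => b.1 + b.2 ≤ n),
        (xVar ℤ (b.1 : ℤ) - yVar ℤ (b.2 : ℤ)))
  | descent (w : Equiv.Perm ℤ) (f : ZXY) (k : ℤ) (hk : 0 < k) (hw : w (k + 1) < w k)
      (hf : IsDoubleSchubert w f) :
      IsDoubleSchubert (w * Equiv.swap k (k + 1)) (dividedDifference k f)

open Classical in
/-- The double Schubert polynomial `𝔖_w(x, y)`, for a permutation `w` of the positive integers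
(regarded as a permutation of `ℤ` that fixes all `i ≤ 0`) with finite support. -/
noncomputable def doubleSchubert (w : Equiv.Perm ℤ) : ZXY :=
  if h : ∃ f, IsDoubleSchubert w f then h.choose else 0

/-- The substitution `y_i ↦ -y_i` in `ℤ[x, y]`. -/
noncomputable def negY : ZXY →ₐ[ℤ] ZXY :=
  aeval (Sum.elim (fun i => xVar ℤ i) (fun i => -yVar ℤ i))

/-! ### Enriched Schubert polynomials -/

/-- The translate `γ^m(w) = 1^m × w` of `w`: it maps `i` to `w(i - m) + m`. -/
def shiftPerm (m : ℤ) (w : Equiv.Perm ℤ) : Equiv.Perm ℤ :=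
  ((Equiv.subRight m).trans w).trans (Equiv.addRight m)

/-- The substitution `x_i ↦ x_{i-m}`, `y_i ↦ y_{i-m}` in `ℤ[x, y]`. -/
noncomputable def shiftBack (m : ℤ) : ZXY →ₐ[ℤ] ZXY :=
  rename (Sum.map (fun i => i - m) (fun i => i - m))

/-- The power series `1 / (1 - a t) = 1 + a t + a² t² + ⋯`. -/
noncomputable def geomSeries {A : Type} [CommRing A] (a : A) : PowerSeries A :=
  PowerSeries.mk fun k => a ^ k

theorem one_sub_mul_geomSeries {A : Type} [CommRing A] (a : A) :
    (1 - PowerSeries.C a * PowerSeries.X) * geomSeries a = 1 := by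
  ext k
  rw [sub_mul, one_mul, map_sub, mul_assoc, PowerSeries.coeff_C_mul]
  cases k with
  | zero => simp [geomSeries]
  | succ k =>
    rw [PowerSeries.coeff_succ_X_mul]
    simp [geomSeries, PowerSeries.coeff_one, pow_succ, mul_comm]

/-- The Chern series `∏_{-m < i ≤ 0} (1 + y_i t) / (1 - x_i t)`. -/
noncomputable def finiteChern (m : ℕ) : PowerSeries ZXY :=
  ∏ i ∈ Finset.Ioc (-(m : ℤ)) 0,
    ((1 + PowerSeries.C (yVar ℤ i) * PowerSeries.X) * geomSeries (xVar ℤ i))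

/-- The homomorphism from `Λ[x, y]` to `ℤ[x, y]` which fixes all `x_i` and `y_i` and substitutes
`c = ∏_{-m < i ≤ 0} (1 + y_i t) / (1 - x_i t)`. -/
noncomputable def specializeC (m : ℕ) : LambdaXY →+* ZXY :=
  eval₂Hom
    (aeval (fun k : ℕ+ => PowerSeries.coeff (k : ℕ) (finiteChern m)) : CRing →ₐ[ℤ] ZXY).toRingHom
    (X : XY → ZXY)

/-- `IsEnrichedSchubert w f` says that `f` is the enriched (or back-stable) Schubert polynomial
`S_w(c, x, y)` in `Λ[x, y]` of the permutation `w` of the integers, of finite support: for every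
`m ≥ 0` such that `w` fixes all `i ≤ -m`, the substitution
`c = ∏_{-m < i ≤ 0} (1 + y_i t) / (1 - x_i t)` maps `f` to the double Schubert polynomial
`𝔖_{1^m × w}(x_{1-m}, x_{2-m}, …; -y_{1-m}, -y_{2-m}, …)`. -/
def IsEnrichedSchubert (w : Equiv.Perm ℤ) (f : LambdaXY) : Prop :=
  ∀ m : ℕ, (∀ i : ℤ, i ≤ -(m : ℤ) → w i = i) →
    specializeC m f = negY (shiftBack m (doubleSchubert (shiftPerm m w)))

/-- `w` avoids the pattern `321`. -/
def Is321Avoiding (w : Equiv.Perm ℤ) : Prop :=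
  ∀ i j k : ℤ, i < j → j < k → ¬ (w k < w j ∧ w j < w i)

/-! ### Tableaux -/

/-- An entry of a tableau: a plain integer `k`, a primed integer `l'`, or a pair `(k, l')`. -/
inductive TableauEntry : Type
  | plain (k : ℕ)
  | primed (l : ℕ)
  | both (k l : ℕ)

/-- The plain integer in an entry, if there is one. -/
def TableauEntry.plainPart : TableauEntry → Option ℕ
  | plain k => some k
  | primed _ => none
  | both k _ => some k

/-- The primed integer in an entry, if there is one. -/
def TableauEntry.primedPart : TableauEntry → Option ℕ
  | plain _ => none
  | primed l => some l
  | both _ l => some l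

/-- The weight of an entry: `u_k` for `k`, `v_l` for `l'`, and `u_k + v_l` for `(k, l')`. -/
def TableauEntry.weight {A : Type} [CommRing A] (u v : ℕ → A) : TableauEntry → A
  | plain k => u k
  | primed l => v l
  | both k l => u k + v l

/-- The boxes of the skew diagram `kap/lam`: in row `i` these are the columns `j` with
`lam i < j ≤ kap i`. -/
noncomputable def skewBoxes {n : ℕ} (kap lam : Fin n → ℤ) : Finset (Σ _ : Fin n, ℤ) :=
  Finset.univ.sigma fun i => Finset.Ioc (lam i) (kap i)

/-- The fillings of the boxes of `kap/lam`. -/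
abbrev Filling {n : ℕ} (kap lam : Fin n → ℤ) : Type := ↥(skewBoxes kap lam) → TableauEntry

/-- `T` is a tableau on `kap/lam` with row bounds `p` and `q`. A box `b` has row `b.1.1` and
column `b.1.2`. -/
structure IsTableau {n : ℕ} (p q : Fin n → ℕ) {kap lam : Fin n → ℤ} (T : Filling kap lam) :
    Prop where
  plain_bound : ∀ b, ∀ k ∈ (T b).plainPart, 1 ≤ k ∧ k ≤ p b.1.1
  primed_bound : ∀ b, ∀ l ∈ (T b).primedPart, 1 ≤ l ∧ l ≤ q b.1.1
  row_plain : ∀ b b', b.1.1 = b'.1.1 → b.1.2 < b'.1.2 →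
    ∀ k ∈ (T b).plainPart, ∃ k' ∈ (T b').plainPart, k ≤ k'
  row_primed : ∀ b b', b.1.1 = b'.1.1 → b.1.2 < b'.1.2 →
    ∀ l ∈ (T b).primedPart, ∃ l' ∈ (T b').primedPart, l < l'
  col_plain : ∀ b b', b.1.2 = b'.1.2 → b.1.1 < b'.1.1 →
    ∀ k ∈ (T b).plainPart, ∃ k' ∈ (T b').plainPart, k < k'
  col_primed : ∀ b b', b.1.2 = b'.1.2 → b.1.1 < b'.1.1 →
    ∀ l ∈ (T b).primedPart, ∃ l' ∈ (T b').primedPart, l ≤ l'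
  row_both : ∀ b b', b.1.1 = b'.1.1 → b'.1.2 = b.1.2 + 1 →
    ∀ k l, T b = .both k l → ∃ m, T b' = .both (k + m) (l + m + 1)
  col_both : ∀ b b', b.1.2 = b'.1.2 → (b'.1.1 : ℕ) = (b.1.1 : ℕ) + 1 →
    ∀ k l, T b = .both k l → ∃ m, T b' = .both (k + m + 1) (l + m)

/-- `T` is a dual tableau on `kap/lam` with row bounds `p` and `q`: the bounds are those of a
tableau, and all the conditions on the ordering are reversed. -/
structure IsDualTableau {n : ℕ} (p q : Fin n → ℕ) {kap lam : Fin n → ℤ} (T : Filling kap lam) :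
    Prop where
  plain_bound : ∀ b, ∀ k ∈ (T b).plainPart, 1 ≤ k ∧ k ≤ p b.1.1
  primed_bound : ∀ b, ∀ l ∈ (T b).primedPart, 1 ≤ l ∧ l ≤ q b.1.1
  row_plain : ∀ b b', b.1.1 = b'.1.1 → b'.1.2 < b.1.2 →
    ∀ k ∈ (T b).plainPart, ∃ k' ∈ (T b').plainPart, k ≤ k'
  row_primed : ∀ b b', b.1.1 = b'.1.1 → b'.1.2 < b.1.2 →
    ∀ l ∈ (T b).primedPart, ∃ l' ∈ (T b').primedPart, l < l'
  col_plain : ∀ b b', b.1.2 = b'.1.2 → b'.1.1 < b.1.1 →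
    ∀ k ∈ (T b).plainPart, ∃ k' ∈ (T b').plainPart, k < k'
  col_primed : ∀ b b', b.1.2 = b'.1.2 → b'.1.1 < b.1.1 →
    ∀ l ∈ (T b).primedPart, ∃ l' ∈ (T b').primedPart, l ≤ l'
  row_both : ∀ b b', b.1.1 = b'.1.1 → b.1.2 = b'.1.2 + 1 →
    ∀ k l, T b = .both k l → ∃ m, T b' = .both (k + m) (l + m + 1)
  col_both : ∀ b b', b.1.2 = b'.1.2 → (b.1.1 : ℕ) = (b'.1.1 : ℕ) + 1 →
    ∀ k l, T b = .both k l → ∃ m, T b' = .both (k + m + 1) (l + m)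

/-- Only finitely many fillings satisfy the bounds, so that sums over tableaux and dual tableaux
are finite. -/
theorem finite_bounded_fillings {n : ℕ} (p q : Fin n → ℕ) (kap lam : Fin n → ℤ) :
    {T : Filling kap lam | (∀ b, ∀ k ∈ (T b).plainPart, 1 ≤ k ∧ k ≤ p b.1.1) ∧
      (∀ b, ∀ l ∈ (T b).primedPart, 1 ≤ l ∧ l ≤ q b.1.1)}.Finite := by
  have hE : ∀ N M : ℕ, {e : TableauEntry | (∀ k ∈ e.plainPart, k ≤ N) ∧
      (∀ l ∈ e.primedPart, l ≤ M)}.Finite := by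
    intro N M
    refine (((Set.finite_Iic N).image TableauEntry.plain).union
      (((Set.finite_Iic M).image TableauEntry.primed).union
      (((Set.finite_Iic N).prod (Set.finite_Iic M)).image
        fun a => TableauEntry.both a.1 a.2))).subset ?_
    rintro (k | l | ⟨k, l⟩) ⟨h1, h2⟩
    · exact Or.inl ⟨k, h1 k rfl, rfl⟩
    · exact Or.inr (Or.inl ⟨l, h2 l rfl, rfl⟩)
    · exact Or.inr (Or.inr ⟨(k, l), ⟨h1 k rfl, h2 l rfl⟩, rfl⟩)
  refine (Set.Finite.pi' fun b : ↥(skewBoxes kap lam) => hE (p b.1.1) (q b.1.1)).subset ?_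
  rintro T ⟨h1, h2⟩ b
  exact ⟨fun k hk => (h1 b k hk).2, fun l hl => (h2 b l hl).2⟩

/-- The weight of a filling, the product of the weights of its entries. -/
noncomputable def fillingWeight {A : Type} [CommRing A] (u v : ℕ → A) {n : ℕ} {kap lam : Fin n → ℤ}
    (T : Filling kap lam) : A :=
  ∏ b, (T b).weight u v

/-! ### The data attached to a 321-avoiding permutation -/

/-- The sequence `κ_i = q_i + 1 + i`, for `1 ≤ i ≤ n`. -/
def kappaSeq {n : ℕ} (q : Fin n → ℤ) (i : Fin n) : ℤ := q i + 1 + ((i : ℤ) + 1)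

/-- The sequence `ρ_i = p_i + i`, for `1 ≤ i ≤ n`. -/
def rhoSeq {n : ℕ} (p : Fin n → ℤ) (i : Fin n) : ℤ := p i + ((i : ℤ) + 1)

/-- The tableaux on `κ/λ`: plain entries in row `i` are at most `max(-q_i, 0)`, primed entries are
at most `max(q_i, 0)`. -/
def tableaux321 {n : ℕ} (q lam : Fin n → ℤ) : Set (Filling (kappaSeq q) lam) :=
  {T | IsTableau (fun i => (-q i).toNat) (fun i => (q i).toNat) T}

/-- The dual tableaux on `ν/ρ`: plain entries in row `i` are at most `max(p_i, 0)`, primed entries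
are at most `max(-p_i, 0)`. -/
def dualTableaux321 {n : ℕ} (p nu : Fin n → ℤ) : Set (Filling nu (rhoSeq p)) :=
  {T | IsDualTableau (fun i => (p i).toNat) (fun i => (-p i).toNat) T}

/-- The weight of a tableau on `κ/λ`: `k` has weight `ỹ_k = -y_{1-k}` and `l'` has weight `y_l`. -/
noncomputable def weightY (A : Type) [CommRing A] {n : ℕ} {kap lam : Fin n → ℤ}
    (T : Filling kap lam) : MvPolynomial XY A :=
  fillingWeight (fun k => -yVar A (1 - (k : ℤ))) (fun l => yVar A (l : ℤ)) T

/-- The weight of a dual tableau on `ν/ρ`: `k` has weight `x_k` and `l'` has weight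
`x̃_l = -x_{1-l}`. -/
noncomputable def weightX (A : Type) [CommRing A] {n : ℕ} {kap lam : Fin n → ℤ}
    (T : Filling kap lam) : MvPolynomial XY A :=
  fillingWeight (fun k => xVar A (k : ℤ)) (fun l => -xVar A (1 - (l : ℤ))) T

open Classical in
/-- The weakly decreasing sequences `lam` with `hi ⊃ lam ⊃ lo`. -/
noncomputable def seqBetween {n : ℕ} (lo hi : Fin n → ℤ) : Finset (Fin n → ℤ) :=
  (Finset.Icc lo hi).filter fun lam => Antitone lam

/-! Both sides are computed as one determinant, `excedanceDet`, whose (i,j) entry is the coefficient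
of t^{q_i+1-p_j} in Y_{q_i}(t) c(t) X_{p_j}(t). Here Y_q is ∏_{l≤q}(1+y_l t) for q ≥ 0 and ∏_{q<l≤0}
1/(1+y_l t) for q ≤ 0, and X_p is defined likewise from the factors 1/(1-x_l t).

Schubert side. Double Schubert polynomials are matrix coefficients of a product of operators h_k(a)
= 1 + a u_k of the nilCoxeter algebra (Fomin–Kirillov). The Yang–Baxter equation gives the divided
difference recursion, and counting inversions gives the value at the longest element; hence
`doubleSchubert_eq_nilPoly`. If w avoids 321, its inversions start at excedances p_1 > … > p_n and
end elsewhere, so a descent moves one of n particles one step into an empty place. The particles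
behave like free fermions: the value at w is an n×n minor of a one-particle matrix
(`IsMinorFunction.nilOp`), and this matrix has an explicit generating function
(`particleRows_eq_coeffInt`). After translation, the factors with indices in (-m, 0] combine to the
substituted series c, so `excedanceDet` with the universal c satisfies the definition of the
enriched Schubert polynomial (`isEnrichedSchubert_excedanceDet`). No other polynomial does, because
the specializations of c, x, y attain all values of any finite set of variables over ℂ
(`IsEnrichedSchubert.unique`).

Tableau side. Applying Cauchy–Binet twice to the product Y · c · X gives a sum over λ ⊃ ν of three
determinants (`det_coeffInt_mul`). The first counts flagged tableaux, by removing extremal entries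
one at a time (`flagDet_eq_tableauSum`); the third counts dual tableaux, by a half turn. The middle
one is a skew Schur determinant, which expands in the S_μ(c) with Littlewood–Richardson coefficients
(`exists_det_chernSeries_eq_sum`); this follows from the Cauchy identity in alternant form. If w
fixes all i ≤ 0, then c = 1 and a single application of Cauchy–Binet suffices. -/

/-! ### The nilCoxeter algebra and double Schubert polynomials -/

section NilCoxeter

variable {R : Type*} [CommRing R]

/-- The operator `(u_k g)(w) = g(w s_k)` if `w(k) > w(k+1)`, and `0` otherwise. -/
def descentOp (R : Type*) [CommRing R] (k : ℤ) : Module.End R (Equiv.Perm ℤ → R) where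
  toFun g w := if w (k + 1) < w k then g (w * Equiv.swap k (k + 1)) else 0
  map_add' f g := by
    ext w
    simp only [Pi.add_apply]
    split_ifs <;> simp
  map_smul' a g := by
    ext w
    simp only [Pi.smul_apply, RingHom.id_apply]
    split_ifs <;> simp

theorem descentOp_apply (k : ℤ) (g : Equiv.Perm ℤ → R) (w : Equiv.Perm ℤ) :
    descentOp R k g w = if w (k + 1) < w k then g (w * Equiv.swap k (k + 1)) else 0 := rfl

theorem descentOp_mul_self (k : ℤ) : descentOp R k * descentOp R k = 0 := by
  refine LinearMap.ext fun g => funext fun w => ?_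
  simp only [Module.End.mul_apply, descentOp_apply, Equiv.Perm.mul_apply, Equiv.swap_apply_left,
    Equiv.swap_apply_right, LinearMap.zero_apply, Pi.zero_apply]
  split_ifs <;> first | rfl | (exfalso; omega)

theorem descentOp_commute {k l : ℤ} (h : k + 1 < l) :
    descentOp R k * descentOp R l = descentOp R l * descentOp R k := by
  refine LinearMap.ext fun g => funext fun w => ?_
  simp only [Module.End.mul_apply, descentOp_apply, Equiv.Perm.mul_apply]
  simp only [
    Equiv.swap_apply_of_ne_of_ne (a := k) (b := k + 1) (x := l) (by omega) (by omega),
    Equiv.swap_apply_of_ne_of_ne (a := k) (b := k + 1) (x := l + 1) (by omega) (by omega),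
    Equiv.swap_apply_of_ne_of_ne (a := l) (b := l + 1) (x := k) (by omega) (by omega),
    Equiv.swap_apply_of_ne_of_ne (a := l) (b := l + 1) (x := k + 1) (by omega) (by omega),
    mul_assoc]
  have : Equiv.swap k (k + 1) * Equiv.swap l (l + 1)
      = Equiv.swap l (l + 1) * Equiv.swap k (k + 1) := by
    refine (Equiv.Perm.Disjoint.commute fun x => ?_).eq
    by_cases h1 : x = k ∨ x = k + 1
    · right
      rw [Equiv.swap_apply_of_ne_of_ne] <;> omega
    · left
      rw [Equiv.swap_apply_of_ne_of_ne] <;> omega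
  simp only [this]
  split_ifs <;> rfl

theorem descentOp_braid (k : ℤ) :
    descentOp R k * descentOp R (k + 1) * descentOp R k =
      descentOp R (k + 1) * descentOp R k * descentOp R (k + 1) := by
  refine LinearMap.ext fun g => funext fun w => ?_
  have e1 : Equiv.swap (k + 1) (k + 1 + 1) k = k :=
    Equiv.swap_apply_of_ne_of_ne (by omega) (by omega)
  have e2 : Equiv.swap k (k + 1) (k + 1 + 1) = k + 1 + 1 :=
    Equiv.swap_apply_of_ne_of_ne (by omega) (by omega)
  have e3 : w * Equiv.swap k (k + 1) * Equiv.swap (k + 1) (k + 1 + 1) * Equiv.swap k (k + 1)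
      = w * Equiv.swap (k + 1) (k + 1 + 1) * Equiv.swap k (k + 1) *
        Equiv.swap (k + 1) (k + 1 + 1) := by
    simp only [mul_assoc]
    congr 1
    ext x
    simp only [Equiv.Perm.mul_apply, Equiv.swap_apply_def]
    split_ifs <;> omega
  simp only [Module.End.mul_apply, descentOp_apply, Equiv.Perm.mul_apply, Equiv.swap_apply_left,
    Equiv.swap_apply_right, e1, e2, e3]
  split_ifs <;> rfl

/-- The operator `h_k(a) = 1 + a u_k`. -/
def nilOp (k : ℤ) (a : R) : Module.End R (Equiv.Perm ℤ → R) := 1 + a • descentOp R k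

theorem nilOp_apply (k : ℤ) (a : R) (g : Equiv.Perm ℤ → R) (w : Equiv.Perm ℤ) :
    nilOp k a g w =
      g w + a * if w (k + 1) < w k then g (w * Equiv.swap k (k + 1)) else 0 := rfl

theorem nilOp_mul_nilOp (k : ℤ) (a b : R) : nilOp k a * nilOp k b = nilOp k (a + b) := by
  simp only [nilOp, mul_add, add_mul, smul_mul_assoc, mul_smul_comm, descentOp_mul_self, one_mul,
    mul_one, add_smul, smul_zero, add_zero]
  abel

theorem nilOp_commute {k l : ℤ} (h : k + 1 < l) (a b : R) :
    nilOp k a * nilOp l b = nilOp l b * nilOp k a := by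
  simp only [nilOp, mul_add, add_mul, smul_mul_assoc, mul_smul_comm, descentOp_commute h, one_mul,
    mul_one]
  module

/-- After expansion, u_k² = 0 and u_{k+1}² = 0 leave equal linear and quadratic terms on both sides;
the cubic terms agree by the braid relation. -/
theorem nilOp_yangBaxter (k : ℤ) (a b : R) :
    nilOp k a * nilOp (k + 1) (a + b) * nilOp k b =
      nilOp (k + 1) b * nilOp k (a + b) * nilOp (k + 1) a := by
  simp only [nilOp, mul_add, add_mul, smul_mul_assoc, mul_smul_comm, descentOp_mul_self,
    descentOp_braid, one_mul, mul_one, add_smul, smul_zero, smul_add, smul_smul]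
  module

/-- The product `h_i(x - y_j) h_{i+1}(x - y_{j+1}) ⋯` with `m` factors. -/
def nilRow (y : ℤ → R) (x : R) : ℤ → ℤ → ℕ → Module.End R (Equiv.Perm ℤ → R)
  | _, _, 0 => 1
  | i, j, m + 1 => nilOp i (x - y j) * nilRow y x (i + 1) (j + 1) m

theorem nilOp_mul_nilRow {k i : ℤ} (h : k + 1 < i) (a : R) (y : ℤ → R) (x : R) (j : ℤ) (m : ℕ) :
    nilOp k a * nilRow y x i j m = nilRow y x i j m * nilOp k a := by
  induction m generalizing i j with
  | zero => simp [nilRow]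
  | succ m ih =>
    rw [nilRow, ← mul_assoc, nilOp_commute h, mul_assoc, ih (by omega), mul_assoc]

/-- The train argument: each use of Yang–Baxter moves the factor h(x' - x) one column to the right
and exchanges x and x' there. In the last column it is absorbed by h(a)h(b) = h(a+b). -/
theorem nilOp_mul_nilRow_mul_nilRow (y : ℤ → R) (x x' : R) (i j : ℤ) (m : ℕ) :
    nilOp i (x' - x) * (nilRow y x' (i + 1) j m * nilRow y x i j (m + 1)) =
      nilRow y x (i + 1) j m * nilRow y x' i j (m + 1) := by
  induction m generalizing i j with
  | zero =>
    simp only [nilRow, one_mul, mul_one, nilOp_mul_nilOp]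
    congr 1
    ring
  | succ m ih =>
    have e : x' - y j = (x' - x) + (x - y j) := by ring
    calc nilOp i (x' - x) * (nilRow y x' (i + 1) j (m + 1) * nilRow y x i j (m + 1 + 1))
        = nilOp i (x' - x) * (nilOp (i + 1) (x' - y j) *
            (nilRow y x' (i + 1 + 1) (j + 1) m * nilOp i (x - y j)) *
              nilRow y x (i + 1) (j + 1) (m + 1)) := by
          simp only [nilRow, mul_assoc]
      _ = (nilOp i (x' - x) * nilOp (i + 1) (x' - y j) * nilOp i (x - y j)) *
            (nilRow y x' (i + 1 + 1) (j + 1) m * nilRow y x (i + 1) (j + 1) (m + 1)) := by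
          rw [← nilOp_mul_nilRow (by omega)]
          simp only [mul_assoc]
      _ = nilOp (i + 1) (x - y j) * nilOp i (x' - y j) * (nilOp (i + 1) (x' - x) *
            (nilRow y x' (i + 1 + 1) (j + 1) m * nilRow y x (i + 1) (j + 1) (m + 1))) := by
          rw [e, nilOp_yangBaxter]
          simp only [mul_assoc]
      _ = nilOp (i + 1) (x - y j) * (nilOp i (x' - y j) * nilRow y x (i + 1 + 1) (j + 1) m) *
            nilRow y x' (i + 1) (j + 1) (m + 1) := by
          rw [ih]
          simp only [mul_assoc]
      _ = _ := by
          rw [nilOp_mul_nilRow (by omega)]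
          simp only [nilRow, mul_assoc]

/-- The product of the rows `r, r - 1, …, 1` of the factorized generating operator of the double
Schubert polynomials of `S_N`. -/
def nilRows (x y : ℤ → R) (N : ℕ) : ℕ → Module.End R (Equiv.Perm ℤ → R)
  | 0 => 1
  | r + 1 => nilRow y (x ((r + 1 : ℕ) : ℤ)) ((r + 1 : ℕ) : ℤ) 1 (N - (r + 1)) * nilRows x y N r

theorem nilRows_congr {x x' : ℤ → R} (y : ℤ → R) (N : ℕ) {r : ℕ}
    (h : ∀ i : ℕ, i ≤ r → x i = x' i) : nilRows x y N r = nilRows x' y N r := by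
  induction r with
  | zero => rfl
  | succ r ih => rw [nilRows, nilRows, ih fun i hi => h i (by omega), h _ le_rfl]

/-- The rows above k+1 involve only h_l with l > k+1, so h_k commutes past them; then it exchanges
the spectral parameters of the rows k+1 and k. -/
theorem nilOp_mul_nilRows (x y : ℤ → R) {N k r : ℕ} (hk : 0 < k) (hkN : k < N) (hr : k < r) :
    nilOp (k : ℤ) (x (k + 1) - x k) * nilRows x y N r =
      nilRows (x ∘ Equiv.swap (k : ℤ) (k + 1)) y N r := by
  induction r, hr using Nat.le_induction with
  | base =>
    obtain ⟨k, rfl⟩ : ∃ l, k = l + 1 := ⟨k - 1, by omega⟩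
    obtain ⟨m, hm⟩ : ∃ m, N - (k + 1) = m + 1 := ⟨N - (k + 1) - 1, by omega⟩
    have hm' : N - (k + 1 + 1) = m := by omega
    have hc : nilRows (x ∘ Equiv.swap ((k + 1 : ℕ) : ℤ) ((k + 1 : ℕ) + 1)) y N k
        = nilRows x y N k := by
      refine nilRows_congr y N fun i hi => ?_
      rw [Function.comp_apply, Equiv.swap_apply_of_ne_of_ne] <;> push_cast <;> omega
    have key := nilOp_mul_nilRow_mul_nilRow y (x ((k + 1 : ℕ) : ℤ)) (x ((k + 1 : ℕ) + 1))
      ((k + 1 : ℕ) : ℤ) 1 m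
    simp only [nilRows, hc, hm, hm', Function.comp_apply]
    rw [← mul_assoc (nilRow _ _ _ _ m), ← mul_assoc (nilRow _ _ _ _ m), ← mul_assoc]
    rw [Nat.cast_succ (k + 1), key, Equiv.swap_apply_left, Equiv.swap_apply_right]
  | succ r hr ih =>
    rw [nilRows, nilRows, ← mul_assoc, nilOp_mul_nilRow (by push_cast; omega), mul_assoc, ih]
    rw [Function.comp_apply, Equiv.swap_apply_of_ne_of_ne] <;> push_cast <;> omega

open Classical in
/-- The indicator function of the identity. -/
noncomputable def permDelta (R : Type*) [CommRing R] (w : Equiv.Perm ℤ) : R :=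
  if w = 1 then 1 else 0

/-- The polynomial attached to `w` by the generating operator of `S_N`. -/
noncomputable def nilPoly (x y : ℤ → R) (N : ℕ) (w : Equiv.Perm ℤ) : R :=
  nilRows x y N N (permDelta R) w

/-- The divided difference recursion, read off by evaluating the exchange of x_k and x_{k+1} at a
permutation with a descent at k. -/
theorem sub_nilPoly_swap (x y : ℤ → R) {N k : ℕ} (hk : 0 < k) (hkN : k < N)
    {w : Equiv.Perm ℤ} (hw : w (k + 1) < w k) :
    nilPoly x y N w - nilPoly (x ∘ Equiv.swap (k : ℤ) (k + 1)) y N w =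
      (x k - x (k + 1)) * nilPoly x y N (w * Equiv.swap (k : ℤ) (k + 1)) := by
  rw [nilPoly, nilPoly, ← nilOp_mul_nilRows x y hk hkN hkN, Module.End.mul_apply, nilOp_apply,
    if_pos hw, nilPoly]
  ring

/-! ### Naturality in the coefficient ring -/

section Map

variable {S : Type*} [CommRing S] (f : R →+* S)

theorem map_nilRow (y : ℤ → R) (x : R) (i j : ℤ) (m : ℕ) (g : Equiv.Perm ℤ → R)
    (w : Equiv.Perm ℤ) :
    f (nilRow y x i j m g w) = nilRow (f ∘ y) (f x) i j m (f ∘ g) w := by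
  induction m generalizing i j w with
  | zero => rfl
  | succ m ih =>
    simp only [nilRow, Module.End.mul_apply, nilOp_apply, map_add, map_mul, map_sub, ih,
      apply_ite f,
      map_zero, Function.comp_apply]

theorem map_nilRows (x y : ℤ → R) (N r : ℕ) (g : Equiv.Perm ℤ → R) (w : Equiv.Perm ℤ) :
    f (nilRows x y N r g w) = nilRows (f ∘ x) (f ∘ y) N r (f ∘ g) w := by
  induction r generalizing w with
  | zero => rfl
  | succ r ih =>
    simp only [nilRows, Module.End.mul_apply, map_nilRow, Function.comp_apply]
    rw [← show f ∘ nilRows x y N r g = nilRows (f ∘ x) (f ∘ y) N r (f ∘ g) from _root_.funext ih]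

theorem map_nilPoly (x y : ℤ → R) (N : ℕ) (w : Equiv.Perm ℤ) :
    f (nilPoly x y N w) = nilPoly (f ∘ x) (f ∘ y) N w := by
  have h : f ∘ permDelta R = permDelta S := by
    refine _root_.funext fun v => ?_
    simp [permDelta, apply_ite f]
  rw [nilPoly, map_nilRows, nilPoly, h]

end Map

/-! ### Stability -/

/-- The functions `g` and `g'` agree on the permutations fixing all `i > n`. -/
def AgreeUpTo (n : ℕ) (g g' : Equiv.Perm ℤ → R) : Prop :=
  ∀ w : Equiv.Perm ℤ, (∀ j : ℤ, n < j → w j = j) → g w = g' w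

theorem apply_le_of_fixed {n : ℕ} {w : Equiv.Perm ℤ} (hw : ∀ j : ℤ, n < j → w j = j) {i : ℤ}
    (hi : i ≤ n) : w i ≤ n := by
  by_contra h
  push Not at h
  have := w.injective (hw _ h)
  omega

/-- A permutation fixing all j > n has no descent at any k ≥ n, so only the identity term of h_k
contributes. -/
theorem AgreeUpTo.nilOp_high {n : ℕ} {g g' : Equiv.Perm ℤ → R} (h : AgreeUpTo n g g') {k : ℤ}
    (hk : (n : ℤ) ≤ k) (a : R) : AgreeUpTo n (nilOp k a g) g' := by
  intro w hw
  rw [nilOp_apply, if_neg, mul_zero, add_zero, h w hw]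
  rw [hw (k + 1) (by omega)]
  rcases hk.lt_or_eq with hk | hk
  · rw [hw k hk]
    omega
  · have := apply_le_of_fixed hw hk.ge
    omega

theorem AgreeUpTo.nilOp_low {n : ℕ} {g g' : Equiv.Perm ℤ → R} (h : AgreeUpTo n g g') {k : ℤ}
    (hk : k < n) (a : R) : AgreeUpTo n (nilOp k a g) (nilOp k a g') := by
  intro w hw
  rw [nilOp_apply, nilOp_apply, h w hw, h (w * Equiv.swap k (k + 1))]
  intro j hj
  rw [Equiv.Perm.mul_apply, Equiv.swap_apply_of_ne_of_ne (by omega) (by omega), hw j hj]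

/-- Of the M factors only the first m, those of index below n, act nontrivially. The case m = 0 also
covers rows that start at or beyond n. -/
theorem AgreeUpTo.nilRow {n : ℕ} {g g' : Equiv.Perm ℤ → R} (h : AgreeUpTo n g g') (y : ℤ → R)
    (x : R) (i j : ℤ) {m M : ℕ} (hM : m ≤ M) (h1 : (n : ℤ) ≤ i + m) (h2 : m = 0 ∨ i + m ≤ n) :
    AgreeUpTo n (nilRow y x i j M g) (nilRow y x i j m g') := by
  induction M generalizing i j m with
  | zero =>
    obtain rfl : m = 0 := by omega
    exact h
  | succ M ih =>
    cases m with
    | zero =>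
      exact AgreeUpTo.nilOp_high (g' := g')
        (ih (i + 1) (j + 1) (Nat.zero_le M) (by push_cast at h1 ⊢; omega) (Or.inl rfl))
        (by simpa using h1) _
    | succ m =>
      have h3 := h2.resolve_left (Nat.succ_ne_zero m)
      push_cast at h1 h3
      exact (ih (i + 1) (j + 1) (m := m) (by omega) (by omega) (Or.inr (by omega))).nilOp_low
        (by omega) _

theorem agreeUpTo_nilRows (x y : ℤ → R) {n N : ℕ} (h : n ≤ N) (g : Equiv.Perm ℤ → R) (r : ℕ) :
    AgreeUpTo n (nilRows x y N r g) (nilRows x y n (min r n) g) := by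
  induction r with
  | zero =>
    rw [Nat.zero_min]
    exact fun _ _ => rfl
  | succ r ih =>
    rcases le_or_gt (r + 1) n with hr | hr
    · rw [min_eq_left hr]
      rw [min_eq_left (by omega)] at ih
      exact ih.nilRow y _ _ _ (by omega) (by omega) (by omega)
    · rw [min_eq_right hr.le]
      rw [min_eq_right (by omega)] at ih
      exact ih.nilRow y _ _ _ (m := 0) (by omega) (by push_cast; omega) (by omega)

theorem nilPoly_stable (x y : ℤ → R) {n N : ℕ} (h : n ≤ N) {w : Equiv.Perm ℤ}
    (hw : ∀ j : ℤ, n < j → w j = j) : nilPoly x y N w = nilPoly x y n w := by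
  have := agreeUpTo_nilRows x y h (permDelta R) N w hw
  rwa [min_eq_right h] at this

/-! ### Inversions -/

/-- The number of inversions of `w` in `{1, …, n}`. -/
noncomputable def invCount (n : ℕ) (w : Equiv.Perm ℤ) : ℕ :=
  ((Finset.Icc (1 : ℤ) n ×ˢ Finset.Icc (1 : ℤ) n).filter
    fun b => b.1 < b.2 ∧ w b.2 < w b.1).card

theorem swap_succ_lt_swap_succ {k i j : ℤ} (h : i < j) (hne : ¬ (i = k ∧ j = k + 1)) :
    Equiv.swap k (k + 1) i < Equiv.swap k (k + 1) j := by
  simp only [Equiv.swap_apply_def]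
  split_ifs <;> omega

theorem swap_succ_mem_Icc {n : ℕ} {k i : ℤ} (hk : 0 < k) (hkn : k < n)
    (hi : i ∈ Finset.Icc (1 : ℤ) n) : Equiv.swap k (k + 1) i ∈ Finset.Icc (1 : ℤ) n := by
  rw [Finset.mem_Icc] at hi ⊢
  simp only [Equiv.swap_apply_def]
  split_ifs <;> omega

/-- Applying s_k to both positions is a bijection from the inversions of w other than (k, k+1) to
the inversions of w s_k. -/
theorem invCount_mul_swap {n : ℕ} {k : ℤ} (hk : 0 < k) (hkn : k < n) {w : Equiv.Perm ℤ}
    (hw : w (k + 1) < w k) :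
    invCount n w = invCount n (w * Equiv.swap k (k + 1)) + 1 := by
  classical
  have hkk : ((k, k + 1) : ℤ × ℤ) ∈ (Finset.Icc (1 : ℤ) n ×ˢ Finset.Icc (1 : ℤ) n).filter
      fun b => b.1 < b.2 ∧ w b.2 < w b.1 := by
    simp only [Finset.mem_filter, Finset.mem_product, Finset.mem_Icc]
    omega
  rw [invCount, ← Finset.card_erase_add_one hkk, invCount]
  congr 1
  refine Finset.card_nbij'
    (fun b => (Equiv.swap k (k + 1) b.1, Equiv.swap k (k + 1) b.2))
    (fun b => (Equiv.swap k (k + 1) b.1, Equiv.swap k (k + 1) b.2)) ?_ ?_ ?_ ?_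
  · rintro ⟨i, j⟩ hb
    simp only [Finset.mem_coe, Finset.mem_erase, Finset.mem_filter, Finset.mem_product, ne_eq,
      Prod.mk.injEq] at hb ⊢
    simp only [Equiv.Perm.mul_apply, Equiv.swap_apply_self]
    exact ⟨⟨swap_succ_mem_Icc hk hkn hb.2.1.1, swap_succ_mem_Icc hk hkn hb.2.1.2⟩,
      swap_succ_lt_swap_succ hb.2.2.1 hb.1, hb.2.2.2⟩
  · rintro ⟨i, j⟩ hb
    simp only [Finset.mem_coe, Finset.mem_erase, Finset.mem_filter, Finset.mem_product, ne_eq,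
      Prod.mk.injEq] at hb ⊢
    simp only [Equiv.Perm.mul_apply] at hb
    have hne : ¬ (i = k ∧ j = k + 1) := by
      rintro ⟨rfl, rfl⟩
      rw [Equiv.swap_apply_left, Equiv.swap_apply_right] at hb
      omega
    refine ⟨?_, ⟨swap_succ_mem_Icc hk hkn hb.1.1, swap_succ_mem_Icc hk hkn hb.1.2⟩,
      swap_succ_lt_swap_succ hb.2.1 hne, hb.2.2⟩
    rintro ⟨h1, h2⟩
    rw [Equiv.swap_apply_eq_iff, Equiv.swap_apply_left] at h1
    rw [Equiv.swap_apply_eq_iff, Equiv.swap_apply_right] at h2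
    omega
  · rintro ⟨i, j⟩ _
    simp
  · rintro ⟨i, j⟩ _
    simp

theorem invCount_longestPerm (n : ℕ) :
    invCount n (longestPerm n) = ∑ i ∈ Finset.range n, (n - (i + 1)) := by
  have h : ∀ b ∈ Finset.Icc (1 : ℤ) n ×ˢ Finset.Icc (1 : ℤ) n,
      ((b.1 < b.2 ∧ longestPerm n b.2 < longestPerm n b.1) ↔ b.1 < b.2) := by
    rintro ⟨i, j⟩ hb
    simp only [Finset.mem_product, Finset.mem_Icc] at hb
    have hl : ∀ i : ℤ, 1 ≤ i ∧ i ≤ n → longestPerm n i = n + 1 - i := fun i hi => if_pos hi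
    rw [hl _ hb.1, hl _ hb.2]
    simp only
    omega
  rw [invCount, Finset.filter_congr h, Finset.card_filter, Finset.sum_product]
  have h2 : Finset.Icc (1 : ℤ) n = (Finset.range n).image fun i : ℕ => (i : ℤ) + 1 := by
    ext i
    simp only [Finset.mem_Icc, Finset.mem_image, Finset.mem_range]
    constructor
    · intro hi
      exact ⟨(i - 1).toNat, by omega, by omega⟩
    · rintro ⟨j, hj, rfl⟩
      omega
  conv_lhs => rw [h2]
  rw [Finset.sum_image (by intro a _ b _ hab; simp only at hab; omega)]
  refine Finset.sum_congr rfl fun i hi => ?_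
  rw [Finset.sum_image (by intro a _ b _ hab; simp only at hab; omega), ← Finset.card_filter]
  have h3 : (Finset.range n).filter (fun j : ℕ => (i : ℤ) + 1 < j + 1) = Finset.Ico (i + 1) n := by
    ext j
    simp only [Finset.mem_filter, Finset.mem_range, Finset.mem_Ico]
    omega
  rw [h3, Nat.card_Ico]

/-! ### The longest element -/

/-- `g` vanishes on permutations with more than `r` inversions in `{1, …, n}`. -/
def InvBounded (n r : ℕ) (g : Equiv.Perm ℤ → R) : Prop :=
  ∀ w, r < invCount n w → g w = 0

theorem InvBounded.nilOp {n r : ℕ} {g : Equiv.Perm ℤ → R} (h : InvBounded n r g) {k : ℤ}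
    (hk : 0 < k) (hkn : k < n) (a : R) : InvBounded n (r + 1) (nilOp k a g) := by
  intro w hw
  rw [nilOp_apply, h w (by omega), zero_add]
  split_ifs with hd
  · rw [invCount_mul_swap hk hkn hd] at hw
    rw [h _ (by omega), mul_zero]
  · rw [mul_zero]

theorem InvBounded.nilRow {n r : ℕ} {g : Equiv.Perm ℤ → R} (h : InvBounded n r g) (y : ℤ → R)
    (x : R) {i : ℤ} (j : ℤ) {m : ℕ} (hi : 0 < i) (hm : i + m ≤ n) :
    InvBounded n (r + m) (nilRow y x i j m g) := by
  induction m generalizing i j with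
  | zero => exact h
  | succ m ih =>
    exact (ih (j + 1) (i := i + 1) (by omega) (by push_cast at hm; omega)).nilOp hi
      (by push_cast at hm; omega) _

theorem invBounded_permDelta (n : ℕ) : InvBounded n 0 (permDelta R) := by
  intro w hw
  rw [permDelta, if_neg]
  rintro rfl
  refine hw.ne' (Finset.card_eq_zero.mpr (Finset.filter_eq_empty_iff.mpr ?_))
  rintro b -
  simp only [Equiv.Perm.coe_one, id_eq]
  omega

theorem InvBounded.nilRows {x y : ℤ → R} {n r : ℕ} (hr : r ≤ n) :
    InvBounded n (∑ i ∈ Finset.range r, (n - (i + 1))) (nilRows x y n r (permDelta R)) := by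
  induction r with
  | zero => exact invBounded_permDelta n
  | succ r ih =>
    rw [Finset.sum_range_succ]
    exact (ih (by omega)).nilRow y _ _ (by push_cast; omega) (by omega)

/-- `w` has the values `n, …, n + 2 - i` at `1, …, i - 1`, the value `n + 1 - i` at `k`, and takes
the values `1, …, n - i` in increasing order at the other positions in `{i, …, n}`. -/
def IsPartialLongest (n : ℕ) (i k : ℤ) (w : Equiv.Perm ℤ) : Prop :=
  ∀ j : ℤ, w j = if j < 1 ∨ n < j then j else if j < i then n + 1 - j else
    if j < k then j - i + 1 else if j = k then n + 1 - i else j - i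

/-- Since w has at least r + m inversions, every one of the m factors must use its descent term.
These descents carry the value n+1-i from position k to position n and collect the product of the
coefficients. -/
theorem nilRow_apply_of_isPartialLongest {n r : ℕ} {g : Equiv.Perm ℤ → R} (y : ℤ → R) (x : R)
    (h : InvBounded n r g) {i k : ℤ} (j : ℤ) {m : ℕ} (hi : 0 < i) (hik : i ≤ k)
    (hm : k + m = n) {w : Equiv.Perm ℤ} (hw : IsPartialLongest n i k w)
    (hr : r + m ≤ invCount n w) :
    ∃ w', IsPartialLongest n i n w' ∧ r ≤ invCount n w' ∧
      nilRow y x k j m g w = (∏ s ∈ Finset.range m, (x - y (j + s))) * g w' := by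
  induction m generalizing k j w with
  | zero =>
    obtain rfl : k = n := by simpa using hm
    exact ⟨w, hw, hr, by simp [_root_.nilRow]⟩
  | succ m ih =>
    push_cast at hm
    have hk1 : w k = n + 1 - i := by
      rw [hw k, if_neg (by omega), if_neg (by omega), if_neg (by omega), if_pos rfl]
    have hk2 : w (k + 1) = k + 1 - i := by
      rw [hw (k + 1), if_neg (by omega), if_neg (by omega), if_neg (by omega), if_neg (by omega)]
    have hd : w (k + 1) < w k := by omega
    have hinv := invCount_mul_swap (n := n) (by omega : 0 < k) (by omega) hd
    have hw' : IsPartialLongest n i (k + 1) (w * Equiv.swap k (k + 1)) := by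
      intro j
      rw [Equiv.Perm.mul_apply]
      by_cases h1 : j = k
      · subst h1
        rw [Equiv.swap_apply_left, hk2, if_neg (by omega), if_neg (by omega), if_pos (by omega)]
        omega
      by_cases h2 : j = k + 1
      · subst h2
        rw [Equiv.swap_apply_right, hk1, if_neg (by omega), if_neg (by omega), if_neg (by omega),
          if_pos rfl]
      rw [Equiv.swap_apply_of_ne_of_ne h1 h2, hw j]
      split_ifs <;> omega
    obtain ⟨w', h1, h2, h3⟩ := ih (j + 1) (k := k + 1) (by omega) (by omega) hw' (by omega)
    refine ⟨w', h1, h2, ?_⟩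
    -- The remaining m factors cannot reach w itself, which has too many inversions; this kills the
    -- identity term of the first factor.
    have hb : InvBounded n (r + m) (_root_.nilRow y x (k + 1) (j + 1) m g) :=
      h.nilRow y x (j + 1) (by omega) (by omega)
    rw [_root_.nilRow, Module.End.mul_apply, nilOp_apply, if_pos hd, hb w (by omega), h3,
      Finset.prod_range_succ', zero_add, ← mul_assoc, Nat.cast_zero, add_zero,
      mul_comm (x - y j)]
    congr 2
    refine Finset.prod_congr rfl fun s _ => ?_
    rw [Nat.cast_succ, add_assoc, add_comm 1]

/-- Row r+1 moves the value n - r from position r+1 to the end, and the resulting permutation is the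
partial longest element for r. At r = 0 this is the identity. -/
theorem nilRows_apply_of_isPartialLongest (x y : ℤ → R) {n r : ℕ} (hr : r ≤ n)
    {w : Equiv.Perm ℤ} (hw : IsPartialLongest n r r w)
    (hinv : ∑ i ∈ Finset.range r, (n - (i + 1)) ≤ invCount n w) :
    nilRows x y n r (permDelta R) w =
      ∏ i ∈ Finset.range r, ∏ s ∈ Finset.range (n - (i + 1)), (x (i + 1) - y (1 + s)) := by
  induction r generalizing w with
  | zero =>
    have : w = 1 := by
      ext j
      rw [hw j, Equiv.Perm.one_apply]
      split_ifs <;> push_cast at * <;> omega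
    rw [this]
    simp [nilRows, permDelta]
  | succ r ih =>
    rw [Finset.sum_range_succ] at hinv
    obtain ⟨w', h1, h2, h3⟩ := nilRow_apply_of_isPartialLongest y (x ((r + 1 : ℕ) : ℤ))
      (InvBounded.nilRows (x := x) (y := y) (n := n) (r := r) (by omega)) 1
      (m := n - (r + 1)) (by omega) le_rfl (by omega) hw hinv
    rw [nilRows, Module.End.mul_apply, h3, Finset.prod_range_succ,
      ih (by omega) ?_ h2, mul_comm, Nat.cast_succ]
    intro j
    rw [h1 j]
    split_ifs <;> omega

theorem isPartialLongest_longestPerm (n : ℕ) : IsPartialLongest n n n (longestPerm n) := by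
  intro j
  have h : longestPerm n j = if 1 ≤ j ∧ j ≤ (n : ℤ) then (n : ℤ) + 1 - j else j := rfl
  rw [h]
  split_ifs <;> omega

theorem nilPoly_longestPerm (x y : ℤ → R) (n : ℕ) :
    nilPoly x y n (longestPerm n) =
      ∏ b ∈ (Finset.Icc 1 n ×ˢ Finset.Icc 1 n).filter (fun b : ℕ × ℕ => b.1 + b.2 ≤ n),
        (x (b.1 : ℤ) - y (b.2 : ℤ)) := by
  rw [nilPoly, nilRows_apply_of_isPartialLongest x y le_rfl (isPartialLongest_longestPerm n)
    (invCount_longestPerm n).ge, Finset.prod_sigma']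
  refine Finset.prod_bij' (fun b _ => (b.1 + 1, b.2 + 1)) (fun b _ => ⟨b.1 - 1, b.2 - 1⟩)
    ?_ ?_ ?_ ?_ ?_
  · rintro ⟨i, j⟩ h
    simp only [Finset.mem_sigma, Finset.mem_range] at h
    simp only [Finset.mem_filter, Finset.mem_product, Finset.mem_Icc]
    omega
  · rintro ⟨i, j⟩ h
    simp only [Finset.mem_filter, Finset.mem_product, Finset.mem_Icc] at h
    simp only [Finset.mem_sigma, Finset.mem_range]
    omega
  · rintro ⟨i, j⟩ _
    rfl
  · rintro ⟨i, j⟩ h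
    simp only [Finset.mem_filter, Finset.mem_product, Finset.mem_Icc] at h
    ext <;> simp only <;> omega
  · rintro ⟨i, j⟩ _
    push_cast
    rw [add_comm (1 : ℤ)]

end NilCoxeter

/-! ### Double Schubert polynomials as nilCoxeter coefficients -/

theorem xVar_injective : Function.Injective (xVar ℤ) := fun i j h => by
  simpa using X_injective h

theorem swapX_comp_xVar (k : ℤ) : swapX k ∘ xVar ℤ = xVar ℤ ∘ Equiv.swap k (k + 1) := by
  refine _root_.funext fun i => ?_
  simp [swapX, xVar]

theorem swapX_comp_yVar (k : ℤ) : swapX k ∘ yVar ℤ = yVar ℤ := by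
  refine _root_.funext fun i => ?_
  simp [swapX, yVar]

theorem dividedDifference_eq {k : ℤ} {f g : ZXY}
    (h : f - swapX k f = (xVar ℤ k - xVar ℤ (k + 1)) * g) : dividedDifference k f = g := by
  have h1 := (exists_dividedDifference k f).choose_spec.trans h
  refine mul_left_cancel₀ (sub_ne_zero.mpr fun h2 => ?_) h1
  have := xVar_injective h2
  omega

/-- This also shows that f does not depend on the chain of descents leading to w. The bound on N has
to grow along the chain, because a divided difference at k requires k < N. -/
theorem IsDoubleSchubert.eq_nilPoly {w : Equiv.Perm ℤ} {f : ZXY} (h : IsDoubleSchubert w f) :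
    ∃ N₀ : ℕ, ∀ N ≥ N₀, f = nilPoly (xVar ℤ) (yVar ℤ) N w := by
  induction h with
  | longest n =>
    refine ⟨n, fun N hN => ?_⟩
    rw [nilPoly_stable _ _ hN, nilPoly_longestPerm]
    intro j hj
    exact if_neg (by omega)
  | descent w f k hk hw hf ih =>
    obtain ⟨N₀, h⟩ := ih
    obtain ⟨k, rfl⟩ := Int.eq_ofNat_of_zero_le hk.le
    refine ⟨max N₀ (k + 1), fun N hN => dividedDifference_eq ?_⟩
    have h1 := h N (le_trans (le_max_left _ _) hN)
    have h2 := map_nilPoly (swapX k : ZXY →+* ZXY) (xVar ℤ) (yVar ℤ) N w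
    have h3 := sub_nilPoly_swap (xVar ℤ) (yVar ℤ) (N := N) (k := k) (by omega) (by omega) hw
    rw [← swapX_comp_xVar] at h3
    simp only [RingHom.coe_coe, swapX_comp_yVar] at h2
    rw [← h2, ← h1] at h3
    exact h3

/-- Descending from position 1 bounds w(j) above by n+1-j, and ascending from position n bounds it
below by the same number. -/
theorem eq_longestPerm {n : ℕ} {w : Equiv.Perm ℤ} (h0 : ∀ j ≤ 0, w j = j)
    (hn : ∀ j : ℤ, n < j → w j = j) (h : ∀ k : ℤ, 0 < k → k < n → w (k + 1) < w k) :
    w = longestPerm n := by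
  have hl : ∀ j, longestPerm n j = if 1 ≤ j ∧ j ≤ (n : ℤ) then (n : ℤ) + 1 - j else j :=
    fun j => rfl
  have hpos : ∀ j : ℤ, 0 < j → 0 < w j := by
    intro j hj
    by_contra hc
    push Not at hc
    have := w.injective (h0 _ hc)
    omega
  have up : ∀ j : ℕ, (j : ℤ) + 1 ≤ n → w (j + 1) ≤ n - j := by
    intro j
    induction j with
    | zero =>
      intro h1
      simpa using apply_le_of_fixed hn h1
    | succ j ih =>
      intro h1
      push_cast at h1 ⊢
      have := ih (by omega)
      have := h (j + 1) (by omega) (by omega)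
      omega
  have down : ∀ j : ℕ, (j : ℤ) < n → (j : ℤ) + 1 ≤ w (n - j) := by
    intro j
    induction j with
    | zero =>
      intro h1
      have := hpos n (by simpa using h1)
      simpa using Int.add_one_le_iff.mpr this
    | succ j ih =>
      intro h1
      push_cast at h1 ⊢
      have h2 := ih (by omega)
      have h3 := h (n - (j + 1)) (by omega) (by omega)
      rw [show (n : ℤ) - (j + 1) + 1 = n - j by ring] at h3
      omega
  ext j
  rw [hl]
  split_ifs with hj
  · have h1 := up (j - 1).toNat (by omega)
    have h2 := down (n - j).toNat (by omega)
    rw [show (((j - 1).toNat : ℕ) : ℤ) = j - 1 by omega] at h1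
    rw [show (((n - j).toNat : ℕ) : ℤ) = n - j by omega] at h2
    rw [show j - 1 + 1 = j by ring] at h1
    rw [show (n : ℤ) - (n - j) = j by ring] at h2
    omega
  · by_cases h1 : j ≤ 0
    · exact h0 j h1
    · exact hn j (by omega)

/-- A permutation other than the longest element has an ascent k; then w s_k has one more inversion,
and w is reached from it by a descent. The number of inversions is at most n². -/
theorem exists_isDoubleSchubert {n : ℕ} {w : Equiv.Perm ℤ} (h0 : ∀ j ≤ 0, w j = j)
    (hn : ∀ j : ℤ, n < j → w j = j) : ∃ f, IsDoubleSchubert w f := by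
  by_cases h : ∀ k : ℤ, 0 < k → k < n → w (k + 1) < w k
  · rw [eq_longestPerm h0 hn h]
    exact ⟨_, .longest n⟩
  · push Not at h
    obtain ⟨k, hk, hkn, hw⟩ := h
    have hlt : w k < w (k + 1) := lt_of_le_of_ne hw fun h => by
      have := w.injective h
      omega
    have hd : (w * Equiv.swap k (k + 1)) (k + 1) < (w * Equiv.swap k (k + 1)) k := by
      simpa [Equiv.Perm.mul_apply] using hlt
    have hinv := invCount_mul_swap hk hkn hd
    have hle : invCount n (w * Equiv.swap k (k + 1)) ≤ (n : ℕ) * n := by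
      refine (Finset.card_filter_le _ _).trans ?_
      simp [Finset.card_product]
    have hdec : n * n - invCount n (w * Equiv.swap k (k + 1)) < n * n - invCount n w := by
      rw [mul_assoc, Equiv.swap_mul_self, mul_one] at hinv
      omega
    obtain ⟨f, hf⟩ := exists_isDoubleSchubert (w := w * Equiv.swap k (k + 1)) (n := n)
      (fun j hj => by
        rw [Equiv.Perm.mul_apply, Equiv.swap_apply_of_ne_of_ne (by omega) (by omega), h0 j hj])
      (fun j hj => by
        rw [Equiv.Perm.mul_apply, Equiv.swap_apply_of_ne_of_ne (by omega) (by omega), hn j hj])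
    have := IsDoubleSchubert.descent _ f k hk hd hf
    rw [mul_assoc, Equiv.swap_mul_self, mul_one] at this
    exact ⟨_, this⟩
termination_by n * n - invCount n w

theorem doubleSchubert_eq_nilPoly {n : ℕ} {w : Equiv.Perm ℤ} (h0 : ∀ j ≤ 0, w j = j)
    (hn : ∀ j : ℤ, n < j → w j = j) :
    ∃ N₀ : ℕ, ∀ N ≥ N₀, doubleSchubert w = nilPoly (xVar ℤ) (yVar ℤ) N w := by
  have h := exists_isDoubleSchubert h0 hn
  rw [doubleSchubert, dif_pos h]
  exact h.choose_spec.eq_nilPoly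

/-! ### Coefficients of power series at integers -/

section CoeffInt

variable {A : Type} [CommRing A]

theorem coeffInt_of_neg (f : PowerSeries A) {m : ℤ} (hm : m < 0) : coeffInt f m = 0 := if_pos hm

theorem coeffInt_natCast (f : PowerSeries A) (m : ℕ) :
    coeffInt f (m : ℤ) = PowerSeries.coeff m f := by
  rw [coeffInt, if_neg (by omega), Int.toNat_natCast]

theorem coeffInt_linear_mul (a : A) (f : PowerSeries A) (m : ℤ) :
    coeffInt ((1 + PowerSeries.C a * PowerSeries.X) * f) m =
      coeffInt f m + a * coeffInt f (m - 1) := by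
  rcases lt_trichotomy m 0 with hm | rfl | hm
  · rw [coeffInt_of_neg _ hm, coeffInt_of_neg _ hm, coeffInt_of_neg _ (by omega)]
    ring
  · rw [coeffInt_of_neg (m := 0 - 1) _ (by omega)]
    have h := fun f : PowerSeries A => coeffInt_natCast f 0
    simp only [Nat.cast_zero] at h
    simp [h]
  · obtain ⟨k, rfl⟩ : ∃ k : ℕ, m = ((k + 1 : ℕ) : ℤ) := ⟨(m - 1).toNat, by omega⟩
    have : ((k + 1 : ℕ) : ℤ) - 1 = (k : ℕ) := by push_cast; ring
    rw [this, coeffInt_natCast, coeffInt_natCast, coeffInt_natCast, add_mul, one_mul, map_add,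
      mul_assoc, PowerSeries.coeff_C_mul, PowerSeries.coeff_succ_X_mul]

theorem coeffInt_one (m : ℤ) : coeffInt (1 : PowerSeries A) m = if m = 0 then 1 else 0 := by
  rcases lt_or_ge m 0 with hm | hm
  · rw [coeffInt_of_neg _ hm, if_neg hm.ne]
  · obtain ⟨k, rfl⟩ := Int.eq_ofNat_of_zero_le hm
    rw [coeffInt_natCast, PowerSeries.coeff_one]
    simp

theorem linear_mul_geomSeries (a b : A) :
    (1 + PowerSeries.C b * PowerSeries.X) * geomSeries a =
      1 + PowerSeries.C (a + b) * PowerSeries.X * geomSeries a := by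
  have h := one_sub_mul_geomSeries a
  rw [map_add]
  linear_combination h

theorem coeffInt_add (f g : PowerSeries A) (m : ℤ) :
    coeffInt (f + g) m = coeffInt f m + coeffInt g m := by
  rw [coeffInt, coeffInt, coeffInt]
  split_ifs <;> simp

theorem coeffInt_C_mul_X_mul (a : A) (f : PowerSeries A) (m : ℤ) :
    coeffInt (PowerSeries.C a * PowerSeries.X * f) m = a * coeffInt f (m - 1) := by
  have h := coeffInt_linear_mul a f m
  rw [add_mul, one_mul, coeffInt_add] at h
  exact add_left_cancel h

theorem coeffInt_of_nonpos {f : PowerSeries A} (hf : PowerSeries.constantCoeff f = 1) {m : ℤ}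
    (hm : m ≤ 0) : coeffInt f m = if m = 0 then 1 else 0 := by
  rcases hm.lt_or_eq with hm | rfl
  · rw [coeffInt_of_neg _ hm, if_neg hm.ne]
  · rw [if_pos rfl, ← hf, ← PowerSeries.coeff_zero_eq_constantCoeff_apply]
    exact coeffInt_natCast f 0

theorem constantCoeff_linear (a : A) :
    PowerSeries.constantCoeff (1 + PowerSeries.C a * PowerSeries.X) = 1 := by
  simp

theorem constantCoeff_geomSeries (a : A) : PowerSeries.constantCoeff (geomSeries a) = 1 := by
  rw [geomSeries, ← PowerSeries.coeff_zero_eq_constantCoeff_apply, PowerSeries.coeff_mk, pow_zero]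

theorem coeffInt_prod_linear_of_card_lt {ι : Type*} (s : Finset ι) (a : ι → A) {m : ℤ}
    (hm : s.card < m) :
    coeffInt (∏ j ∈ s, (1 + PowerSeries.C (a j) * PowerSeries.X)) m = 0 := by
  classical
  induction s using Finset.induction_on generalizing m with
  | empty =>
    simp only [Finset.card_empty, Nat.cast_zero] at hm
    rw [Finset.prod_empty, coeffInt_one, if_neg hm.ne']
  | insert j s hj ih =>
    rw [Finset.card_insert_of_notMem hj] at hm
    push_cast at hm
    rw [Finset.prod_insert hj, coeffInt_linear_mul, ih (by omega), ih (by omega), mul_zero,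
      add_zero]

end CoeffInt

/-! ### Determinants with a block of zeros -/

/-- The zero block has r+1 rows and n-r columns (counting r from 0), n+1 in total, so by the
pigeonhole principle every term of the Leibniz expansion meets it. -/
theorem Matrix.det_eq_zero_of_upper_block {R : Type*} [CommRing R] {n : ℕ}
    (M : Matrix (Fin n) (Fin n) R) (r : Fin n) (h : ∀ i j, i ≤ r → r ≤ j → M i j = 0) :
    M.det = 0 := by
  rw [Matrix.det_apply]
  refine Finset.sum_eq_zero fun σ _ => ?_
  obtain ⟨j, hj, hσ⟩ : ∃ j, r ≤ j ∧ σ j ≤ r := by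
    by_contra hc
    push Not at hc
    have : (Finset.Ici r).card ≤ (Finset.Ioi r).card :=
      Finset.card_le_card_of_injOn σ (fun j hj => by simpa using hc j (by simpa using hj))
        σ.injective.injOn
    rw [Fin.card_Ici, Fin.card_Ioi] at this
    omega
  have h0 : ∏ i, M (σ i) i = 0 := Finset.prod_eq_zero (Finset.mem_univ j) (h _ _ hσ hj)
  rw [h0, smul_zero]

theorem Matrix.det_eq_zero_of_lower_block {R : Type*} [CommRing R] {n : ℕ}
    (M : Matrix (Fin n) (Fin n) R) (r : Fin n) (h : ∀ i j, r ≤ i → j ≤ r → M i j = 0) :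
    M.det = 0 := by
  rw [← Matrix.det_transpose]
  exact M.transpose.det_eq_zero_of_upper_block r fun i j hi hj => h j i hj hi

/-! ### Permutations of the integers of finite support -/

section FiniteSupport

variable {w : Equiv.Perm ℤ}

theorem exists_support_bound (hw : {i : ℤ | w i ≠ i}.Finite) :
    ∃ K : ℕ, (∀ j : ℤ, j ≤ -K → w j = j) ∧ ∀ j : ℤ, K < j → w j = j := by
  obtain ⟨b, hb⟩ := hw.bddAbove
  obtain ⟨a, ha⟩ := hw.bddBelow
  refine ⟨max b.toNat (-a).toNat + 1, fun j hj => ?_, fun j hj => ?_⟩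
  · by_contra h
    have := ha h
    omega
  · by_contra h
    have := hb h
    omega

/-- For a bound M of the support with M ≥ a, w maps (a, M] injectively into (w a, M]; compare
cardinalities. -/
theorem apply_le_self_of_forall_gt (hw : {i : ℤ | w i ≠ i}.Finite) {a : ℤ}
    (h : ∀ c, a < c → w a < w c) : w a ≤ a := by
  obtain ⟨K, -, hK⟩ := exists_support_bound hw
  have h1 := (Finset.card_le_card_of_injOn (s := Finset.Ioc a (max a K))
    (t := Finset.Ioc (w a) (max a K)) w (fun c hc => ?_) w.injective.injOn)
  · rw [Int.card_Ioc, Int.card_Ioc] at h1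
    by_cases h2 : (K : ℤ) < a
    · rw [hK a h2]
    · have := apply_le_of_fixed hK (not_lt.mp h2)
      omega
  · simp only [Finset.coe_Ioc, Set.mem_Ioc] at hc ⊢
    refine ⟨h c hc.1, ?_⟩
    by_cases h2 : (K : ℤ) < c
    · rw [hK c h2]
      exact hc.2
    · exact (apply_le_of_fixed hK (not_lt.mp h2)).trans (le_max_right _ _)

/-- Conjugation by negation of ℤ reduces this to the preceding inequality. -/
theorem self_le_apply_of_forall_lt (hw : {i : ℤ | w i ≠ i}.Finite) {a : ℤ}
    (h : ∀ c, c < a → w c < w a) : a ≤ w a := by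
  have hn : ∀ i, ((Equiv.neg ℤ).trans (w.trans (Equiv.neg ℤ))) i = -w (-i) := fun i => rfl
  have hf : {i : ℤ | ((Equiv.neg ℤ).trans (w.trans (Equiv.neg ℤ))) i ≠ i}.Finite := by
    refine (hw.preimage (f := fun i : ℤ => -i) neg_injective.injOn).subset fun i hi => ?_
    simp only [Set.mem_ofPred_eq, Set.mem_preimage, hn] at hi ⊢
    omega
  have := apply_le_self_of_forall_gt hf (a := -a) fun c hc => by
    rw [hn, hn, neg_neg]
    exact neg_lt_neg (h _ (by omega))
  rw [hn, neg_neg] at this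
  omega

theorem eq_one_of_forall_le (hw : {i : ℤ | w i ≠ i}.Finite) (h : ∀ i, w i ≤ i) : w = 1 := by
  by_contra hne
  have hs : hw.toFinset.Nonempty := by
    rw [Set.Finite.toFinset_nonempty, Set.nonempty_iff_ne_empty]
    intro he
    refine hne (Equiv.ext fun i => ?_)
    by_contra hi
    have : i ∈ {i : ℤ | w i ≠ i} := hi
    rw [he] at this
    exact this
  have h1 := Finset.min'_mem _ hs
  rw [Set.Finite.mem_toFinset] at h1
  have h2 : w (hw.toFinset.min' hs) ∈ hw.toFinset := by
    rw [Set.Finite.mem_toFinset]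
    exact fun h3 => h1 (w.injective h3)
  exact absurd (Finset.min'_le _ _ h2) (not_le.mpr (lt_of_le_of_ne (h _) h1))

theorem finite_support_mul_swap (hw : {i : ℤ | w i ≠ i}.Finite) (k l : ℤ) :
    {i : ℤ | (w * Equiv.swap k l) i ≠ i}.Finite := by
  refine (hw.union (Set.toFinite {k, l})).subset fun i hi => ?_
  by_contra hc
  simp only [Set.mem_union, Set.mem_ofPred_eq, Set.mem_insert_iff, Set.mem_singleton_iff,
    not_or, not_not] at hc hi
  rw [Equiv.Perm.mul_apply, Equiv.swap_apply_of_ne_of_ne hc.2.1 hc.2.2] at hi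
  exact hi hc.1

end FiniteSupport

/-! ### Nonintersecting particles -/

/-- The inversions of `w` are among the pairs `(a, b)` for which `a` belongs to the range of the
strictly decreasing sequence `p` and `b` does not. -/
structure InversionsAt {n : ℕ} (p : Fin n → ℤ) (w : Equiv.Perm ℤ) : Prop where
  strictAnti : StrictAnti p
  finite : {i : ℤ | w i ≠ i}.Finite
  inv : ∀ a b, a < b → w b < w a → (∃ i, p i = a) ∧ ∀ i, p i ≠ b

namespace InversionsAt

variable {n : ℕ} {p : Fin n → ℤ} {w : Equiv.Perm ℤ} (h : InversionsAt p w)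

include h

theorem self_le (i : Fin n) : p i ≤ w (p i) :=
  self_le_apply_of_forall_lt h.finite fun c hc =>
    lt_of_not_ge fun hle => (h.inv c (p i) hc (lt_of_le_of_ne hle fun he =>
      hc.ne' (w.injective he))).2 i rfl

theorem apply_lt {i j : Fin n} (hij : i < j) : w (p j) < w (p i) :=
  lt_of_not_ge fun hle => (h.inv _ _ (h.strictAnti hij) (lt_of_le_of_ne hle fun he =>
    (h.strictAnti hij).ne' (w.injective he))).2 i rfl

theorem apply_le {i j : Fin n} (hij : i ≤ j) : w (p j) ≤ w (p i) := by
  rcases hij.eq_or_lt with rfl | hij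
  · exact le_rfl
  · exact (h.apply_lt hij).le

theorem le_self {b : ℤ} (hb : ∀ i, p i ≠ b) : w b ≤ b :=
  apply_le_self_of_forall_gt h.finite fun c hc =>
    lt_of_not_ge fun hle =>
      let ⟨i, hi⟩ := (h.inv b c hc (lt_of_le_of_ne hle fun he => hc.ne' (w.injective he))).1
      hb i hi

end InversionsAt

section Particles

variable {R : Type*} [CommRing R]

/-- If w ≠ 1, some particle has w(p_r) > p_r. For i ≤ r ≤ j this gives w(p_i) ≥ w(p_r) > p_r ≥ p_j,
which is a block of zeros. -/
theorem det_indicator_of_inversionsAt {n : ℕ} {p : Fin n → ℤ} {w : Equiv.Perm ℤ}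
    (h : InversionsAt p w) :
    permDelta R w = Matrix.det (Matrix.of fun i j : Fin n =>
      if w (p i) = p j then (1 : R) else 0) := by
  rw [permDelta]
  split_ifs with h1
  · rw [h1]
    have : (Matrix.of fun i j : Fin n =>
        if (1 : Equiv.Perm ℤ) (p i) = p j then (1 : R) else 0) = 1 := by
      ext i j
      simp [Matrix.one_apply, h.strictAnti.injective.eq_iff]
    rw [this, Matrix.det_one]
  · obtain ⟨r, hr⟩ : ∃ r, p r < w (p r) := by
      by_contra hc
      push Not at hc
      refine h1 (eq_one_of_forall_le h.finite fun b => ?_)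
      by_cases hb : ∃ i, p i = b
      · obtain ⟨i, rfl⟩ := hb
        exact hc i
      · push Not at hb
        exact h.le_self hb
    refine (Matrix.det_eq_zero_of_upper_block _ r fun i j hi hj => ?_).symm
    rw [Matrix.of_apply, if_neg]
    have h2 := h.apply_le hi
    have h3 := h.strictAnti.antitone hj
    omega

/-- The operator `1 + a E` on matrices, where `E` replaces the column `k` by the column `k + 1` and
annihilates all other columns. -/
def particleOp (k : ℤ) (a : R) (M : ℤ → ℤ → R) : ℤ → ℤ → R :=
  fun b c => M b c + if c = k then a * M b (k + 1) else 0

/-- The function `g` on permutations is given by the minors of the lower triangular matrix `M`. -/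
structure IsMinorFunction (g : Equiv.Perm ℤ → R) (M : ℤ → ℤ → R) : Prop where
  lower : ∀ b c, b < c → M b c = 0
  eq_det : ∀ (n : ℕ) (p : Fin n → ℤ) (w : Equiv.Perm ℤ), InversionsAt p w →
    g w = Matrix.det (Matrix.of fun i j : Fin n => M (w (p i)) (p j))

/-- The particle at k moves to the empty place k+1 while its destination w(p_r) is unchanged. The
order of the particles survives since k+1 was free. -/
theorem InversionsAt.mul_swap {n : ℕ} {p : Fin n → ℤ} {w : Equiv.Perm ℤ} (h : InversionsAt p w)
    {r : Fin n} {k : ℤ} (hr : p r = k) (hk : ∀ i, p i ≠ k + 1) (hd : w (k + 1) < w k) :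
    InversionsAt (Function.update p r (k + 1)) (w * Equiv.swap k (k + 1)) ∧
      ∀ i, (w * Equiv.swap k (k + 1)) (Function.update p r (k + 1) i) = w (p i) := by
  have hval : ∀ i, Function.update p r (k + 1) i = Equiv.swap k (k + 1) (p i) := by
    intro i
    by_cases hi : i = r
    · subst hi
      rw [Function.update_self, hr, Equiv.swap_apply_left]
    · rw [Function.update_of_ne hi, Equiv.swap_apply_of_ne_of_ne _ (hk i)]
      rw [← hr]
      exact fun he => hi (h.strictAnti.injective he)
  refine ⟨⟨fun i j hij => ?_, finite_support_mul_swap h.finite _ _, fun a b hab hw => ?_⟩,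
    fun i => ?_⟩
  · rw [hval, hval]
    exact swap_succ_lt_swap_succ (h.strictAnti hij) fun he => hk i he.2
  · have hne : ¬ (a = k ∧ b = k + 1) := by
      rintro ⟨rfl, rfl⟩
      simp only [Equiv.Perm.mul_apply, Equiv.swap_apply_left, Equiv.swap_apply_right] at hw
      omega
    obtain ⟨⟨i, hi⟩, hb⟩ := h.inv _ _ (swap_succ_lt_swap_succ hab hne) hw
    refine ⟨⟨i, ?_⟩, fun j hj => hb j ?_⟩
    · rw [hval, hi, Equiv.swap_apply_self]
    · rw [← hj, hval, Equiv.swap_apply_self]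
  · rw [hval, Equiv.Perm.mul_apply, Equiv.swap_apply_self]

/-- The free fermion property. By linearity in the column of the particle at k, it remains to see
that the minor with column k replaced by column k+1 is g(w s_k) if k is a descent, and zero
otherwise. -/
theorem IsMinorFunction.nilOp {g : Equiv.Perm ℤ → R} {M : ℤ → ℤ → R} (hg : IsMinorFunction g M)
    (k : ℤ) (a : R) : IsMinorFunction (nilOp k a g) (particleOp k a M) := by
  refine ⟨fun b c hbc => ?_, fun n p w h => ?_⟩
  · rw [particleOp, hg.lower b c hbc]
    split_ifs with hc
    · rw [hg.lower b (k + 1) (by omega)]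
      ring
    · ring
  · rw [nilOp_apply, hg.eq_det n p w h]
    by_cases hk : ∃ r, p r = k
    · obtain ⟨r, hr⟩ := hk
      set A : Matrix (Fin n) (Fin n) R := Matrix.of fun i j : Fin n => M (w (p i)) (p j) with hA
      have h1 : (Matrix.of fun i j : Fin n => particleOp k a M (w (p i)) (p j)) =
          A.updateCol r ((fun i => A i r) + a • fun i => M (w (p i)) (k + 1)) := by
        ext i j
        rw [Matrix.updateCol_apply, Matrix.of_apply, particleOp]
        by_cases hj : j = r
        · subst hj
          simp [hr, hA]
        · rw [if_neg hj, if_neg, add_zero]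
          · rfl
          · rw [← hr]
            exact fun he => hj (h.strictAnti.injective he)
      have h2 : A.updateCol r (fun i => A i r) = A := Matrix.updateCol_eq_self A r
      rw [h1, Matrix.det_updateCol_add, Matrix.det_updateCol_smul, h2]
      congr 2
      by_cases hk1 : ∃ s, p s = k + 1
      · obtain ⟨s, hs⟩ := hk1
        have hrs : r ≠ s := by
          rintro rfl
          omega
        -- Exclusion: with both places occupied there is no descent, and the new minor has two equal
        -- columns.
        rw [if_neg fun hd => (h.inv k (k + 1) (by omega) hd).2 s hs,
          Matrix.det_zero_of_column_eq hrs]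
        intro i
        rw [Matrix.updateCol_self, Matrix.updateCol_ne hrs.symm, hA, Matrix.of_apply, hs]
      · push Not at hk1
        split_ifs with hd
        · obtain ⟨h3, h4⟩ := h.mul_swap hr hk1 hd
          rw [hg.eq_det n _ _ h3]
          congr 1
          ext i j
          rw [Matrix.of_apply, h4, Matrix.updateCol_apply]
          split_ifs with hj
          · rw [hj, Function.update_self]
          · rw [Function.update_of_ne hj, hA, Matrix.of_apply]
        -- Without a descent the particle at k has nowhere to go: a later value below w(k) would
        -- form an inversion starting at the empty place k+1. Then the rows i ≥ r have index at most
        -- k and the columns j ≤ r have index at least k+1, so lower triangularity yields a zero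
        -- block.
        · have hwk : w k ≤ k := by
            refine apply_le_self_of_forall_gt h.finite fun c hc => lt_of_not_ge fun hle => hd ?_
            have hlt : w c < w k := lt_of_le_of_ne hle fun he => hc.ne' (w.injective he)
            have hc1 : k + 1 ≠ c := by
              rintro rfl
              exact hd hlt
            have hle2 : w (k + 1) ≤ w c := le_of_not_gt fun hgt =>
              let ⟨i, hi⟩ := (h.inv (k + 1) c (by omega) hgt).1
              hk1 i hi
            omega
          refine (Matrix.det_eq_zero_of_lower_block _ r fun i j hi hj => ?_).symm
          have h3 : w (p i) ≤ k := by
            have := h.apply_le hi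
            rw [hr] at this
            exact this.trans hwk
          rw [Matrix.updateCol_apply]
          split_ifs with hjr
          · exact hg.lower _ _ (by omega)
          · have h4 := h.strictAnti (lt_of_le_of_ne hj hjr)
            exact hg.lower _ _ (by omega)
    · push Not at hk
      rw [if_neg fun hd => by
        obtain ⟨i, hi⟩ := (h.inv k (k + 1) (by omega) hd).1
        exact hk i hi]
      rw [mul_zero, add_zero]
      congr 1
      ext i j
      simp only [Matrix.of_apply, particleOp, if_neg (hk j), add_zero]

/-- The action of `nilRow` on matrices. -/
def particleRow (y : ℤ → R) (x : R) : ℤ → ℤ → ℕ → (ℤ → ℤ → R) → ℤ → ℤ → R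
  | _, _, 0, M => M
  | i, j, m + 1, M => particleOp i (x - y j) (particleRow y x (i + 1) (j + 1) m M)

/-- The action of `nilRows` on matrices. -/
def particleRows (x y : ℤ → R) (N : ℕ) : ℕ → (ℤ → ℤ → R) → ℤ → ℤ → R
  | 0, M => M
  | r + 1, M => particleRow y (x ((r + 1 : ℕ) : ℤ)) ((r + 1 : ℕ) : ℤ) 1 (N - (r + 1))
      (particleRows x y N r M)

theorem IsMinorFunction.nilRow {g : Equiv.Perm ℤ → R} {M : ℤ → ℤ → R} (hg : IsMinorFunction g M)
    (y : ℤ → R) (x : R) (i j : ℤ) (m : ℕ) :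
    IsMinorFunction (nilRow y x i j m g) (particleRow y x i j m M) := by
  induction m generalizing i j with
  | zero => exact hg
  | succ m ih => exact (ih (i + 1) (j + 1)).nilOp i _

theorem IsMinorFunction.nilRows {g : Equiv.Perm ℤ → R} {M : ℤ → ℤ → R} (hg : IsMinorFunction g M)
    (x y : ℤ → R) (N r : ℕ) : IsMinorFunction (nilRows x y N r g) (particleRows x y N r M) := by
  induction r with
  | zero => exact hg
  | succ r ih => exact ih.nilRow y _ _ _ _

theorem isMinorFunction_permDelta :
    IsMinorFunction (permDelta R) fun b c => if b = c then 1 else 0 :=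
  ⟨fun _ _ hbc => if_neg hbc.ne, fun _ _ _ h => det_indicator_of_inversionsAt h⟩

theorem particleRow_of_lt (y : ℤ → R) (x : R) {i : ℤ} (j : ℤ) (m : ℕ) (M : ℤ → ℤ → R) (b : ℤ)
    {c : ℤ} (hc : c < i) : particleRow y x i j m M b c = M b c := by
  induction m generalizing i j with
  | zero => rfl
  | succ m ih => rw [particleRow, particleOp, if_neg hc.ne, add_zero, ih _ (by omega)]

theorem particleRow_of_ge (y : ℤ → R) (x : R) {i : ℤ} (j : ℤ) {m : ℕ} (M : ℤ → ℤ → R) (b : ℤ)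
    {c : ℤ} (hc : i + m ≤ c) : particleRow y x i j m M b c = M b c := by
  induction m generalizing i j with
  | zero => rfl
  | succ m ih =>
    push_cast at hc
    rw [particleRow, particleOp, if_neg (by omega), add_zero, ih _ (by omega)]

/-- The factor h_c acts after those of larger index, so it adds a multiple of the already modified
column c+1; hence the recursion in c. -/
theorem particleRow_of_mem (y : ℤ → R) (x : R) {i : ℤ} (j : ℤ) {m : ℕ} (M : ℤ → ℤ → R) (b : ℤ)
    {c : ℤ} (hc : i ≤ c) (hc' : c < i + m) :
    particleRow y x i j m M b c =
      M b c + (x - y (c - i + j)) * particleRow y x i j m M b (c + 1) := by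
  induction m generalizing i j with
  | zero => 
    simp only [Nat.cast_zero] at hc'
    omega
  | succ m ih =>
    push_cast at hc'
    rw [particleRow, particleOp, particleOp]
    rw [if_neg (by omega : ¬ c + 1 = i), add_zero]
    rcases hc.eq_or_lt with rfl | hc
    · rw [if_pos rfl, particleRow_of_lt _ _ _ _ _ _ (by omega), sub_self, zero_add]
    · rw [if_neg (by omega), add_zero, ih _ (by omega) (by omega)]
      congr 4
      ring

end Particles

/-! ### Generating function of one particle -/

section OneParticle

variable {R : Type} [CommRing R]

/-- The column recursion is matched with (1 - yt)/(1 - xt) = 1 + (x - y)t/(1 - xt). The induction is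
on the number of rows and, within a row, on c downwards from N. -/
theorem particleRows_eq_coeffInt (x y : ℤ → R) {N : ℕ} {b : ℤ} (hb : b ≤ N) {r : ℕ} (hr : r ≤ N)
    {c : ℤ} (hc : r ≤ c) :
    particleRows x y N r (fun b c => if b = c then 1 else 0) b c =
      coeffInt ((∏ j ∈ Finset.Ioo (c - r) b, (1 + PowerSeries.C (-y j) * PowerSeries.X)) *
        ∏ i ∈ Finset.Ioc (0 : ℤ) r, geomSeries (x i)) (b - c) := by
  have hconst : ∀ (s t : Finset ℤ), PowerSeries.constantCoeff
      ((∏ j ∈ s, (1 + PowerSeries.C (-y j) * PowerSeries.X)) * ∏ i ∈ t, geomSeries (x i)) = 1 := by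
    intro s t
    rw [map_mul, map_prod, map_prod, Finset.prod_eq_one fun j _ => constantCoeff_linear _,
      Finset.prod_eq_one fun j _ => constantCoeff_geomSeries _, one_mul]
  induction r generalizing c with
  | zero =>
    rcases le_or_gt b c with hbc | hbc
    · rw [coeffInt_of_nonpos (hconst _ _) (by omega)]
      simp only [particleRows, sub_eq_zero]
    -- Only b - c - 1 linear factors are present, so the coefficient of t^{b-c} vanishes.
    · simp only [particleRows, Nat.cast_zero, sub_zero, Finset.Ioc_self, Finset.prod_empty, mul_one]
      rw [if_neg hbc.ne', coeffInt_prod_linear_of_card_lt]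
      rw [Int.card_Ioo]
      omega
  | succ r ih =>
    have hx : Finset.Ioc (0 : ℤ) (r + 1 : ℕ) = insert ((r + 1 : ℕ) : ℤ) (Finset.Ioc (0 : ℤ) r) := by
      ext i
      simp only [Finset.mem_Ioc, Finset.mem_insert]
      omega
    have hx' : ((r + 1 : ℕ) : ℤ) ∉ Finset.Ioc (0 : ℤ) r := by
      simp
    obtain ⟨d, hd⟩ : ∃ d : ℕ, (N - c).toNat = d := ⟨_, rfl⟩
    rw [particleRows]
    induction d generalizing c with
    | zero =>
      rw [particleRow_of_ge _ _ _ _ _ (by push_cast at *; omega), ih (by omega) (by omega),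
        coeffInt_of_nonpos (hconst _ _) (by omega), coeffInt_of_nonpos (hconst _ _) (by omega)]
    | succ d ihd =>
      have hy := ihd (c := c + 1) (by omega) (by omega)
      rw [particleRow_of_mem _ _ _ _ _ hc (by push_cast at *; omega), ih (by omega) (by omega), hy]
      have e1 : c + 1 - ((r + 1 : ℕ) : ℤ) = c - r := by push_cast; ring
      have e2 : b - (c + 1) = b - c - 1 := by ring
      have e3 : c - ((r + 1 : ℕ) : ℤ) + 1 = c - r := by push_cast; ring
      rw [e1, e2, e3]
      rcases lt_or_ge (c - r) b with hcb | hcb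
      · have hj : Finset.Ioo (c - ((r + 1 : ℕ) : ℤ)) b =
            insert (c - r : ℤ) (Finset.Ioo (c - r) b) := by
          ext i
          simp only [Finset.mem_Ioo, Finset.mem_insert]
          push_cast
          omega
        rw [hj, Finset.prod_insert (by simp), hx, Finset.prod_insert hx']
        set Q := ∏ j ∈ Finset.Ioo (c - r : ℤ) b, (1 + PowerSeries.C (-y j) * PowerSeries.X)
        set P := ∏ i ∈ Finset.Ioc (0 : ℤ) r, geomSeries (x i)
        have e4 : (1 + PowerSeries.C (-y (c - r)) * PowerSeries.X) * Q *
            (geomSeries (x ((r + 1 : ℕ) : ℤ)) * P) = Q * P +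
              PowerSeries.C (x ((r + 1 : ℕ) : ℤ) - y (c - r)) * PowerSeries.X *
                (Q * (geomSeries (x ((r + 1 : ℕ) : ℤ)) * P)) := by
          have := linear_mul_geomSeries (x ((r + 1 : ℕ) : ℤ)) (-y (c - r))
          rw [← sub_eq_add_neg] at this
          linear_combination Q * P * this
        rw [e4, coeffInt_add, coeffInt_C_mul_X_mul]
      · rw [coeffInt_of_neg (m := b - c - 1) _ (by omega), mul_zero, add_zero,
          coeffInt_of_nonpos (hconst _ _) (by omega), coeffInt_of_nonpos (hconst _ _) (by omega)]

/-- Row i changes only columns of index at least i, so the rows beyond c may be dropped. -/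
theorem particleRows_eq_coeffInt_of_le (x y : ℤ → R) {N : ℕ} {b : ℤ} (hb : b ≤ N) {r : ℕ}
    (hr : r ≤ N) {c : ℤ} (hc : 0 ≤ c) (hcr : c ≤ r) :
    particleRows x y N r (fun b c => if b = c then 1 else 0) b c =
      coeffInt ((∏ j ∈ Finset.Ioo 0 b, (1 + PowerSeries.C (-y j) * PowerSeries.X)) *
        ∏ i ∈ Finset.Ioc (0 : ℤ) c, geomSeries (x i)) (b - c) := by
  induction r with
  | zero =>
    obtain rfl : c = 0 := by
      push_cast at hcr
      omega
    simpa using particleRows_eq_coeffInt x y hb (r := 0) (by omega) le_rfl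
  | succ r ih =>
    rcases hcr.eq_or_lt with rfl | hlt
    · simpa using particleRows_eq_coeffInt x y hb hr le_rfl
    · rw [particleRows, particleRow_of_lt _ _ _ _ _ _ hlt]
      exact ih (by omega) (by push_cast at hlt; omega)

theorem nilPoly_eq_det (x y : ℤ → R) {N n : ℕ} {p : Fin n → ℤ} {w : Equiv.Perm ℤ}
    (h : InversionsAt p w) (hp : ∀ i, 0 ≤ p i) (hw : ∀ i, w (p i) ≤ N) :
    nilPoly x y N w = Matrix.det (Matrix.of fun i j : Fin n =>
      coeffInt ((∏ l ∈ Finset.Ioo 0 (w (p i)), (1 + PowerSeries.C (-y l) * PowerSeries.X)) *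
        ∏ l ∈ Finset.Ioc 0 (p j), geomSeries (x l)) (w (p i) - p j)) := by
  rw [nilPoly, (isMinorFunction_permDelta.nilRows x y N N).eq_det n p w h]
  congr 1
  ext i j
  rw [Matrix.of_apply, Matrix.of_apply, particleRows_eq_coeffInt_of_le x y (hw i) le_rfl (hp j)]
  exact (h.self_le j).trans (hw j)

end OneParticle

/-! ### Inversions of 321-avoiding permutations -/

section Avoiding

variable {w : Equiv.Perm ℤ}

/-- The counting argument for w a ≤ a, with the earlier position b as one more element mapped above
w a; this makes the inequality strict. -/
theorem apply_lt_self_of_forall_gt (hw : {i : ℤ | w i ≠ i}.Finite) {a b : ℤ}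
    (h : ∀ c, a < c → w a < w c) (hb : b < a) (hab : w a < w b) : w a < a := by
  obtain ⟨K, -, hK⟩ := exists_support_bound hw
  have h1 := (Finset.card_le_card_of_injOn (s := insert b (Finset.Ioc a (max a K)))
    (t := Finset.Ioc (w a) (max a K)) w (fun c hc => ?_) w.injective.injOn)
  · rw [Finset.card_insert_of_notMem (by simp [hb.le]), Int.card_Ioc, Int.card_Ioc] at h1
    omega
  · have h2 : w a < w c := by
      simp only [Finset.coe_insert, Set.mem_insert_iff, Finset.coe_Ioc, Set.mem_Ioc] at hc
      rcases hc with rfl | hc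
      · exact hab
      · exact h c hc.1
    have h3 : c ≤ max a K := by
      simp only [Finset.coe_insert, Set.mem_insert_iff, Finset.coe_Ioc, Set.mem_Ioc] at hc
      omega
    simp only [Finset.coe_Ioc, Set.mem_Ioc]
    refine ⟨h2, ?_⟩
    by_cases h4 : (K : ℤ) < c
    · rw [hK c h4]
      exact h3
    · exact (apply_le_of_fixed hK (not_lt.mp h4)).trans (le_max_right _ _)

theorem self_lt_apply_of_forall_lt (hw : {i : ℤ | w i ≠ i}.Finite) {a b : ℤ}
    (h : ∀ c, c < a → w c < w a) (hb : a < b) (hab : w b < w a) : a < w a := by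
  have hn : ∀ i, ((Equiv.neg ℤ).trans (w.trans (Equiv.neg ℤ))) i = -w (-i) := fun i => rfl
  have hf : {i : ℤ | ((Equiv.neg ℤ).trans (w.trans (Equiv.neg ℤ))) i ≠ i}.Finite := by
    refine (hw.preimage (f := fun i : ℤ => -i) neg_injective.injOn).subset fun i hi => ?_
    simp only [Set.mem_ofPred_eq, Set.mem_preimage, hn] at hi ⊢
    omega
  have := apply_lt_self_of_forall_gt hf (a := -a) (b := -b) (fun c hc => by
    rw [hn, hn, neg_neg]
    exact neg_lt_neg (h _ (by omega))) (by omega) (by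
    rw [hn, hn, neg_neg, neg_neg]
    omega)
  rw [hn, neg_neg] at this
  omega

/-- The left end of an inversion exceeds all earlier values and the right end lies below all later
ones, since otherwise a 321 pattern appears. By counting, left ends are excedances and right ends
satisfy w b < b. -/
theorem Is321Avoiding.inversionsAt (h : Is321Avoiding w) (hw : {i : ℤ | w i ≠ i}.Finite) {n : ℕ}
    {p : Fin n → ℤ} (hp : StrictAnti p) (hpw : ∀ a : ℤ, a < w a ↔ ∃ i, p i = a) :
    InversionsAt p w := by
  refine ⟨hp, hw, fun a b hab hlt => ⟨(hpw a).mp ?_, fun i hi => ?_⟩⟩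
  · refine self_lt_apply_of_forall_lt hw (fun c hc => lt_of_not_ge fun hle => ?_) hab hlt
    exact h c a b hc hab ⟨hlt, lt_of_le_of_ne hle fun he => hc.ne' (w.injective he)⟩
  · have h1 := (hpw b).mpr ⟨i, hi⟩
    have h2 : w b < b :=
      apply_lt_self_of_forall_gt hw (fun c hc => lt_of_not_ge fun hle => h a b c hab hc
        ⟨lt_of_le_of_ne hle fun he => hc.ne' (w.injective he), hlt⟩) hab hlt
    exact lt_asymm h1 h2

end Avoiding

/-! ### The Cauchy–Binet formula -/

section CauchyBinet

variable {R : Type*} [CommRing R]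

theorem exists_perm_strictAnti {n : ℕ} {α : Type*} [LinearOrder α] {r : Fin n → α}
    (hr : Function.Injective r) : ∃ (s : Fin n → α) (σ : Equiv.Perm (Fin n)),
      StrictAnti s ∧ s ∘ σ = r := by
  have h := Tuple.monotone_sort (OrderDual.toDual ∘ r)
  refine ⟨r ∘ Tuple.sort (OrderDual.toDual ∘ r), (Tuple.sort (OrderDual.toDual ∘ r))⁻¹, ?_, ?_⟩
  · have hs := h.strictMono_of_injective
      ((OrderDual.toDual.injective.comp hr).comp (Equiv.injective _))
    exact fun i j hij => hs hij
  · ext i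
    simp

theorem strictAnti_comp_perm_inj {n : ℕ} {α : Type*} [LinearOrder α] {s s' : Fin n → α}
    (hs : StrictAnti s) (hs' : StrictAnti s') {σ σ' : Equiv.Perm (Fin n)}
    (h : s ∘ σ = s' ∘ σ') : s = s' ∧ σ = σ' := by
  have h1 : Set.range s = Set.range s' := by
    rw [← σ.surjective.range_comp s, h, σ'.surjective.range_comp]
  have h2 : s = s' := hs.range_inj hs' |>.mp h1
  subst h2
  refine ⟨rfl, Equiv.ext fun i => hs.injective (congrFun h i)⟩

open Classical in
-- Multilinear expansion gives a sum over all index maps r. Those that are not injective produce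
-- equal rows, and each injective one is uniquely a strictly decreasing sequence composed with a
-- permutation.
theorem Matrix.det_sum_mul {n : ℕ} {α : Type*} [LinearOrder α] (S : Finset α)
    (f : Fin n → α → R) (g : α → Fin n → R) :
    Matrix.det (Matrix.of fun i j => ∑ a ∈ S, f i a * g a j) =
      ∑ s ∈ (Fintype.piFinset fun _ : Fin n => S).filter StrictAnti,
        Matrix.det (Matrix.of fun i k => f i (s k)) *
          Matrix.det (Matrix.of fun k j => g (s k) j) := by
  have h1 : Matrix.det (Matrix.of fun i j => ∑ a ∈ S, f i a * g a j) =
      ∑ r ∈ Fintype.piFinset fun _ : Fin n => S,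
        (∏ i, f i (r i)) * Matrix.det (Matrix.of fun i j => g (r i) j) := by
    have e : (Matrix.of fun i j => ∑ a ∈ S, f i a * g a j) =
        fun i => ∑ a ∈ S, f i a • g a := by
      ext i j
      simp [Finset.sum_apply]
    rw [e]
    have := (Matrix.detRowAlternating (R := R) (n := Fin n)).toMultilinearMap.map_sum_finset
      (fun i a => f i a • g a) (fun _ => S)
    refine this.trans (Finset.sum_congr rfl fun r _ => ?_)
    exact (Matrix.detRowAlternating (R := R) (n := Fin n)).toMultilinearMap.map_smul_univ
      (fun i => f i (r i)) fun i => g (r i)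
  rw [h1]
  have h2 : ∀ s : Fin n → α, Matrix.det (Matrix.of fun i k => f i (s k)) *
      Matrix.det (Matrix.of fun k j => g (s k) j) =
      ∑ σ : Equiv.Perm (Fin n), (∏ i, f i ((s ∘ σ) i)) *
        Matrix.det (Matrix.of fun i j => g ((s ∘ σ) i) j) := by
    intro s
    rw [← Matrix.det_transpose (Matrix.of fun i k => f i (s k)), Matrix.det_apply',
      Finset.sum_mul]
    refine Finset.sum_congr rfl fun σ _ => ?_
    have := Matrix.det_permute σ (Matrix.of fun k j => g (s k) j)
    have e : (Matrix.of fun k j => g (s k) j).submatrix σ id =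
      Matrix.of fun i j => g ((s ∘ σ) i) j := rfl
    rw [e] at this
    rw [this]
    simp only [Matrix.transpose_apply, Matrix.of_apply, Function.comp_apply]
    ring
  simp only [h2]
  rw [← Finset.sum_product', ← Finset.sum_filter_add_sum_filter_not _ Function.Injective]
  rw [Finset.sum_eq_zero (s := Finset.filter (fun x => ¬ Function.Injective x) _), add_zero]
  · symm
    refine Finset.sum_bij (fun b _ => b.1 ∘ b.2) ?_ ?_ ?_ ?_
    · rintro ⟨s, σ⟩ hs
      simp only [Finset.mem_product, Finset.mem_filter, Fintype.mem_piFinset] at hs ⊢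
      exact ⟨fun i => hs.1.1 _, hs.1.2.injective.comp σ.injective⟩
    · rintro ⟨s, σ⟩ hs ⟨s', σ'⟩ hs' h
      simp only [Finset.mem_product, Finset.mem_filter] at hs hs'
      obtain ⟨h1, h2⟩ := strictAnti_comp_perm_inj hs.1.2 hs'.1.2 h
      exact Prod.ext h1 h2
    · intro r hr
      rw [Finset.mem_filter, Fintype.mem_piFinset] at hr
      obtain ⟨s, σ, hs, h⟩ := exists_perm_strictAnti hr.2
      refine ⟨⟨s, σ⟩, ?_, h⟩
      simp only [Finset.mem_product, Finset.mem_filter, Fintype.mem_piFinset, Finset.mem_univ,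
        and_true]
      refine ⟨fun i => ?_, hs⟩
      have := hr.1 (σ.symm i)
      rwa [← h, Function.comp_apply, Equiv.apply_symm_apply] at this
    · rintro ⟨s, σ⟩ _
      rfl
  · intro r hr
    rw [Finset.mem_filter] at hr
    obtain ⟨i, j, hij, hne⟩ := Function.not_injective_iff.mp hr.2
    rw [Matrix.det_zero_of_row_eq hne, mul_zero]
    ext k
    simp [hij]

end CauchyBinet

/-! ### Cauchy–Binet for coefficients of power series -/

section SeqSum

variable {A : Type} [CommRing A]

theorem coeffInt_mul (f g : PowerSeries A) {b d B D : ℤ} (hD : D ≤ d) (hB : b ≤ B) :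
    coeffInt (f * g) (b - d) =
      ∑ a ∈ Finset.Icc D B, coeffInt f (b - a) * coeffInt g (a - d) := by
  have h1 : ∑ a ∈ Finset.Icc D B, coeffInt f (b - a) * coeffInt g (a - d) =
      ∑ a ∈ Finset.Icc d b, coeffInt f (b - a) * coeffInt g (a - d) := by
    symm
    refine Finset.sum_subset (Finset.Icc_subset_Icc hD hB) fun a _ ha => ?_
    rw [Finset.mem_Icc, not_and_or, not_le, not_le] at ha
    rcases ha with ha | ha
    · rw [coeffInt_of_neg g (by omega), mul_zero]
    · rw [coeffInt_of_neg f (by omega), zero_mul]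
  rw [h1]
  rcases lt_or_ge b d with hbd | hbd
  · rw [coeffInt_of_neg _ (by omega), Finset.Icc_eq_empty (by omega), Finset.sum_empty]
  · obtain ⟨m, hm⟩ := Int.eq_ofNat_of_zero_le (sub_nonneg.mpr hbd)
    obtain rfl : b = d + m := by omega
    rw [add_sub_cancel_left, coeffInt_natCast, PowerSeries.coeff_mul]
    refine Finset.sum_nbij' (fun k => d + k.2) (fun a => ((d + m - a).toNat, (a - d).toNat))
      ?_ ?_ ?_ ?_ ?_
    · rintro ⟨k, l⟩ h
      have h := Finset.HasAntidiagonal.mem_antidiagonal.mp h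
      rw [Finset.mem_Icc]
      simp only at h ⊢
      omega
    · intro a h
      rw [Finset.mem_Icc] at h
      refine Finset.HasAntidiagonal.mem_antidiagonal.mpr ?_
      simp only
      omega
    · rintro ⟨k, l⟩ h
      have h := Finset.HasAntidiagonal.mem_antidiagonal.mp h
      simp only at h
      ext <;> simp only <;> omega
    · intro a h
      rw [Finset.mem_Icc] at h
      simp only
      omega
    · rintro ⟨k, l⟩ h
      have h := Finset.HasAntidiagonal.mem_antidiagonal.mp h
      simp only at h ⊢
      rw [show d + (m : ℤ) - (d + l) = (k : ℕ) by omega, show d + (l : ℤ) - d = (l : ℕ) by omega,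
        coeffInt_natCast, coeffInt_natCast]

theorem mem_seqBetween {n : ℕ} {lo hi lam : Fin n → ℤ} :
    lam ∈ seqBetween lo hi ↔ (lo ≤ lam ∧ lam ≤ hi) ∧ Antitone lam := by
  rw [seqBetween, Finset.mem_filter, Finset.mem_Icc]

theorem strictAnti_sub_id {n : ℕ} {lam : Fin n → ℤ} (h : Antitone lam) :
    StrictAnti fun i : Fin n => lam i - (i : ℤ) := by
  intro i j hij
  have h1 := h hij.le
  have h2 : (i : ℕ) < j := hij
  simp only
  omega

theorem antitone_add_id {n : ℕ} {s : Fin n → ℤ} (h : StrictAnti s) :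
    Antitone fun i : Fin n => s i + (i : ℤ) := by
  have key : ∀ (k : ℕ) (i j : Fin n), (j : ℕ) = i + k → s j + (j : ℤ) ≤ s i + (i : ℤ) := by
    intro k
    induction k with
    | zero =>
      intro i j hij
      rw [Fin.ext hij]
    | succ k ih =>
      intro i j hij
      have h1 := ih i ⟨i + k, by omega⟩ rfl
      have h2 := h (show (⟨i + k, by omega⟩ : Fin n) < j from Fin.mk_lt_of_lt_val (by omega))
      simp only at h1
      omega
  intro i j hij
  exact key (j - i) i j (by have : (i : ℕ) ≤ j := hij; omega)

/-- If kap_r < lam_r, then all entries with j ≤ r ≤ i are coefficients of negative degree. -/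
theorem det_coeffInt_eq_zero {n : ℕ} {kap lam : Fin n → ℤ} (hkap : Antitone kap)
    (hlam : Antitone lam) (f : Fin n → Fin n → PowerSeries A) (h : ¬ lam ≤ kap) :
    Matrix.det (Matrix.of fun i j : Fin n =>
      coeffInt (f i j) (kap i - (i : ℤ) - (lam j - (j : ℤ)))) = 0 := by
  obtain ⟨r, hr⟩ : ∃ r, kap r < lam r := by
    by_contra hc
    push Not at hc
    exact h hc
  refine Matrix.det_eq_zero_of_lower_block _ r fun i j hi hj => ?_
  rw [Matrix.of_apply, coeffInt_of_neg]
  have h1 := (strictAnti_sub_id hkap).antitone hi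
  have h2 := (strictAnti_sub_id hlam).antitone hj
  omega

/-- The strictly decreasing sequences s of Cauchy–Binet correspond to lam_i = s_i + i. Those not
between rho and kap contribute zero, because one of the two determinants has a zero block. -/
theorem det_coeffInt_mul {n : ℕ} {kap rho : Fin n → ℤ} (hkap : Antitone kap) (hrho : Antitone rho)
    (f g : Fin n → PowerSeries A) :
    Matrix.det (Matrix.of fun i j : Fin n =>
      coeffInt (f i * g j) (kap i - (i : ℤ) - (rho j - (j : ℤ)))) =
    ∑ lam ∈ seqBetween rho kap,
      Matrix.det (Matrix.of fun i j : Fin n =>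
        coeffInt (f i) (kap i - (i : ℤ) - (lam j - (j : ℤ)))) *
      Matrix.det (Matrix.of fun i j : Fin n =>
        coeffInt (g j) (lam i - (i : ℤ) - (rho j - (j : ℤ)))) := by
  classical
  obtain ⟨D, hD⟩ : ∃ D : ℤ, ∀ j, D ≤ rho j - (j : ℤ) :=
    let ⟨D, hD⟩ := (Set.finite_range fun j : Fin n => rho j - (j : ℤ)).bddBelow
    ⟨D, fun j => hD ⟨j, rfl⟩⟩
  obtain ⟨B, hB⟩ : ∃ B : ℤ, ∀ j, kap j - (j : ℤ) ≤ B :=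
    let ⟨B, hB⟩ := (Set.finite_range fun j : Fin n => kap j - (j : ℤ)).bddAbove
    ⟨B, fun j => hB ⟨j, rfl⟩⟩
  have h1 : (Matrix.of fun i j : Fin n =>
      coeffInt (f i * g j) (kap i - (i : ℤ) - (rho j - (j : ℤ)))) =
      Matrix.of fun i j : Fin n => ∑ a ∈ Finset.Icc D B,
        coeffInt (f i) (kap i - (i : ℤ) - a) * coeffInt (g j) (a - (rho j - (j : ℤ))) := by
    ext i j
    exact coeffInt_mul _ _ (hD j) (hB i)
  rw [h1, Matrix.det_sum_mul (Finset.Icc D B) (fun i a => coeffInt (f i) (kap i - (i : ℤ) - a))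
    (fun a j => coeffInt (g j) (a - (rho j - (j : ℤ))))]
  symm
  refine Finset.sum_of_injOn (fun lam i => lam i - (i : ℤ)) ?_ ?_ ?_ ?_
  · intro lam _ lam' _ h
    ext i
    have := congrFun h i
    simp only at this
    omega
  · intro lam h
    rw [Finset.mem_coe, mem_seqBetween] at h
    rw [Finset.mem_coe, Finset.mem_filter, Fintype.mem_piFinset]
    refine ⟨fun i => ?_, strictAnti_sub_id h.2⟩
    rw [Finset.mem_Icc]
    change D ≤ lam i - (i : ℤ) ∧ lam i - (i : ℤ) ≤ B
    have h1 := h.1.1 i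
    have h2 := h.1.2 i
    exact ⟨(hD i).trans (sub_le_sub_right h1 _), (sub_le_sub_right h2 _).trans (hB i)⟩
  · intro s hs h
    rw [Finset.mem_filter] at hs
    have hanti := antitone_add_id hs.2
    have hs' : s = fun i : Fin n => (fun i : Fin n => s i + (i : ℤ)) i - (i : ℤ) := by
      ext i
      simp
    by_cases hk : (fun i : Fin n => s i + (i : ℤ)) ≤ kap
    · by_cases hr : rho ≤ fun i : Fin n => s i + (i : ℤ)
      · exact absurd ⟨_, mem_seqBetween.mpr ⟨⟨hr, hk⟩, hanti⟩, hs'.symm⟩ h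
      · have := det_coeffInt_eq_zero hanti hrho (fun _ j => g j) hr
        simp only [add_sub_cancel_right] at this
        rw [this, mul_zero]
    · have := det_coeffInt_eq_zero hkap hanti (fun i _ => f i) hk
      simp only [add_sub_cancel_right] at this
      rw [this, zero_mul]
  · intro lam _
    rfl

end SeqSum

/-! ### Flagged tableaux and determinants -/

/-- The entries allowed in a row with parameter `q`: plain integers at most `-q` or primed integers
at most `q`. -/
def EntryBound (q : ℤ) : TableauEntry → Prop
  | .plain k => 1 ≤ k ∧ (k : ℤ) ≤ -q
  | .primed l => 1 ≤ l ∧ (l : ℤ) ≤ q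
  | .both _ _ => False

/-- The condition on an entry and an entry to its right, in the absence of pairs. -/
def RowRel : TableauEntry → TableauEntry → Prop
  | .plain k, .plain k' => k ≤ k'
  | .primed l, .primed l' => l < l'
  | _, _ => False

/-- The condition on an entry and an entry below it, in the absence of pairs. -/
def ColRel : TableauEntry → TableauEntry → Prop
  | .plain k, .plain k' => k < k'
  | .primed l, .primed l' => l ≤ l'
  | _, _ => False

/-- The tableaux on `kap/lam` with plain entries at most `max(-q_i, 0)` and primed entries at most
`max(q_i, 0)` in row `i`. -/
def flagTableaux {n : ℕ} (q kap lam : Fin n → ℤ) : Set (Filling kap lam) :=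
  {T | IsTableau (fun i => (-q i).toNat) (fun i => (q i).toNat) T}

theorem mem_skewBoxes {n : ℕ} {kap lam : Fin n → ℤ} {b : Σ _ : Fin n, ℤ} :
    b ∈ skewBoxes kap lam ↔ lam b.1 < b.2 ∧ b.2 ≤ kap b.1 := by
  simp [skewBoxes]

theorem entryBound_iff {q : ℤ} {e : TableauEntry} :
    EntryBound q e ↔ (∀ k ∈ e.plainPart, 1 ≤ k ∧ k ≤ (-q).toNat) ∧
      ∀ l ∈ e.primedPart, 1 ≤ l ∧ l ≤ q.toNat := by
  cases e with
  | plain k =>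
    simp only [EntryBound, TableauEntry.plainPart, TableauEntry.primedPart, Option.mem_def,
      Option.some.injEq, forall_eq', reduceCtorEq, false_implies, implies_true, and_true]
    omega
  | primed l =>
    simp only [EntryBound, TableauEntry.plainPart, TableauEntry.primedPart, Option.mem_def,
      Option.some.injEq, forall_eq', reduceCtorEq, false_implies, implies_true, true_and]
    omega
  | both k l =>
    simp only [EntryBound, TableauEntry.plainPart, TableauEntry.primedPart, Option.mem_def,
      Option.some.injEq, forall_eq', false_iff]
    omega

theorem rowRel_iff {q q' : ℤ} {e e' : TableauEntry} (he : EntryBound q e)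
    (he' : EntryBound q' e') :
    RowRel e e' ↔ (∀ k ∈ e.plainPart, ∃ k' ∈ e'.plainPart, k ≤ k') ∧
      ∀ l ∈ e.primedPart, ∃ l' ∈ e'.primedPart, l < l' := by
  cases e <;> cases e' <;>
    first
    | exact he.elim
    | exact he'.elim
    | simp [RowRel, TableauEntry.plainPart, TableauEntry.primedPart]

theorem colRel_iff {q q' : ℤ} {e e' : TableauEntry} (he : EntryBound q e)
    (he' : EntryBound q' e') :
    ColRel e e' ↔ (∀ k ∈ e.plainPart, ∃ k' ∈ e'.plainPart, k < k') ∧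
      ∀ l ∈ e.primedPart, ∃ l' ∈ e'.primedPart, l ≤ l' := by
  cases e <;> cases e' <;>
    first
    | exact he.elim
    | exact he'.elim
    | simp [ColRel, TableauEntry.plainPart, TableauEntry.primedPart]

/-- Pairs cannot occur, since -q and q are never both positive; the plain and primed conditions then
merge into a single relation each for rows and columns. -/
theorem mem_flagTableaux {n : ℕ} {q kap lam : Fin n → ℤ} {T : Filling kap lam} :
    T ∈ flagTableaux q kap lam ↔ (∀ b, EntryBound (q b.1.1) (T b)) ∧
      (∀ b b', b.1.1 = b'.1.1 → b.1.2 < b'.1.2 → RowRel (T b) (T b')) ∧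
      ∀ b b', b.1.2 = b'.1.2 → b.1.1 < b'.1.1 → ColRel (T b) (T b') := by
  constructor
  · intro h
    have hb : ∀ b, EntryBound (q b.1.1) (T b) := fun b =>
      entryBound_iff.mpr ⟨h.plain_bound b, h.primed_bound b⟩
    exact ⟨hb, fun b b' h1 h2 => (rowRel_iff (hb b) (hb b')).mpr
      ⟨h.row_plain b b' h1 h2, h.row_primed b b' h1 h2⟩, fun b b' h1 h2 =>
      (colRel_iff (hb b) (hb b')).mpr ⟨h.col_plain b b' h1 h2, h.col_primed b b' h1 h2⟩⟩
  · rintro ⟨hb, hr, hc⟩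
    refine ⟨fun b => (entryBound_iff.mp (hb b)).1, fun b => (entryBound_iff.mp (hb b)).2,
      fun b b' h1 h2 => ((rowRel_iff (hb b) (hb b')).mp (hr b b' h1 h2)).1,
      fun b b' h1 h2 => ((rowRel_iff (hb b) (hb b')).mp (hr b b' h1 h2)).2,
      fun b b' h1 h2 => ((colRel_iff (hb b) (hb b')).mp (hc b b' h1 h2)).1,
      fun b b' h1 h2 => ((colRel_iff (hb b) (hb b')).mp (hc b b' h1 h2)).2, ?_, ?_⟩ <;>
    · intro b b' _ _ k l h
      have := hb b
      rw [h] at this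
      exact this.elim

theorem mem_dualTableaux321 {n : ℕ} {p nu : Fin n → ℤ} {T : Filling nu (rhoSeq p)} :
    T ∈ dualTableaux321 p nu ↔ (∀ b, EntryBound (-p b.1.1) (T b)) ∧
      (∀ b b', b.1.1 = b'.1.1 → b'.1.2 < b.1.2 → RowRel (T b) (T b')) ∧
      ∀ b b', b.1.2 = b'.1.2 → b'.1.1 < b.1.1 → ColRel (T b) (T b') := by
  constructor
  · intro h
    have hb : ∀ b, EntryBound (-p b.1.1) (T b) := fun b =>
      entryBound_iff.mpr ⟨by rw [neg_neg]; exact h.plain_bound b, h.primed_bound b⟩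
    exact ⟨hb, fun b b' h1 h2 => (rowRel_iff (hb b) (hb b')).mpr
      ⟨h.row_plain b b' h1 h2, h.row_primed b b' h1 h2⟩, fun b b' h1 h2 =>
      (colRel_iff (hb b) (hb b')).mpr ⟨h.col_plain b b' h1 h2, h.col_primed b b' h1 h2⟩⟩
  · rintro ⟨hb, hr, hc⟩
    refine ⟨fun b => ?_, fun b => (entryBound_iff.mp (hb b)).2,
      fun b b' h1 h2 => ((rowRel_iff (hb b) (hb b')).mp (hr b b' h1 h2)).1,
      fun b b' h1 h2 => ((rowRel_iff (hb b) (hb b')).mp (hr b b' h1 h2)).2,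
      fun b b' h1 h2 => ((colRel_iff (hb b) (hb b')).mp (hc b b' h1 h2)).1,
      fun b b' h1 h2 => ((colRel_iff (hb b) (hb b')).mp (hc b b' h1 h2)).2, ?_, ?_⟩
    · have := (entryBound_iff.mp (hb b)).1
      rwa [neg_neg] at this
    all_goals
      intro b b' _ _ k l h
      have := hb b
      rw [h] at this
      exact this.elim

theorem finite_flagTableaux {n : ℕ} (q kap lam : Fin n → ℤ) : (flagTableaux q kap lam).Finite :=
  (finite_bounded_fillings (fun i => (-q i).toNat) (fun i => (q i).toNat) kap lam).subset
    fun _ h => ⟨h.plain_bound, h.primed_bound⟩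

theorem finite_dualTableaux321 {n : ℕ} (p nu : Fin n → ℤ) : (dualTableaux321 p nu).Finite :=
  (finite_bounded_fillings (fun i => (p i).toNat) (fun i => (-p i).toNat) nu (rhoSeq p)).subset
    fun _ h => ⟨h.plain_bound, h.primed_bound⟩

/-! ### Removing an extremal entry from a tableau -/

section Recursion

variable {A : Type} [CommRing A] (u v : ℕ → A) {n : ℕ}

/-- The generating function of the tableaux on `kap/lam` with row parameters `q`. -/
noncomputable def tableauSum (q kap lam : Fin n → ℤ) : A :=
  ∑ᶠ T ∈ flagTableaux q kap lam, fillingWeight u v T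

variable {q kap lam : Fin n → ℤ} {r : Fin n}

theorem skewBoxes_update (r : Fin n) {b : Σ _ : Fin n, ℤ} (hb : b ∈ skewBoxes kap lam)
    (hne : ¬ (b.1 = r ∧ b.2 = kap r)) :
    b ∈ skewBoxes (Function.update kap r (kap r - 1)) lam := by
  rw [mem_skewBoxes] at hb ⊢
  refine ⟨hb.1, ?_⟩
  by_cases h : b.1 = r
  · rw [h, Function.update_self]
    rw [h] at hb hne
    have := fun h => hne ⟨rfl, h⟩
    omega
  · rw [Function.update_of_ne h]
    exact hb.2

theorem skewBoxes_of_update {r : Fin n} {b : Σ _ : Fin n, ℤ}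
    (hb : b ∈ skewBoxes (Function.update kap r (kap r - 1)) lam) :
    b ∈ skewBoxes kap lam ∧ ¬ (b.1 = r ∧ b.2 = kap r) := by
  rw [mem_skewBoxes] at hb ⊢
  by_cases h : b.1 = r
  · rw [h, Function.update_self] at hb
    rw [h]
    omega
  · rw [Function.update_of_ne h] at hb
    exact ⟨hb, fun h' => h h'.1⟩

/-- The box at the end of row `r`. -/
def endBox (h : lam r < kap r) : ↥(skewBoxes kap lam) :=
  ⟨⟨r, kap r⟩, mem_skewBoxes.mpr ⟨h, le_rfl⟩⟩

/-- The restriction of a filling to the complement of the box at the end of row `r`. -/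
def removeEnd (r : Fin n) (T : Filling kap lam) :
    Filling (Function.update kap r (kap r - 1)) lam :=
  fun b => T ⟨b.1, (skewBoxes_of_update b.2).1⟩

/-- The extension of a filling by the entry `e` at the end of row `r`. -/
noncomputable def addEnd (e : TableauEntry)
    (T : Filling (Function.update kap r (kap r - 1)) lam) : Filling kap lam :=
  open Classical in
  fun b => if h : b.1 ∈ skewBoxes (Function.update kap r (kap r - 1)) lam then T ⟨b.1, h⟩ else e

theorem eq_endBox (h : lam r < kap r) (b : ↥(skewBoxes kap lam)) (h1 : b.1.1 = r)
    (h2 : b.1.2 = kap r) : b = endBox h :=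
  Subtype.ext (Sigma.ext h1 (heq_of_eq h2))

theorem fillingWeight_eq_mul_removeEnd (h : lam r < kap r) (T : Filling kap lam) :
    fillingWeight u v T = (T (endBox h)).weight u v * fillingWeight u v (removeEnd r T) := by
  classical
  rw [fillingWeight, fillingWeight, ← Finset.mul_prod_erase _ _ (Finset.mem_univ (endBox h))]
  congr 1
  refine Finset.prod_bij' (fun b hb => ⟨b.1, skewBoxes_update r b.2 fun hr =>
    (Finset.mem_erase.mp hb).1 (eq_endBox h b hr.1 hr.2)⟩)
    (fun b _ => ⟨b.1, (skewBoxes_of_update b.2).1⟩) ?_ ?_ ?_ ?_ ?_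
  · intro b _
    exact Finset.mem_univ _
  · intro b _
    refine Finset.mem_erase.mpr ⟨fun he => (skewBoxes_of_update b.2).2 ?_, Finset.mem_univ _⟩
    have := congrArg Subtype.val he
    simp only [endBox] at this
    rw [this]
    exact ⟨rfl, rfl⟩
  · intro b _
    rfl
  · intro b _
    rfl
  · intro b _
    rfl

/-- Removing the entry `e` at a corner. -/
theorem finsum_tableaux_endBox_eq (h : lam r < kap r) (hcorner : ∀ i, r < i → kap i < kap r)
    {q' : Fin n → ℤ} (hq' : ∀ i, i ≠ r → q' i = q i) {e : TableauEntry}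
    (he : EntryBound (q r) e)
    (hrow : ∀ f, EntryBound (q' r) f ↔ EntryBound (q r) f ∧ RowRel f e)
    (hcol : ∀ i, i < r → ∀ f, EntryBound (q i) f → ColRel f e) :
    ∑ᶠ T ∈ {T ∈ flagTableaux q kap lam | T (endBox h) = e}, fillingWeight u v T =
      e.weight u v * tableauSum u v q' (Function.update kap r (kap r - 1)) lam := by
  rw [tableauSum, mul_finsum_mem' _ _ (finite_flagTableaux _ _ _)]
  refine finsum_mem_eq_of_bijOn (removeEnd r) ⟨?_, ?_, ?_⟩ ?_
  · rintro T ⟨hT, hTe⟩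
    rw [mem_flagTableaux] at hT ⊢
    refine ⟨fun b => ?_, fun b b' h1 h2 => hT.2.1 _ _ h1 h2, fun b b' h1 h2 => hT.2.2 _ _ h1 h2⟩
    obtain ⟨hb, hb'⟩ := skewBoxes_of_update b.2
    have hbd := hT.1 ⟨b.1, hb⟩
    by_cases hbr : b.1.1 = r
    · rw [hbr]
      simp only [hbr] at hbd
      refine (hrow _).mpr ⟨hbd, ?_⟩
      have h1 := mem_skewBoxes.mp hb
      have h2 := fun h => hb' ⟨hbr, h⟩
      rw [hbr] at h1
      rw [← hTe]
      refine hT.2.1 ⟨b.1, hb⟩ (endBox h) hbr ?_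
      exact lt_of_le_of_ne h1.2 h2
    · rw [hq' _ hbr]
      exact hbd
  · rintro T ⟨_, hT⟩ T' ⟨_, hT'⟩ heq
    refine _root_.funext fun b => ?_
    by_cases hb : b.1.1 = r ∧ b.1.2 = kap r
    · rw [eq_endBox h b hb.1 hb.2, hT, hT']
    · exact congrFun heq ⟨b.1, skewBoxes_update r b.2 hb⟩
  · intro T hT
    rw [mem_flagTableaux] at hT
    have hnot : ∀ b : ↥(skewBoxes kap lam),
        b.1 ∉ skewBoxes (Function.update kap r (kap r - 1)) lam → b = endBox h := by
      intro b hb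
      by_contra hne
      exact hb (skewBoxes_update r b.2 fun hr => hne (eq_endBox h b hr.1 hr.2))
    have hbound : ∀ b : ↥(skewBoxes (Function.update kap r (kap r - 1)) lam),
        EntryBound (q b.1.1) (T b) := by
      intro b
      have := hT.1 b
      by_cases hbr : b.1.1 = r
      · rw [hbr] at this ⊢
        exact ((hrow _).mp this).1
      · rwa [hq' _ hbr] at this
    have hend : (endBox h).1 ∉ skewBoxes (Function.update kap r (kap r - 1)) lam :=
      fun hm => (skewBoxes_of_update hm).2 ⟨rfl, rfl⟩
    refine ⟨addEnd e T, ⟨mem_flagTableaux.mpr ⟨fun b => ?_, fun b b' h1 h2 => ?_,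
      fun b b' h1 h2 => ?_⟩, ?_⟩, ?_⟩
    · by_cases hb : b.1 ∈ skewBoxes (Function.update kap r (kap r - 1)) lam
      · rw [addEnd, dif_pos hb]
        exact hbound ⟨b.1, hb⟩
      · rw [addEnd, dif_neg hb, hnot b hb]
        exact he
    -- Nothing lies to the right of the removed box, so it cannot be the left one of the two boxes;
    -- the corner condition plays the same role for columns.
    · have hb : b.1 ∈ skewBoxes (Function.update kap r (kap r - 1)) lam := by
        by_contra hb
        have hb2 := (mem_skewBoxes.mp b'.2).2
        rw [hnot b hb] at h1 h2
        rw [← h1] at hb2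
        exact absurd h2 (not_lt.mpr hb2)
      rw [addEnd, dif_pos hb]
      by_cases hb' : b'.1 ∈ skewBoxes (Function.update kap r (kap r - 1)) lam
      · rw [addEnd, dif_pos hb']
        exact hT.2.1 ⟨b.1, hb⟩ ⟨b'.1, hb'⟩ h1 h2
      · rw [addEnd, dif_neg hb']
        rw [hnot b' hb'] at h1
        have hbr : b.1.1 = r := h1
        have := hT.1 ⟨b.1, hb⟩
        simp only [hbr] at this
        exact ((hrow _).mp this).2
    · have hb : b.1 ∈ skewBoxes (Function.update kap r (kap r - 1)) lam := by
        by_contra hb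
        have hb2 := (mem_skewBoxes.mp b'.2).2
        rw [hnot b hb] at h1 h2
        rw [← h1] at hb2
        exact absurd (hcorner _ h2) (not_lt.mpr hb2)
      rw [addEnd, dif_pos hb]
      by_cases hb' : b'.1 ∈ skewBoxes (Function.update kap r (kap r - 1)) lam
      · rw [addEnd, dif_pos hb']
        exact hT.2.2 ⟨b.1, hb⟩ ⟨b'.1, hb'⟩ h1 h2
      · rw [addEnd, dif_neg hb']
        rw [hnot b' hb'] at h2
        exact hcol _ h2 _ (hbound ⟨b.1, hb⟩)
    · rw [addEnd, dif_neg hend]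
    · refine _root_.funext fun b => ?_
      rw [removeEnd, addEnd, dif_pos b.2]
  · rintro T ⟨_, hT⟩
    rw [fillingWeight_eq_mul_removeEnd u v h, hT]

theorem flagTableaux_congr {q' : Fin n → ℤ} (hr : kap r ≤ lam r) (hq' : ∀ i, i ≠ r → q' i = q i) :
    flagTableaux q' kap lam = flagTableaux q kap lam := by
  ext T
  rw [mem_flagTableaux, mem_flagTableaux]
  have : ∀ b : ↥(skewBoxes kap lam), q' b.1.1 = q b.1.1 := by
    intro b
    refine hq' _ fun h => ?_
    have := mem_skewBoxes.mp b.2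
    rw [h] at this
    omega
  simp only [this]

/-- The entry e is the largest one in row r, so if the end box avoids it then so does the whole row.
The hypothesis `hrow` passes the smaller bound from the end box to the left. -/
theorem flagTableaux_eq_of_entries {q' : Fin n → ℤ} (h : lam r < kap r)
    (hq' : ∀ i, i ≠ r → q' i = q i) {e : TableauEntry}
    (hbound : ∀ f, EntryBound (q' r) f ↔ EntryBound (q r) f ∧ f ≠ e)
    (hrow : ∀ f g, EntryBound (q r) f → RowRel f g → EntryBound (q' r) g → EntryBound (q' r) f) :
    flagTableaux q' kap lam = {T ∈ flagTableaux q kap lam | T (endBox h) ≠ e} := by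
  ext T
  simp only [Set.mem_ofPred_eq, mem_flagTableaux]
  constructor
  · rintro ⟨h1, h2⟩
    refine ⟨⟨fun b => ?_, h2⟩, ?_⟩
    · have := h1 b
      by_cases hbr : b.1.1 = r
      · rw [hbr] at this ⊢
        exact ((hbound _).mp this).1
      · rwa [hq' _ hbr] at this
    · exact ((hbound _).mp (h1 (endBox h))).2
  · rintro ⟨⟨h1, h2⟩, h3⟩
    have hend : EntryBound (q' r) (T (endBox h)) := (hbound _).mpr ⟨h1 (endBox h), h3⟩
    refine ⟨fun b => ?_, h2⟩
    have hb := h1 b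
    by_cases hbr : b.1.1 = r
    · rw [hbr] at hb ⊢
      by_cases hb2 : b.1.2 = kap r
      · rw [eq_endBox h b hbr hb2]
        exact hend
      · refine hrow _ _ hb (h2.1 b (endBox h) hbr ?_) hend
        have := (mem_skewBoxes.mp b.2).2
        rw [hbr] at this
        exact lt_of_le_of_ne this hb2
    · rw [hq' _ hbr]
      exact hb

/-- The recursion for generating functions of tableaux: the entry `e` is either absent from row `r`
or stands at the end of this row. -/
theorem tableauSum_eq_add {q' q'' : Fin n → ℤ} (h : lam r < kap r)
    (hcorner : ∀ i, r < i → kap i < kap r)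
    (hq' : ∀ i, i ≠ r → q' i = q i) (hq'' : ∀ i, i ≠ r → q'' i = q i) {e : TableauEntry}
    (he : EntryBound (q r) e)
    (hrow : ∀ f, EntryBound (q' r) f ↔ EntryBound (q r) f ∧ RowRel f e)
    (hcol : ∀ i, i < r → ∀ f, EntryBound (q i) f → ColRel f e)
    (hbound : ∀ f, EntryBound (q'' r) f ↔ EntryBound (q r) f ∧ f ≠ e)
    (hrow' : ∀ f g, EntryBound (q r) f → RowRel f g → EntryBound (q'' r) g →
      EntryBound (q'' r) f) :
    tableauSum u v q kap lam = tableauSum u v q'' kap lam +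
      e.weight u v * tableauSum u v q' (Function.update kap r (kap r - 1)) lam := by
  rw [← finsum_tableaux_endBox_eq u v h hcorner hq' he hrow hcol, tableauSum, tableauSum,
    flagTableaux_eq_of_entries h hq'' hbound hrow', ← finsum_mem_union]
  · refine finsum_mem_congr (Set.ext fun T => ?_) fun _ _ => rfl
    simp only [Set.mem_union, Set.mem_ofPred_eq]
    tauto
  · rw [Set.disjoint_left]
    rintro T ⟨_, h1⟩ ⟨_, h2⟩
    exact h1 h2
  · exact (finite_flagTableaux q kap lam).subset fun T hT => hT.1
  · exact (finite_flagTableaux q kap lam).subset fun T hT => hT.1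

/-- There is a box of row s below the end of row r, and no admissible entry of it fits under e.
Hence e cannot stand at the end of row r. -/
theorem tableauSum_eq_of_not_corner {q'' : Fin n → ℤ} (hlam : Antitone lam)
    (hq'' : ∀ i, i ≠ r → q'' i = q i) {e : TableauEntry}
    (hbound : ∀ f, EntryBound (q'' r) f ↔ EntryBound (q r) f ∧ f ≠ e)
    (hrow' : ∀ f g, EntryBound (q r) f → RowRel f g → EntryBound (q'' r) g →
      EntryBound (q'' r) f)
    {s : Fin n} (hs : r < s) (hkap : kap s = kap r)
    (hcol : ∀ f, EntryBound (q s) f → ¬ ColRel e f) :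
    tableauSum u v q kap lam = tableauSum u v q'' kap lam := by
  rcases lt_or_ge (lam r) (kap r) with h | h
  · rw [tableauSum, tableauSum, flagTableaux_eq_of_entries h hq'' hbound hrow']
    refine finsum_mem_congr (Set.ext fun T => ?_) fun _ _ => rfl
    refine ⟨fun hT => ⟨hT, fun he => ?_⟩, fun hT => hT.1⟩
    rw [mem_flagTableaux] at hT
    have hmem : (⟨s, kap r⟩ : Σ _ : Fin n, ℤ) ∈ skewBoxes kap lam :=
      mem_skewBoxes.mpr ⟨(hlam hs.le).trans_lt h, hkap.ge⟩
    refine hcol _ (hT.1 ⟨_, hmem⟩) ?_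
    rw [← he]
    exact hT.2.2 (endBox h) ⟨_, hmem⟩ rfl hs
  · rw [tableauSum, tableauSum, flagTableaux_congr h hq'']

end Recursion

/-! ### Flagged determinants count tableaux -/

section FlagDet

variable {A : Type} [CommRing A] (u v : ℕ → A) {n : ℕ}

/-- The series `∏_{l ≤ q} (1 + v_l t)` for `q ≥ 0`, and `∏_{k ≤ -q} 1 / (1 - u_k t)` for
`q ≤ 0`. -/
noncomputable def flagSeries (q : ℤ) : PowerSeries A :=
  (∏ l ∈ Finset.Icc 1 q.toNat, (1 + PowerSeries.C (v l) * PowerSeries.X)) *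
    ∏ k ∈ Finset.Icc 1 (-q).toNat, geomSeries (u k)

theorem flagSeries_zero : flagSeries u v 0 = 1 := by
  simp [flagSeries]

theorem coeffInt_flagSeries_of_pos {q : ℤ} (hq : 0 < q) (m : ℤ) :
    coeffInt (flagSeries u v q) m = coeffInt (flagSeries u v (q - 1)) m +
      v q.toNat * coeffInt (flagSeries u v (q - 1)) (m - 1) := by
  obtain ⟨k, rfl⟩ : ∃ k : ℕ, q = k + 1 := ⟨(q - 1).toNat, by omega⟩
  have h1 : ((k : ℤ) + 1).toNat = k + 1 := by omega
  have h2 : ((k : ℤ) + 1 - 1).toNat = k := by omega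
  have h3 : (-((k : ℤ) + 1)).toNat = 0 := by omega
  have h4 : (-((k : ℤ) + 1 - 1)).toNat = 0 := by omega
  rw [← coeffInt_linear_mul, flagSeries, flagSeries, h1, h2, h3, h4,
    Finset.prod_Icc_succ_top (by omega), mul_comm (∏ l ∈ Finset.Icc 1 k, _), mul_assoc]

theorem coeffInt_flagSeries_of_neg {q : ℤ} (hq : q < 0) (m : ℤ) :
    coeffInt (flagSeries u v q) m = coeffInt (flagSeries u v (q + 1)) m +
      u (-q).toNat * coeffInt (flagSeries u v q) (m - 1) := by
  obtain ⟨k, rfl⟩ : ∃ k : ℕ, q = -(k + 1) := ⟨(-q - 1).toNat, by omega⟩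
  have h1 : (-(-((k : ℤ) + 1))).toNat = k + 1 := by omega
  have h2 : (-(-((k : ℤ) + 1) + 1)).toNat = k := by omega
  have h3 : (-((k : ℤ) + 1)).toNat = 0 := by omega
  have h4 : (-((k : ℤ) + 1) + 1).toNat = 0 := by omega
  rw [← coeffInt_C_mul_X_mul, ← coeffInt_add]
  congr 1
  rw [flagSeries, flagSeries, h1, h2, h3, h4, Finset.prod_Icc_succ_top (by omega)]
  have h := one_sub_mul_geomSeries (u (k + 1))
  simp only [Finset.Icc_eq_empty (show ¬ 1 ≤ 0 by omega), Finset.prod_empty, one_mul]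
  linear_combination (∏ k ∈ Finset.Icc 1 k, geomSeries (u k)) * h

/-- The determinant which counts flagged tableaux. -/
noncomputable def flagDet (q kap lam : Fin n → ℤ) : A :=
  Matrix.det (Matrix.of fun i j : Fin n =>
    coeffInt (flagSeries u v (q i)) (kap i - (i : ℤ) - (lam j - (j : ℤ))))

variable {q kap lam : Fin n → ℤ} {r : Fin n}

/-- Linearity in row r. The degree shift m - 1 amounts to removing the last box of that row. -/
theorem flagDet_eq_add {q' q'' : Fin n → ℤ} (hq' : ∀ i, i ≠ r → q' i = q i)
    (hq'' : ∀ i, i ≠ r → q'' i = q i) (a : A)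
    (h : ∀ m, coeffInt (flagSeries u v (q r)) m = coeffInt (flagSeries u v (q'' r)) m +
      a * coeffInt (flagSeries u v (q' r)) (m - 1)) :
    flagDet u v q kap lam = flagDet u v q'' kap lam +
      a * flagDet u v q' (Function.update kap r (kap r - 1)) lam := by
  set M' : Matrix (Fin n) (Fin n) A := Matrix.of fun i j : Fin n =>
    coeffInt (flagSeries u v (q' i))
      (Function.update kap r (kap r - 1) i - (i : ℤ) - (lam j - (j : ℤ))) with hM'
  set M'' : Matrix (Fin n) (Fin n) A := Matrix.of fun i j : Fin n =>
    coeffInt (flagSeries u v (q'' i)) (kap i - (i : ℤ) - (lam j - (j : ℤ))) with hM''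
  have h1 : (Matrix.of fun i j : Fin n =>
      coeffInt (flagSeries u v (q i)) (kap i - (i : ℤ) - (lam j - (j : ℤ)))) =
      M''.updateRow r (M'' r + a • M' r) := by
    ext i j
    by_cases hi : i = r
    · subst hi
      rw [Matrix.updateRow_self, Matrix.of_apply, h]
      simp only [hM', hM'', Pi.add_apply, Pi.smul_apply, Matrix.of_apply, smul_eq_mul,
        Function.update_self]
      congr 3
      ring
    · rw [Matrix.updateRow_ne hi, hM'', Matrix.of_apply, Matrix.of_apply, hq'' i hi]
  have h2 : M''.updateRow r (M' r) = M' := by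
    ext i j
    by_cases hi : i = r
    · rw [hi, Matrix.updateRow_self]
    · rw [Matrix.updateRow_ne hi, hM'', hM', Matrix.of_apply, Matrix.of_apply, hq' i hi,
        hq'' i hi, Function.update_of_ne hi]
  rw [flagDet, h1, Matrix.det_updateRow_add, Matrix.det_updateRow_smul, Matrix.updateRow_eq_self,
    h2, flagDet, flagDet]

theorem flagDet_eq_zero_of_adjacent {q' : Fin n → ℤ} {s : Fin n} (hs : (s : ℕ) = r + 1)
    (hkap : kap s = kap r) (hq : q' r = q' s) :
    flagDet u v q' (Function.update kap r (kap r - 1)) lam = 0 := by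
  have hne : r ≠ s := by
    rintro rfl
    omega
  refine Matrix.det_zero_of_row_eq hne ?_
  ext j
  rw [Matrix.of_apply, Matrix.of_apply, Function.update_self, Function.update_of_ne hne.symm, hq,
    hkap, hs]
  congr 1
  push_cast
  ring

theorem antitone_update_corner (hkap : Antitone kap) (hcorner : ∀ i, r < i → kap i < kap r) :
    Antitone (Function.update kap r (kap r - 1)) := by
  intro i j hij
  by_cases hi : i = r
  · subst hi
    rw [Function.update_self]
    by_cases hj : j = i
    · rw [hj, Function.update_self]
    · rw [Function.update_of_ne hj]
      have := hcorner j (lt_of_le_of_ne hij fun h => hj h.symm)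
      omega
  · rw [Function.update_of_ne hi]
    by_cases hj : j = r
    · subst hj
      rw [Function.update_self]
      have := hkap hij
      omega
    · rw [Function.update_of_ne hj]
      exact hkap hij

theorem flagDet_zero (hkap : Antitone kap) (hlam : Antitone lam) (hle : lam ≤ kap)
    (hq : ∀ i, q i = 0) : flagDet u v q kap lam = tableauSum u v q kap lam := by
  by_cases h : kap = lam
  · subst h
    have h1 : (Matrix.of fun i j : Fin n => coeffInt (flagSeries u v (q i))
        (kap i - (i : ℤ) - (kap j - (j : ℤ)))) = 1 := by
      ext i j
      rw [Matrix.of_apply, hq, flagSeries_zero, coeffInt_one, Matrix.one_apply]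
      simp only [sub_eq_zero]
      exact if_congr (strictAnti_sub_id hkap).injective.eq_iff rfl rfl
    have hemp : IsEmpty ↥(skewBoxes kap kap) := by
      refine ⟨fun b => ?_⟩
      have := mem_skewBoxes.mp b.2
      omega
    have h2 : flagTableaux q kap kap = {fun b => hemp.elim b} := by
      ext T
      rw [mem_flagTableaux, Set.mem_singleton_iff]
      exact ⟨fun _ => _root_.funext fun b => hemp.elim b, fun _ =>
        ⟨fun b => hemp.elim b, fun b => hemp.elim b, fun b => hemp.elim b⟩⟩
    rw [flagDet, h1, Matrix.det_one, tableauSum, h2, finsum_mem_singleton, fillingWeight,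
      Finset.univ_eq_empty, Finset.prod_empty]
  · obtain ⟨r, hr⟩ : ∃ r, lam r < kap r := by
      by_contra hc
      push Not at hc
      exact h (le_antisymm hc hle)
    have h1 : flagDet u v q kap lam = 0 := by
      refine Matrix.det_eq_zero_of_upper_block _ r fun i j hi hj => ?_
      rw [Matrix.of_apply, hq, flagSeries_zero, coeffInt_one, if_neg]
      have h1 := (strictAnti_sub_id hkap).antitone hi
      have h2 := (strictAnti_sub_id hlam).antitone hj
      omega
    have h2 : flagTableaux q kap lam = ∅ := by
      rw [Set.eq_empty_iff_forall_notMem]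
      intro T hT
      have := (mem_flagTableaux.mp hT).1 (endBox hr)
      rw [hq] at this
      cases hT : T (endBox hr) <;> rw [hT, EntryBound] at this <;> omega
    rw [h1, tableauSum, h2, finsum_mem_empty]

theorem exists_next_of_not_corner (hkap : Antitone kap)
    (hcorner : ¬ ∀ i, r < i → kap i < kap r) : ∃ s : Fin n, (s : ℕ) = r + 1 ∧ kap s = kap r := by
  push Not at hcorner
  obtain ⟨i, hi, hki⟩ := hcorner
  have hi' : (r : ℕ) < i := hi
  refine ⟨⟨r + 1, by omega⟩, rfl, ?_⟩
  refine le_antisymm (hkap (Fin.mk_le_of_le_val (by simp))) (hki.trans (hkap ?_))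
  exact Fin.mk_le_of_le_val (by simpa using hi')

/-- Determinants and tableau sums satisfy the same recursion. At a corner the last term removes the
box; otherwise it vanishes on the determinant side by equal rows, and on the tableau side because e
cannot occur. -/
theorem flagDet_step (hkap : Antitone kap) (hlam : Antitone lam)
    {q' q'' : Fin n → ℤ} (hq' : ∀ i, i ≠ r → q' i = q i) (hq'' : ∀ i, i ≠ r → q'' i = q i)
    {e : TableauEntry}
    (hcoeff : ∀ m, coeffInt (flagSeries u v (q r)) m = coeffInt (flagSeries u v (q'' r)) m +
      e.weight u v * coeffInt (flagSeries u v (q' r)) (m - 1))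
    (he : EntryBound (q r) e)
    (hrow : ∀ f, EntryBound (q' r) f ↔ EntryBound (q r) f ∧ RowRel f e)
    (hcol : ∀ i, i < r → ∀ f, EntryBound (q i) f → ColRel f e)
    (hbound : ∀ f, EntryBound (q'' r) f ↔ EntryBound (q r) f ∧ f ≠ e)
    (hrow' : ∀ f g, EntryBound (q r) f → RowRel f g → EntryBound (q'' r) g → EntryBound (q'' r) f)
    (hadj : ∀ s : Fin n, (s : ℕ) = r + 1 → kap s = kap r →
      q' r = q' s ∧ ∀ f, EntryBound (q s) f → ¬ ColRel e f)
    (h'' : flagDet u v q'' kap lam = tableauSum u v q'' kap lam)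
    (h' : Antitone (Function.update kap r (kap r - 1)) → lam r < kap r →
      flagDet u v q' (Function.update kap r (kap r - 1)) lam =
        tableauSum u v q' (Function.update kap r (kap r - 1)) lam) :
    flagDet u v q kap lam = tableauSum u v q kap lam := by
  rw [flagDet_eq_add u v hq' hq'' _ hcoeff, h'']
  by_cases hcorner : ∀ i, r < i → kap i < kap r
  · have hanti := antitone_update_corner hkap hcorner
    rcases lt_or_ge (lam r) (kap r) with h | h
    · rw [tableauSum_eq_add u v h hcorner hq' hq'' he hrow hcol hbound hrow', h' hanti h]
    · have h0 : flagDet u v q' (Function.update kap r (kap r - 1)) lam = 0 := by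
        refine det_coeffInt_eq_zero hanti hlam _ fun hle => ?_
        have : lam r ≤ Function.update kap r (kap r - 1) r := hle r
        rw [Function.update_self] at this
        omega
      rw [h0, mul_zero, add_zero, tableauSum, tableauSum, flagTableaux_congr h hq'']
  · obtain ⟨s, hs, hks⟩ := exists_next_of_not_corner hkap hcorner
    rw [flagDet_eq_zero_of_adjacent u v hs hks (hadj s hs hks).1, mul_zero, add_zero,
      tableauSum_eq_of_not_corner u v hlam hq'' hbound hrow' (Fin.lt_def.mpr (by omega)) hks
        (hadj s hs hks).2]

/-- Induction on the sum of the |q_i| plus the number of boxes, using up the largest primed entries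
first and then the largest plain ones. The gap condition makes the equal-row argument work for
primed entries when the chosen row does not end in a corner. -/
theorem flagDet_eq_tableauSum (hkap : Antitone kap) (hlam : Antitone lam) (hle : lam ≤ kap)
    (hq : Antitone q)
    (hgap : ∀ i j : Fin n, (j : ℕ) = i + 1 → 0 < q i → q i - q j ≤ kap i - kap j + 1) :
    flagDet u v q kap lam = tableauSum u v q kap lam := by
  obtain ⟨N, hN⟩ : ∃ N : ℕ, ∑ i, (q i).natAbs + ∑ i, (kap i - lam i).toNat = N := ⟨_, rfl⟩
  induction N using Nat.strong_induction_on generalizing q kap with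
  | _ N ih =>
    by_cases hzero : ∀ i, q i = 0
    · exact flagDet_zero u v hkap hlam hle hzero
    have hupdle : ∀ r, lam r < kap r → lam ≤ Function.update kap r (kap r - 1) := by
      intro r hr i
      by_cases hi : i = r
      · rw [hi, Function.update_self]
        exact Int.le_sub_one_of_lt hr
      · rw [Function.update_of_ne hi]
        exact hle i
    have hupdsum : ∀ r, lam r < kap r →
        ∑ i, (Function.update kap r (kap r - 1) i - lam i).toNat < ∑ i, (kap i - lam i).toNat := by
      intro r hr
      refine Finset.sum_lt_sum (fun i _ => ?_) ⟨r, Finset.mem_univ _, ?_⟩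
      · by_cases hi : i = r
        · rw [hi, Function.update_self]
          omega
        · rw [Function.update_of_ne hi]
      · rw [Function.update_self]
        omega
    have hqsum : ∀ r c, c.natAbs < (q r).natAbs →
        ∑ i, (Function.update q r c i).natAbs < ∑ i, (q i).natAbs := by
      intro r c hc
      refine Finset.sum_lt_sum (fun i _ => ?_) ⟨r, Finset.mem_univ _, ?_⟩
      · by_cases hi : i = r
        · rw [hi, Function.update_self]
          omega
        · rw [Function.update_of_ne hi]
      · rwa [Function.update_self]
    have hne : ∀ {r : Fin n} {c : ℤ}, ∀ i, i ≠ r → Function.update q r c i = q i :=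
      fun i hi => Function.update_of_ne hi _ _
    by_cases hpos : ∃ i, 0 < q i
    -- The last row with maximal q: the rows above have the same bound, so Q' may stand below any of
    -- their entries. Primed entries increase strictly along rows, hence both the absence and the
    -- removal of Q' lower the bound to Q - 1.
    · obtain ⟨r, -, hr⟩ := Finset.exists_max_image (Finset.univ : Finset (Fin n))
        (fun i => toLex (q i, i)) ⟨hpos.choose, Finset.mem_univ _⟩
      have hr : ∀ i, q i < q r ∨ q i = q r ∧ i ≤ r := fun i =>
        (Prod.Lex.toLex_le_toLex.mp (hr i (Finset.mem_univ i)))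
      have hrpos : 0 < q r := by
        obtain ⟨i, hi⟩ := hpos
        have := hr i
        omega
      have hlt : ∀ i, i < r → q i = q r := fun i hi => by
        have h1 := hq hi.le
        have h2 := hr i
        omega
      have hgt : ∀ i, r < i → q i < q r := fun i hi =>
        (hr i).resolve_right fun h => absurd h.2 (not_le.mpr hi)
      set Q := q r with hQ
      have hanti : Antitone (Function.update q r (Q - 1)) :=
        antitone_update_corner hq hgt
      have hgap' : ∀ kap' : Fin n → ℤ, (∀ i, i ≠ r → kap' i = kap i) →
          (kap' r = kap r ∨ kap' r = kap r - 1) → ∀ i j : Fin n, (j : ℕ) = i + 1 →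
            0 < Function.update q r (Q - 1) i →
              Function.update q r (Q - 1) i - Function.update q r (Q - 1) j ≤
                kap' i - kap' j + 1 := by
        intro kap' h1 h2 i j hij hi
        have hkij := hkap (show i ≤ j from Fin.le_def.mpr (by omega))
        by_cases hir : i = r
        · subst hir
          have hji : j ≠ i := fun h => by subst h; omega
          rw [Function.update_self, Function.update_of_ne hji, h1 j hji]
          have := hgap i j hij hrpos
          omega
        · rw [Function.update_of_ne hir] at hi ⊢
          by_cases hjr : j = r
          · subst hjr
            rw [Function.update_self, h1 i hir, hlt i (Fin.lt_def.mpr (by omega))]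
            omega
          · rw [Function.update_of_ne hjr, h1 i hir, h1 j hjr]
            exact hgap i j hij hi
      have hcase : ∀ f, EntryBound (Q - 1) f ↔ EntryBound Q f ∧ f ≠ .primed Q.toNat := by
        rintro (k | l | ⟨k, l⟩) <;> simp only [EntryBound, ne_eq, TableauEntry.primed.injEq,
          reduceCtorEq, not_false_eq_true, false_and] <;> omega
      refine flagDet_step u v hkap hlam (r := r) (q' := Function.update q r (Q - 1))
        (q'' := Function.update q r (Q - 1)) (e := .primed Q.toNat) hne hne ?_ ?_ ?_ ?_ ?_ ?_ ?_
        ?_ ?_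
      · rw [Function.update_self]
        exact coeffInt_flagSeries_of_pos u v hrpos
      · simp only [EntryBound]
        omega
      · rw [Function.update_self]
        rintro (k | l | ⟨k, l⟩) <;> simp only [EntryBound, RowRel, and_false, iff_false] <;> omega
      · intro i hi
        rw [hlt i hi]
        rintro (k | l | ⟨k, l⟩) <;> simp only [EntryBound, ColRel, false_implies] <;> omega
      · rw [Function.update_self]
        exact hcase
      · rw [Function.update_self]
        rintro (k | l | ⟨k, l⟩) (k' | l' | ⟨k', l'⟩) <;>
          simp only [EntryBound, RowRel, false_implies, implies_true] <;> omega
      -- With equal row ends the gap condition gives q_s ≥ Q - 1, while maximality gives q_s < Q; so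
      -- q_s = Q - 1.
      · intro s hs hks
        have hrs : r < s := Fin.lt_def.mpr (by omega)
        have h1 := hgt s hrs
        have h2 := hgap r s hs hrpos
        rw [Function.update_self, Function.update_of_ne hrs.ne']
        refine ⟨by omega, ?_⟩
        rintro (k | l | ⟨k, l⟩) <;> simp only [EntryBound, ColRel, false_implies] <;> omega
      · refine ih _ ?_ hkap hle hanti (hgap' kap (fun _ _ => rfl) (Or.inl rfl)) rfl
        have := hqsum r (Q - 1) (by omega)
        omega
      · intro h1 h2
        refine ih _ ?_ h1 (hupdle r h2) hanti (hgap' _ (fun i hi => Function.update_of_ne hi _ _)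
          (Or.inr (Function.update_self _ _ _))) rfl
        have := hqsum r (Q - 1) (by omega)
        have := hupdsum r h2
        omega
    · push Not at hpos hzero
      obtain ⟨i₀, hi₀⟩ := hzero
      -- The first row with minimal q: the rows above allow only smaller plain entries, and those
      -- below have the same bound. Plain entries may repeat in a row, so removing one keeps q.
      obtain ⟨r, -, hr⟩ := Finset.exists_min_image (Finset.univ : Finset (Fin n))
        (fun i => toLex (q i, i)) ⟨i₀, Finset.mem_univ _⟩
      have hr : ∀ i, q r < q i ∨ q r = q i ∧ r ≤ i := fun i =>
        (Prod.Lex.toLex_le_toLex.mp (hr i (Finset.mem_univ i)))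
      have hrneg : q r < 0 := by
        have h1 := hr i₀
        have h2 := hpos i₀
        omega
      have hlt : ∀ i, i < r → q r < q i := fun i hi =>
        (hr i).resolve_right fun h => absurd h.2 (not_le.mpr hi)
      have hgt : ∀ i, r < i → q i = q r := fun i hi => by
        have h1 := hq hi.le
        have h2 := hr i
        omega
      set Q := q r with hQ
      have hanti : Antitone (Function.update q r (Q + 1)) := by
        intro i j hij
        by_cases hj : j = r
        · subst hj
          rw [Function.update_self]
          rcases hij.eq_or_lt with rfl | hij
          · rw [Function.update_self]
          · rw [Function.update_of_ne hij.ne]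
            exact hlt i hij
        · rw [Function.update_of_ne hj]
          by_cases hi : i = r
          · subst hi
            rw [Function.update_self]
            have := hq hij
            omega
          · rw [Function.update_of_ne hi]
            exact hq hij
      have hcase : ∀ f, EntryBound (Q + 1) f ↔ EntryBound Q f ∧ f ≠ .plain (-Q).toNat := by
        rintro (k | l | ⟨k, l⟩) <;> simp only [EntryBound, ne_eq, TableauEntry.plain.injEq,
          reduceCtorEq, not_false_eq_true, false_and] <;> omega
      refine flagDet_step u v hkap hlam (r := r) (q' := q)
        (q'' := Function.update q r (Q + 1)) (e := .plain (-Q).toNat) (fun _ _ => rfl) hne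
        ?_ ?_ ?_ ?_ ?_ ?_ ?_ ?_ ?_
      · rw [Function.update_self]
        exact coeffInt_flagSeries_of_neg u v hrneg
      · simp only [EntryBound]
        omega
      · rintro (k | l | ⟨k, l⟩) <;> simp only [EntryBound, RowRel, and_false, iff_false] <;> omega
      · intro i hi
        have h1 := hlt i hi
        have h2 := hpos i
        rintro (k | l | ⟨k, l⟩) <;> simp only [EntryBound, ColRel, false_implies] <;> omega
      · rw [Function.update_self]
        exact hcase
      · rw [Function.update_self]
        rintro (k | l | ⟨k, l⟩) (k' | l' | ⟨k', l'⟩) <;>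
          simp only [EntryBound, RowRel, false_implies, implies_true] <;> omega
      · intro s hs hks
        have h1 := hgt s (Fin.lt_def.mpr (by omega))
        refine ⟨h1.symm, ?_⟩
        rw [h1]
        rintro (k | l | ⟨k, l⟩) <;> simp only [EntryBound, ColRel, false_implies] <;> omega
      · refine ih _ ?_ hkap hle hanti (fun i j _ hi => ?_) rfl
        · have := hqsum r (Q + 1) (by omega)
          omega
        · exfalso
          by_cases hir : i = r
          · rw [hir, Function.update_self] at hi
            omega
          · rw [Function.update_of_ne hir] at hi
            have := hpos i
            omega
      · intro h1 h2
        refine ih _ ?_ h1 (hupdle r h2) hq (fun i j _ hi => absurd hi (not_lt.mpr (hpos i))) rfl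
        have := hupdsum r h2
        omega

end FlagDet

/-! ### Dual tableaux -/

section Dual

variable {A : Type} [CommRing A] (u v : ℕ → A) {n : ℕ}

/-- Rotation by a half turn, on the boxes of a skew diagram. -/
def rotateBoxes (kap lam : Fin n → ℤ) :
    ↥(skewBoxes kap lam) ≃ ↥(skewBoxes (fun i => -lam i.rev) (fun i => -kap i.rev)) where
  toFun b := ⟨⟨b.1.1.rev, 1 - b.1.2⟩, by
    have := mem_skewBoxes.mp b.2
    rw [mem_skewBoxes]
    simp only [Fin.rev_rev]
    omega⟩
  invFun b := ⟨⟨b.1.1.rev, 1 - b.1.2⟩, by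
    have := mem_skewBoxes.mp b.2
    rw [mem_skewBoxes]
    simp only at this ⊢
    omega⟩
  left_inv b := by
    refine Subtype.ext (Sigma.ext (Fin.rev_rev _) (heq_of_eq ?_))
    simp
  right_inv b := by
    refine Subtype.ext (Sigma.ext (Fin.rev_rev _) (heq_of_eq ?_))
    simp

/-- A half turn reverses rows and columns and exchanges the roles of inner and outer boundary,
turning dual tableaux into ordinary ones with flags -p in reverse order. -/
theorem finsum_dualTableaux_eq (p nu : Fin n → ℤ) :
    ∑ᶠ T ∈ dualTableaux321 p nu, fillingWeight u v T =
      tableauSum u v (fun i => -p i.rev) (fun i => -rhoSeq p i.rev) fun i => -nu i.rev := by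
  rw [tableauSum]
  refine finsum_mem_eq_of_bijOn (fun T b => T ((rotateBoxes nu (rhoSeq p)).symm b))
    ⟨?_, ?_, ?_⟩ ?_
  · intro T hT
    rw [mem_dualTableaux321] at hT
    rw [mem_flagTableaux]
    refine ⟨fun b => hT.1 _, fun b b' h1 h2 => hT.2.1 _ _ ?_ ?_, fun b b' h1 h2 => hT.2.2 _ _ ?_ ?_⟩
    · exact congrArg Fin.rev h1
    · exact sub_lt_sub_left h2 1
    · exact congrArg (fun j => 1 - j) h1
    · exact Fin.rev_lt_rev.mpr h2
  · intro T _ T' _ h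
    refine _root_.funext fun b => ?_
    have := congrFun h (rotateBoxes nu (rhoSeq p) b)
    simpa using this
  · intro T hT
    rw [mem_flagTableaux] at hT
    refine ⟨fun b => T (rotateBoxes nu (rhoSeq p) b), mem_dualTableaux321.mpr ⟨fun b => ?_,
      fun b b' h1 h2 => hT.2.1 _ _ ?_ ?_, fun b b' h1 h2 => hT.2.2 _ _ ?_ ?_⟩, ?_⟩
    · have := hT.1 (rotateBoxes nu (rhoSeq p) b)
      simp only [rotateBoxes, Equiv.coe_fn_mk, Fin.rev_rev] at this
      exact this
    · exact congrArg Fin.rev h1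
    · exact sub_lt_sub_left h2 1
    · exact congrArg (fun j => 1 - j) h1
    · exact Fin.rev_lt_rev.mpr h2
    · refine _root_.funext fun b => ?_
      simp
  · intro T _
    rw [fillingWeight, fillingWeight]
    exact (Equiv.prod_comp (rotateBoxes nu (rhoSeq p)).symm fun b => (T b).weight u v).symm

theorem antitone_rhoSeq {p : Fin n → ℤ} (hp : StrictAnti p) : Antitone (rhoSeq p) := by
  intro i j hij
  have := antitone_add_id hp hij
  simp only [rhoSeq] at this ⊢
  omega

theorem antitone_kappaSeq {q : Fin n → ℤ} (hq : StrictAnti q) : Antitone (kappaSeq q) := by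
  intro i j hij
  have := antitone_add_id hq hij
  simp only [kappaSeq] at this ⊢
  omega

theorem finsum_tableaux321_eq_det {q lam : Fin n → ℤ} (hq : StrictAnti q) (hlam : Antitone lam)
    (hle : lam ≤ kappaSeq q) :
    ∑ᶠ T ∈ tableaux321 q lam, fillingWeight u v T =
      Matrix.det (Matrix.of fun i j : Fin n =>
        coeffInt (flagSeries u v (q i)) (kappaSeq q i - (i : ℤ) - (lam j - (j : ℤ)))) := by
  refine (flagDet_eq_tableauSum u v (antitone_kappaSeq hq) hlam hle hq.antitone ?_).symm
  -- For κ the gap condition holds with equality: κ_i - κ_{i+1} = q_i - q_{i+1} - 1.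
  intro i j hij _
  simp only [kappaSeq, hij]
  push_cast
  omega

theorem finsum_dualTableaux321_eq_det {p nu : Fin n → ℤ} (hp : StrictAnti p) (hnu : Antitone nu)
    (hle : rhoSeq p ≤ nu) :
    ∑ᶠ T ∈ dualTableaux321 p nu, fillingWeight u v T =
      Matrix.det (Matrix.of fun i j : Fin n =>
        coeffInt (flagSeries u v (-p j)) (nu i - (i : ℤ) - (rhoSeq p j - (j : ℤ)))) := by
  rw [finsum_dualTableaux_eq, ← flagDet_eq_tableauSum u v, flagDet, ← Matrix.det_transpose,
    ← Matrix.det_submatrix_equiv_self Fin.revPerm]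
  · congr 1
    ext i j
    simp only [Matrix.submatrix_apply, Matrix.transpose_apply, Matrix.of_apply, Fin.revPerm_apply,
      Fin.rev_rev]
    congr 1
    have h1 := Fin.val_rev i
    have h2 := Fin.val_rev j
    omega
  · intro i j hij
    exact neg_le_neg (antitone_rhoSeq hp (Fin.rev_le_rev.mpr hij))
  · intro i j hij
    exact neg_le_neg (hnu (Fin.rev_le_rev.mpr hij))
  · intro i
    exact neg_le_neg (hle i.rev)
  · intro i j hij
    exact neg_le_neg (hp.antitone (Fin.rev_le_rev.mpr hij))
  · intro i j hij _
    have h1 := Fin.val_rev i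
    have h2 := Fin.val_rev j
    simp only [rhoSeq]
    omega

end Dual

/-! ### Alternants -/

section Alternants

variable {R : Type} [CommRing R] {N : ℕ}

/-- The alternant `det (z_i ^ s_j)`. -/
noncomputable def altPoly (R : Type) [CommRing R] {N : ℕ} (s : Fin N → ℕ) :
    MvPolynomial (Fin N) R :=
  Matrix.det (Matrix.of fun i j : Fin N => X i ^ s j)

theorem altPoly_eq_sum (s : Fin N → ℕ) :
    altPoly R s = ∑ σ : Equiv.Perm (Fin N),
      Equiv.Perm.sign σ • monomial (Finsupp.equivFunOnFinite.symm (s ∘ σ)) (1 : R) := by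
  rw [altPoly, ← Matrix.det_transpose, Matrix.det_apply]
  refine Finset.sum_congr rfl fun σ _ => ?_
  rw [monomial_eq, Finsupp.prod_fintype _ _ fun _ => pow_zero _, C_1, one_mul]
  rfl

theorem coeff_altPoly {s b : Fin N → ℕ} (hs : StrictAnti s) (hb : StrictAnti b) :
    coeff (Finsupp.equivFunOnFinite.symm b) (altPoly R s) = if b = s then 1 else 0 := by
  rw [altPoly_eq_sum, coeff_sum, Finset.sum_eq_single 1]
  · simp only [Equiv.Perm.sign_one, one_smul, Equiv.Perm.coe_one, Function.comp_id, coeff_monomial,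
      Equiv.apply_eq_iff_eq, eq_comm]
  · intro σ _ hσ
    rw [coeff_smul, coeff_monomial, if_neg, smul_zero]
    intro h
    have h1 := Finsupp.equivFunOnFinite.symm.injective h
    exact hσ (strictAnti_comp_perm_inj hs hb (σ' := 1) h1).2
  · exact fun h => absurd (Finset.mem_univ _) h

/-- Each monomial of the alternant contains some variable to the power s_k, which exceeds every
exponent in b. -/
theorem coeff_mul_altPoly_eq_zero {s b : Fin N → ℕ} (p : MvPolynomial (Fin N) R)
    (h : ∃ k, ∀ i, b i < s k) :
    coeff (Finsupp.equivFunOnFinite.symm b) (p * altPoly R s) = 0 := by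
  obtain ⟨k, hk⟩ := h
  rw [altPoly_eq_sum, Finset.mul_sum, coeff_sum]
  refine Finset.sum_eq_zero fun σ _ => ?_
  rw [mul_smul_comm, coeff_smul, coeff_mul_monomial', if_neg, smul_zero]
  intro hle
  have h1 := hle (σ.symm k)
  have h2 := hk (σ.symm k)
  simp only [Finsupp.equivFunOnFinite_symm_apply_apply, Function.comp_apply,
    Equiv.apply_symm_apply] at h1
  omega

theorem altPoly_ne_zero [Nontrivial R] {s : Fin N → ℕ} (hs : StrictAnti s) : altPoly R s ≠ 0 := by
  intro h
  have := coeff_altPoly (R := R) hs hs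
  rw [h, coeff_zero, if_pos rfl] at this
  exact zero_ne_one this

/-- The coefficient of `t^m` in the truncation of `c` at degree `K`. -/
noncomputable def truncCoeff (c : PowerSeries R) (K : ℕ) (m : ℤ) : R :=
  if m ≤ K then coeffInt c m else 0

/-- The truncation of `c` at degree `K`, evaluated at the variable `z_i`. -/
noncomputable def truncAt (c : PowerSeries R) (K : ℕ) (i : Fin N) : MvPolynomial (Fin N) R :=
  ∑ k ∈ Finset.range (K + 1), C (PowerSeries.coeff k c) * X i ^ k

theorem truncAt_mul_pow (c : PowerSeries R) (K : ℕ) (i : Fin N) (a M : ℕ) (hM : K + a ≤ M) :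
    truncAt c K i * X i ^ a =
      ∑ k ∈ Finset.range (M + 1), C (truncCoeff c K ((k : ℤ) - a)) * X i ^ k := by
  rw [truncAt, Finset.sum_mul]
  refine Finset.sum_of_injOn (fun k => k + a) (fun k _ l _ h => by simpa using h) ?_ ?_ ?_
  · intro k hk
    simp only [Finset.coe_range, Set.mem_Iio] at hk ⊢
    omega
  · intro k _ hk
    rw [truncCoeff]
    split_ifs with h
    · rw [coeffInt_of_neg, C_0, zero_mul]
      by_contra hc
      refine hk ⟨k - a, ?_, ?_⟩
      · simp only [Finset.coe_range, Set.mem_Iio]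
        omega
      · simp only
        omega
    · rw [C_0, zero_mul]
  · intro k hk
    rw [Finset.mem_range] at hk
    rw [truncCoeff, if_pos (by push_cast; omega)]
    push_cast
    rw [add_sub_cancel_right, coeffInt_natCast, pow_add, mul_assoc]

open Classical in
-- The Cauchy identity in alternant form: put the factor c(z_i) into row i of the alternant and
-- apply Cauchy–Binet. Truncating c keeps everything polynomial.
theorem prod_truncAt_mul_altPoly (c : PowerSeries R) (K : ℕ) (a : Fin N → ℕ) {M : ℕ}
    (hM : ∀ j, K + a j ≤ M) :
    (∏ i, truncAt c K i) * altPoly R a =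
      ∑ s ∈ (Fintype.piFinset fun _ : Fin N => Finset.range (M + 1)).filter StrictAnti,
        C (Matrix.det (Matrix.of fun k j : Fin N => truncCoeff c K ((s k : ℤ) - a j))) *
          altPoly R s := by
  rw [altPoly, ← Matrix.det_mul_column]
  have h1 : (Matrix.of fun i j : Fin N => truncAt c K i *
      (Matrix.of fun i j : Fin N => (X i : MvPolynomial (Fin N) R) ^ a j) i j) =
      Matrix.of fun i j : Fin N => ∑ k ∈ Finset.range (M + 1),
        (X i : MvPolynomial (Fin N) R) ^ k * C (truncCoeff c K ((k : ℤ) - a j)) := by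
    ext1 i j
    rw [Matrix.of_apply, Matrix.of_apply, Matrix.of_apply, truncAt_mul_pow c K i (a j) M (hM j)]
    exact Finset.sum_congr rfl fun k _ => mul_comm _ _
  rw [h1, Matrix.det_sum_mul (Finset.range (M + 1))
    (fun (i : Fin N) (k : ℕ) => (X i : MvPolynomial (Fin N) R) ^ k)
    (fun k j => C (truncCoeff c K ((k : ℤ) - a j)))]
  refine Finset.sum_congr rfl fun s _ => ?_
  rw [mul_comm, altPoly, RingHom.map_det]
  rfl

/-! ### The bialternant formula -/

/-- The generating series `∏ 1 / (1 - z_i t)` of the complete symmetric polynomials. -/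
noncomputable def completeSeries (R : Type) [CommRing R] (N : ℕ) :
    PowerSeries (MvPolynomial (Fin N) R) :=
  ∏ i : Fin N, geomSeries (X i)

theorem constantCoeff_completeSeries :
    PowerSeries.constantCoeff (completeSeries R N) = 1 := by
  rw [completeSeries, map_prod, Finset.prod_eq_one fun i _ => constantCoeff_geomSeries _]

theorem coeffInt_mul_of_degree {A : Type} [CommRing A] (f g : PowerSeries A) {D : ℕ}
    (hg : ∀ a : ℤ, D < a → coeffInt g a = 0) {l : ℕ} (hl : D < l) (m : ℤ) :
    coeffInt (f * g) (m + (l - 1)) =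
      ∑ j : Fin l, coeffInt f (m + (j : ℤ)) * coeffInt g ((l : ℤ) - 1 - (j : ℤ)) := by
  have h := coeffInt_mul f g (b := m + (l - 1)) (d := 0) (B := max (m + (l - 1)) (l - 1)) (D := 0)
    le_rfl (le_max_left _ _)
  rw [sub_zero] at h
  rw [h]
  symm
  refine Finset.sum_of_injOn (fun j : Fin l => (l : ℤ) - 1 - (j : ℤ)) ?_ ?_ ?_ ?_
  · intro i _ j _ hij
    simp only at hij
    exact Fin.ext (by omega)
  · intro j _
    have := j.2
    rw [Finset.mem_coe, Finset.mem_Icc]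
    change ((0 : ℕ) : ℤ) ≤ (l : ℤ) - 1 - (j : ℤ) ∧ (l : ℤ) - 1 - (j : ℤ) ≤ max (m + (l - 1)) (l - 1)
    omega
  · intro a ha hna
    rw [Finset.mem_Icc] at ha
    rw [hg, mul_zero]
    rw [sub_zero]
    by_contra hc
    refine hna ⟨⟨(l - 1 - a).toNat, by omega⟩, Finset.mem_coe.mpr (Finset.mem_univ _), ?_⟩
    simp only
    omega
  · intro j _
    rw [sub_zero]
    congr 2
    ring

/-- The matrix `(c_{mu_k + l - k})` of size `N`. -/
noncomputable def schurMatrix {A : Type} [CommRing A] (c : PowerSeries A) (mu : ℕ → ℕ) (N : ℕ) :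
    Matrix (Fin N) (Fin N) A :=
  Matrix.of fun k l : Fin N => coeffInt c ((mu k : ℤ) + (l : ℤ) - (k : ℤ))

theorem det_schurMatrix_zero {A : Type} [CommRing A] {c : PowerSeries A}
    (hc : PowerSeries.constantCoeff c = 1) (N : ℕ) : (schurMatrix c (fun _ => 0) N).det = 1 := by
  rw [Matrix.det_of_isUpperTriangular]
  · refine Finset.prod_eq_one fun i _ => ?_
    rw [schurMatrix, Matrix.of_apply, coeffInt_of_nonpos hc (by simp), if_pos (by simp)]
  · intro i j hij
    have : (j : ℕ) < i := hij
    rw [schurMatrix, Matrix.of_apply, coeffInt_of_neg _ (by push_cast; omega)]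

/-- The exponents `mu_k + N - 1 - k`. -/
def shiftedPart (N : ℕ) (mu : ℕ → ℕ) (k : Fin N) : ℕ := mu k + (N - 1 - k)

theorem strictAnti_shiftedPart {mu : ℕ → ℕ} (hmu : Antitone mu) :
    StrictAnti (shiftedPart N mu) := by
  intro i j hij
  have h1 : (i : ℕ) < j := hij
  have h2 := hmu h1.le
  have h3 := j.2
  simp only [shiftedPart]
  omega

/-- Since h(t) ∏_{l≠i}(1 - z_l t) = 1/(1 - z_i t), the Jacobi–Trudi matrix times a fixed matrix of
signed elementary polynomials is the transposed alternant matrix. The case mu = 0 identifies the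
determinant of the fixed matrix. -/
theorem det_schurMatrix_mul_altPoly (mu : ℕ → ℕ) :
    (schurMatrix (completeSeries R N) mu N).det * altPoly R (shiftedPart N fun _ => 0) =
      altPoly R (shiftedPart N mu) := by
  classical
  set E : Fin N → PowerSeries (MvPolynomial (Fin N) R) := fun i =>
    ∏ l ∈ Finset.univ.erase i, (1 + PowerSeries.C (-X l) * PowerSeries.X) with hE
  have hEh : ∀ i, completeSeries R N * E i = geomSeries (X i) := by
    intro i
    rw [completeSeries, hE, ← Finset.mul_prod_erase _ _ (Finset.mem_univ i), mul_assoc,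
      ← Finset.prod_mul_distrib, Finset.prod_eq_one, mul_one]
    intro l _
    rw [mul_comm, map_neg, neg_mul, ← sub_eq_add_neg, one_sub_mul_geomSeries]
  have key : ∀ mu : ℕ → ℕ, (altPoly R (shiftedPart N mu)) =
      (schurMatrix (completeSeries R N) mu N).det *
        Matrix.det (Matrix.of fun j i : Fin N => coeffInt (E i) ((N : ℤ) - 1 - (j : ℤ))) := by
    intro mu
    rw [← Matrix.det_mul, altPoly, ← Matrix.det_transpose]
    congr 1
    ext1 k i
    have hN : N - 1 < N := by have := k.2; omega
    have h1 := coeffInt_mul_of_degree (completeSeries R N) (E i) (D := N - 1) (l := N)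
      (fun a ha => coeffInt_prod_linear_of_card_lt _ _ (by
        rw [Finset.card_erase_of_mem (Finset.mem_univ i), Finset.card_univ, Fintype.card_fin]
        exact ha)) hN ((mu k : ℤ) - k)
    rw [Matrix.mul_apply, Matrix.transpose_apply, Matrix.of_apply]
    rw [hEh, show (mu k : ℤ) - (k : ℤ) + ((N : ℤ) - 1) = (shiftedPart N mu k : ℕ) by
      have := k.2
      rw [shiftedPart]
      omega, coeffInt_natCast, geomSeries, PowerSeries.coeff_mk] at h1
    rw [h1]
    refine Finset.sum_congr rfl fun j _ => ?_
    rw [schurMatrix, Matrix.of_apply, Matrix.of_apply]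
    congr 2
    ring
  rw [key mu, key fun _ => 0, det_schurMatrix_zero constantCoeff_completeSeries, one_mul]

/-- With more positive parts than variables, the coefficients of ∏(1 - z_i t) form a nonzero kernel
vector: h(t) ∏(1 - z_i t) = 1 has no terms of positive degree. -/
theorem det_schurMatrix_eq_zero [IsDomain R] {mu : ℕ → ℕ} {l : ℕ} (hl : N < l)
    (hmu : ∀ k, k < l → 0 < mu k) : (schurMatrix (completeSeries R N) mu l).det = 0 := by
  set E : PowerSeries (MvPolynomial (Fin N) R) :=
    ∏ l : Fin N, (1 + PowerSeries.C (-X l) * PowerSeries.X) with hE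
  have hEh : completeSeries R N * E = 1 := by
    rw [completeSeries, hE, ← Finset.prod_mul_distrib, Finset.prod_eq_one]
    intro l _
    rw [mul_comm, map_neg, neg_mul, ← sub_eq_add_neg, one_sub_mul_geomSeries]
  refine Matrix.exists_mulVec_eq_zero_iff.mp
    ⟨fun j => coeffInt E ((l : ℤ) - 1 - (j : ℤ)), fun h => ?_, ?_⟩
  · have h1 := congrFun h ⟨l - 1, by omega⟩
    have h2 : (l : ℤ) - 1 - ((l - 1 : ℕ) : ℤ) = 0 := by omega
    simp only [Pi.zero_apply, h2] at h1
    rw [coeffInt_of_nonpos (by rw [hE, map_prod, Finset.prod_eq_one fun j _ =>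
      constantCoeff_linear _]) le_rfl, if_pos rfl] at h1
    exact one_ne_zero h1
  · ext1 k
    have h1 := coeffInt_mul_of_degree (completeSeries R N) E (D := N) (l := l)
      (fun a ha => coeffInt_prod_linear_of_card_lt _ _ (by simpa using ha)) hl ((mu k : ℤ) - k)
    rw [hEh, coeffInt_one, if_neg (by have := hmu k k.2; have := k.2; omega)] at h1
    rw [Pi.zero_apply, h1, Matrix.mulVec, dotProduct]
    refine Finset.sum_congr rfl fun j _ => ?_
    rw [schurMatrix, Matrix.of_apply]
    congr 2
    ring

end Alternants

/-! ### Schur determinants -/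

section SchurDet

theorem coeffInt_map {A B : Type} [CommRing A] [CommRing B] (φ : A →+* B) (f : PowerSeries A)
    (m : ℤ) : coeffInt (PowerSeries.map φ f) m = φ (coeffInt f m) := by
  rw [coeffInt, coeffInt]
  split_ifs
  · rw [map_zero]
  · rw [PowerSeries.coeff_map]

theorem map_det_coeffInt {A B : Type} [CommRing A] [CommRing B] (φ : A →+* B) {N : ℕ}
    (f : Fin N → Fin N → PowerSeries A) (m : Fin N → Fin N → ℤ) :
    φ (Matrix.det (Matrix.of fun i j => coeffInt (f i j) (m i j))) =
      Matrix.det (Matrix.of fun i j => coeffInt (PowerSeries.map φ (f i j)) (m i j)) := by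
  rw [RingHom.map_det]
  congr 1
  ext1 i j
  rw [RingHom.mapMatrix_apply, Matrix.map_apply, Matrix.of_apply, Matrix.of_apply, coeffInt_map]

theorem map_det_schurMatrix {A B : Type} [CommRing A] [CommRing B] (φ : A →+* B)
    (c : PowerSeries A) (mu : ℕ → ℕ) (N : ℕ) :
    φ (schurMatrix c mu N).det = (schurMatrix (PowerSeries.map φ c) mu N).det :=
  map_det_coeffInt φ (fun _ _ => c) _

theorem map_schurDet {A B : Type} [CommRing A] [CommRing B] (φ : A →+* B) (c : PowerSeries A)
    (mu : YoungDiagram) : φ (schurDet c mu) = schurDet (PowerSeries.map φ c) mu :=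
  map_det_schurMatrix φ c _ _

theorem det_schurMatrix_succ {A : Type} [CommRing A] {c : PowerSeries A}
    (hc : PowerSeries.constantCoeff c = 1) {mu : ℕ → ℕ} {N : ℕ} (hN : mu N = 0) :
    (schurMatrix c mu (N + 1)).det = (schurMatrix c mu N).det := by
  rw [Matrix.det_succ_row _ (Fin.last N), Fin.sum_univ_castSucc, Finset.sum_eq_zero, zero_add]
  · have h : schurMatrix c mu (N + 1) (Fin.last N) (Fin.last N) = 1 := by
      rw [schurMatrix, Matrix.of_apply, Fin.val_last, hN, coeffInt_of_nonpos hc (by simp),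
        if_pos (by simp)]
    rw [h, mul_one, Even.neg_one_pow ⟨N, by simp⟩, one_mul]
    congr 1
    ext1 i j
    simp [schurMatrix]
  · intro j _
    have := j.2
    have h : schurMatrix c mu (N + 1) (Fin.last N) j.castSucc = 0 := by
      rw [schurMatrix, Matrix.of_apply, Fin.val_last, hN, coeffInt_of_neg]
      simp
    rw [h, mul_zero, zero_mul]

theorem rowLen_eq_zero_iff {mu : YoungDiagram} {k : ℕ} : mu.rowLen k = 0 ↔ mu.colLen 0 ≤ k := by
  rw [← not_lt, ← YoungDiagram.mem_iff_lt_colLen, YoungDiagram.mem_iff_lt_rowLen, not_lt,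
    Nat.le_zero]

theorem schurDet_eq_det {A : Type} [CommRing A] {c : PowerSeries A}
    (hc : PowerSeries.constantCoeff c = 1) {mu : YoungDiagram} {N : ℕ} (hN : mu.colLen 0 ≤ N) :
    schurDet c mu = (schurMatrix c mu.rowLen N).det := by
  induction N, hN using Nat.le_induction with
  | base => rfl
  | succ N hN ih => rw [ih, det_schurMatrix_succ hc (rowLen_eq_zero_iff.mpr hN)]

theorem rowLen_diagramOf {n : ℕ} {lam : Fin n → ℤ} (hlam : Antitone lam) (i : Fin n) :
    (diagramOf lam).rowLen i = (lam i).toNat := by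
  refine eq_of_forall_lt_iff fun j => ?_
  rw [← YoungDiagram.mem_iff_lt_rowLen, mem_diagramOf hlam]
  constructor
  · rintro ⟨h, h1⟩
    have : (j : ℤ) < lam i := h1
    omega
  · intro h
    refine ⟨i.2, ?_⟩
    change (j : ℤ) < lam i
    omega

theorem colLen_diagramOf_le {n : ℕ} {lam : Fin n → ℤ} (hlam : Antitone lam) :
    (diagramOf lam).colLen 0 ≤ n := by
  by_contra! h
  rw [← YoungDiagram.mem_iff_lt_colLen, mem_diagramOf hlam] at h
  obtain ⟨h, -⟩ := h
  exact lt_irrefl _ h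

theorem youngDiagram_ext_of_rowLen {mu nu : YoungDiagram} {N : ℕ} (hmu : mu.colLen 0 ≤ N)
    (hnu : nu.colLen 0 ≤ N) (h : ∀ i < N, mu.rowLen i = nu.rowLen i) : mu = nu := by
  ext ⟨i, j⟩
  rw [YoungDiagram.mem_cells, YoungDiagram.mem_cells, YoungDiagram.mem_iff_lt_rowLen,
    YoungDiagram.mem_iff_lt_rowLen]
  by_cases hi : i < N
  · rw [h i hi]
  · rw [rowLen_eq_zero_iff.mpr (hmu.trans (not_lt.mp hi)),
      rowLen_eq_zero_iff.mpr (hnu.trans (not_lt.mp hi))]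

theorem antitone_rowLen (mu : YoungDiagram) : Antitone mu.rowLen :=
  fun _ _ h => mu.rowLen_anti _ _ h

/-- The partition `mu` with `mu_k + N - 1 - k = s_k`. -/
def diagramOfShifted {N : ℕ} (s : Fin N → ℕ) : YoungDiagram :=
  diagramOf fun k : Fin N => (s k : ℤ) - ((N : ℤ) - 1 - k)

theorem antitone_sub_staircase {N : ℕ} {s : Fin N → ℕ} (hs : StrictAnti s) :
    Antitone fun k : Fin N => (s k : ℤ) - ((N : ℤ) - 1 - k) := by
  have h : StrictAnti fun k : Fin N => (s k : ℤ) - ((N : ℤ) - 1) :=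
    fun i j hij => by simpa using hs hij
  intro i j hij
  have h1 := antitone_add_id h hij
  simp only at h1 ⊢
  omega

theorem sub_staircase_nonneg {N : ℕ} {s : Fin N → ℕ} (hs : StrictAnti s) (k : Fin N) :
    (N : ℤ) - 1 - k ≤ s k := by
  have h0 : (k : ℕ) ≤ N - 1 := by have := k.2; omega
  have h1 := antitone_sub_staircase hs (show k ≤ ⟨N - 1, by have := k.2; omega⟩ from h0)
  simp only at h1
  have := k.2
  omega

theorem shiftedPart_diagramOfShifted {N : ℕ} {s : Fin N → ℕ} (hs : StrictAnti s) :
    shiftedPart N (diagramOfShifted s).rowLen = s := by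
  ext1 k
  have := sub_staircase_nonneg hs k
  have := k.2
  rw [shiftedPart, diagramOfShifted, rowLen_diagramOf (antitone_sub_staircase hs)]
  omega

theorem colLen_diagramOfShifted_le {N : ℕ} {s : Fin N → ℕ} (hs : StrictAnti s) :
    (diagramOfShifted s).colLen 0 ≤ N := colLen_diagramOf_le (antitone_sub_staircase hs)

theorem shiftedPart_inj {N : ℕ} {mu nu : YoungDiagram} (hmu : mu.colLen 0 ≤ N)
    (hnu : nu.colLen 0 ≤ N) (h : shiftedPart N mu.rowLen = shiftedPart N nu.rowLen) : mu = nu := by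
  refine youngDiagram_ext_of_rowLen hmu hnu fun i hi => ?_
  have h1 := congrFun h ⟨i, hi⟩
  simpa only [shiftedPart, Nat.add_right_cancel_iff] using h1

theorem diagramOfShifted_shiftedPart {N : ℕ} {mu : YoungDiagram} (hmu : mu.colLen 0 ≤ N) :
    diagramOfShifted (shiftedPart N mu.rowLen) = mu :=
  shiftedPart_inj (colLen_diagramOfShifted_le (strictAnti_shiftedPart (antitone_rowLen mu))) hmu
    (shiftedPart_diagramOfShifted (strictAnti_shiftedPart (antitone_rowLen mu)))

end SchurDet

/-! ### Schur polynomials in finitely many variables -/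

section SchurPoly

variable {R : Type} [CommRing R] {N : ℕ}

theorem schurDet_completeSeries_mul_altPoly {mu : YoungDiagram} (hmu : mu.colLen 0 ≤ N) :
    schurDet (completeSeries R N) mu * altPoly R (shiftedPart N fun _ => 0) =
      altPoly R (shiftedPart N mu.rowLen) := by
  rw [schurDet_eq_det constantCoeff_completeSeries hmu, det_schurMatrix_mul_altPoly]

theorem schurDet_completeSeries_eq_zero [IsDomain R] {mu : YoungDiagram} (hmu : N < mu.colLen 0) :
    schurDet (completeSeries R N) mu = 0 :=
  det_schurMatrix_eq_zero hmu fun k hk => Nat.pos_of_ne_zero fun h =>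
    absurd (rowLen_eq_zero_iff.mp h) (by omega)

theorem altPoly_eq_schurDet_mul {s : Fin N → ℕ} (hs : StrictAnti s) :
    altPoly R s = schurDet (completeSeries R N) (diagramOfShifted s) *
      altPoly R (shiftedPart N fun _ => 0) := by
  rw [schurDet_completeSeries_mul_altPoly (colLen_diagramOfShifted_le hs),
    shiftedPart_diagramOfShifted hs]

theorem map_geomSeries {A B : Type} [CommRing A] [CommRing B] (φ : A →+* B) (a : A) :
    PowerSeries.map φ (geomSeries a) = geomSeries (φ a) := by
  ext k
  rw [PowerSeries.coeff_map, geomSeries, geomSeries, PowerSeries.coeff_mk, PowerSeries.coeff_mk,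
    map_pow]

theorem map_completeSeries {S : Type} [CommRing S] (φ : R →+* S) :
    PowerSeries.map (MvPolynomial.map φ) (completeSeries R N) = completeSeries S N := by
  rw [completeSeries, completeSeries, map_prod]
  simp only [map_geomSeries, map_X]

theorem schurDet_completeSeries_eq_map (mu : YoungDiagram) :
    schurDet (completeSeries R N) mu =
      MvPolynomial.map (Int.castRingHom R) (schurDet (completeSeries ℤ N) mu) := by
  rw [map_schurDet, map_completeSeries]

theorem isHomogeneous_coeff_completeSeries (k : ℕ) :
    (PowerSeries.coeff k (completeSeries R N)).IsHomogeneous k := by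
  classical
  rw [completeSeries]
  induction (Finset.univ : Finset (Fin N)) using Finset.induction_on generalizing k with
  | empty =>
    rw [Finset.prod_empty, PowerSeries.coeff_one]
    split_ifs with h
    · rw [h]
      exact isHomogeneous_one _ _
    · exact isHomogeneous_zero _ _ _
  | insert i s hi ih =>
    rw [Finset.prod_insert hi, PowerSeries.coeff_mul]
    refine IsHomogeneous.sum _ _ _ fun ab hab => ?_
    rw [← Finset.HasAntidiagonal.mem_antidiagonal.mp hab, geomSeries, PowerSeries.coeff_mk]
    exact (isHomogeneous_X_pow i ab.1).mul (ih ab.2)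

theorem coeff_coeffInt_completeSeries_mul {α : Fin N →₀ ℕ} {m : ℤ} (hm : (α.degree : ℤ) < m)
    (P : MvPolynomial (Fin N) R) : coeff α (coeffInt (completeSeries R N) m * P) = 0 := by
  classical
  rw [coeff_mul]
  refine Finset.sum_eq_zero fun ab hab => ?_
  have h := Finset.HasAntidiagonal.mem_antidiagonal.mp hab
  rw [show m = (m.toNat : ℕ) by omega, coeffInt_natCast,
    (isHomogeneous_coeff_completeSeries m.toNat).coeff_eq_zero, zero_mul]
  rw [← h, map_add] at hm
  omega

/-- The first row of the determinant consists of complete symmetric polynomials of degree at least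
the first part of mu. -/
theorem coeff_schurDet_completeSeries_eq_zero {α : Fin N →₀ ℕ} {mu : YoungDiagram}
    (h : α.degree < mu.rowLen 0) : coeff α (schurDet (completeSeries R N) mu) = 0 := by
  have h0 : 0 < mu.colLen 0 := by
    by_contra hc
    rw [rowLen_eq_zero_iff.mpr (not_lt.mp hc)] at h
    omega
  obtain ⟨l, hl⟩ : ∃ l, mu.colLen 0 = l + 1 := ⟨mu.colLen 0 - 1, by omega⟩
  rw [schurDet_eq_det constantCoeff_completeSeries hl.le, Matrix.det_succ_row_zero, coeff_sum]
  refine Finset.sum_eq_zero fun j _ => ?_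
  rw [mul_comm ((-1) ^ (j : ℕ)), mul_assoc, schurMatrix, Matrix.of_apply]
  refine coeff_coeffInt_completeSeries_mul ?_ _
  rw [Fin.val_zero]
  push_cast
  omega

end SchurPoly

/-! ### Littlewood–Richardson coefficients -/

section LittlewoodRichardson

theorem constantCoeff_chernSeries : PowerSeries.constantCoeff chernSeries = 1 := by
  rw [← PowerSeries.coeff_zero_eq_constantCoeff_apply, chernSeries, PowerSeries.coeff_mk,
    dif_neg (lt_irrefl 0)]

theorem det_truncCoeff_eq_schurC {N K : ℕ} {s : Fin N → ℕ} (hs : StrictAnti s)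
    (hK : ∀ k, s k ≤ K) :
    Matrix.det (Matrix.of fun k j : Fin N =>
      truncCoeff chernSeries K ((s k : ℤ) - (shiftedPart N (fun _ => 0) j : ℕ))) =
      schurC (diagramOfShifted s) := by
  rw [schurC, schurDet_eq_det constantCoeff_chernSeries (colLen_diagramOfShifted_le hs)]
  congr 1
  ext1 k j
  have h1 := sub_staircase_nonneg hs k
  have h2 := k.2
  have h3 := hK k
  rw [Matrix.of_apply, schurMatrix, Matrix.of_apply, diagramOfShifted,
    rowLen_diagramOf (antitone_sub_staircase hs), truncCoeff, if_pos (by omega), shiftedPart]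
  congr 1
  have := j.2
  omega

open Classical in
theorem prod_truncAt_eq_sum_schurDet {N : ℕ} (K : ℕ) :
    ∏ i : Fin N, truncAt chernSeries K i =
      ∑ s ∈ (Fintype.piFinset fun _ : Fin N => Finset.range (K + N + 1)).filter StrictAnti,
        C (Matrix.det (Matrix.of fun k j : Fin N =>
          truncCoeff chernSeries K ((s k : ℤ) - (shiftedPart N (fun _ => 0) j : ℕ)))) *
          schurDet (completeSeries CRing N) (diagramOfShifted s) := by
  have hd : StrictAnti (shiftedPart N fun _ => 0) := strictAnti_shiftedPart antitone_const
  refine mul_right_cancel₀ (altPoly_ne_zero (R := CRing) hd) ?_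
  rw [prod_truncAt_mul_altPoly chernSeries K (shiftedPart N fun _ => 0) (M := K + N)
    (fun j => by rw [shiftedPart]; omega), Finset.sum_mul]
  refine Finset.sum_congr rfl fun s hs => ?_
  rw [mul_assoc, ← altPoly_eq_schurDet_mul (Finset.mem_filter.mp hs).2]

theorem coeff_prod_truncAt {R : Type} [CommRing R] (c : PowerSeries R) {K N : ℕ} {α : Fin N →₀ ℕ}
    (hα : ∀ i, α i ≤ K) :
    coeff α (∏ i : Fin N, truncAt c K i) = ∏ i, PowerSeries.coeff (α i) c := by
  classical
  simp only [truncAt, Finset.prod_univ_sum, coeff_sum, Finset.prod_mul_distrib]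
  rw [Finset.sum_eq_single (⇑α)]
  · rw [← map_prod, coeff_C_mul]
    have : (∏ i, X i ^ α i : MvPolynomial (Fin N) R) = monomial α 1 := by
      rw [monomial_eq, Finsupp.prod_fintype _ _ fun _ => pow_zero _, C_1, one_mul]
    rw [this, coeff_monomial, if_pos rfl, mul_one]
  · intro b _ hb
    rw [← map_prod, coeff_C_mul]
    have : (∏ i, X i ^ b i : MvPolynomial (Fin N) R) =
        monomial (Finsupp.equivFunOnFinite.symm b) 1 := by
      rw [monomial_eq, Finsupp.prod_fintype _ _ fun _ => pow_zero _, C_1, one_mul]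
      rfl
    rw [this, coeff_monomial, if_neg, mul_zero]
    rintro rfl
    exact hb rfl
  · intro h
    refine absurd (Fintype.mem_piFinset.mpr fun i => ?_) h
    rw [Finset.mem_range]
    exact Nat.lt_succ_of_le (hα i)

/-- Compare coefficients of z^α in the Cauchy identity ∏ c(z_i) = ∑ S_λ(c) s_λ(z): the s_λ have
integer coefficients. -/
theorem prod_coeff_chernSeries_mem_span {N : ℕ} (α : Fin N → ℕ) :
    ∏ i, PowerSeries.coeff (α i) chernSeries ∈ Submodule.span ℤ (Set.range schurC) := by
  classical
  set a : Fin N →₀ ℕ := Finsupp.equivFunOnFinite.symm α with ha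
  -- If some s_k exceeds K, the truncation may spoil the determinant, but then the first part of the
  -- shape exceeds |α| and the term has no z^α.
  set K := a.degree + N with hK
  have haK : ∀ i, a i ≤ K := fun i => (Finsupp.le_degree i a).trans (Nat.le_add_right _ _)
  have h := coeff_prod_truncAt chernSeries haK
  rw [← show ∏ i, PowerSeries.coeff (a i) chernSeries =
    ∏ i, PowerSeries.coeff (α i) chernSeries from rfl, ← h, prod_truncAt_eq_sum_schurDet, coeff_sum]
  refine Submodule.sum_mem _ fun s hs => ?_
  have hs' := (Finset.mem_filter.mp hs).2
  rw [coeff_C_mul]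
  by_cases hsK : ∀ k, s k ≤ K
  · rw [det_truncCoeff_eq_schurC hs' hsK, schurDet_completeSeries_eq_map, coeff_map, mul_comm,
      eq_intCast, ← zsmul_eq_mul]
    exact Submodule.smul_mem _ _ (Submodule.subset_span ⟨_, rfl⟩)
  · obtain ⟨k, hk⟩ := not_forall.mp hsK
    have h0 : 0 < N := by have := k.2; omega
    rw [coeff_schurDet_completeSeries_eq_zero, mul_zero]
    · exact Submodule.zero_mem _
    · have h1 := hs'.antitone (show (⟨0, h0⟩ : Fin N) ≤ k from Nat.zero_le _)
      have h2 := rowLen_diagramOf (antitone_sub_staircase hs') ⟨0, h0⟩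
      change (diagramOfShifted s).rowLen 0 = _ at h2
      rw [h2]
      change _ < ((s ⟨0, h0⟩ : ℤ) - ((N : ℤ) - 1 - (0 : ℕ))).toNat
      omega

theorem span_range_schurC : Submodule.span ℤ (Set.range schurC) = ⊤ := by
  have h1 : Algebra.adjoin ℤ (Set.range (X : ℕ+ → CRing)) = ⊤ := adjoin_range_X
  rw [eq_top_iff, ← Algebra.top_toSubmodule, ← h1, Algebra.adjoin_eq_span, Submodule.span_le]
  intro f hf
  obtain ⟨l, hl, rfl⟩ := Submonoid.exists_list_of_mem_closure hf
  have h2 : ∃ l' : List ℕ, l'.map (fun k => PowerSeries.coeff k chernSeries) = l := by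
    induction l with
    | nil => exact ⟨[], rfl⟩
    | cons a l ih =>
      obtain ⟨k, rfl⟩ := hl a List.mem_cons_self
      obtain ⟨l', rfl⟩ := ih (fun x hx => hl x (List.mem_cons_of_mem _ hx))
        (Submonoid.list_prod_mem _ fun x hx =>
          Submonoid.subset_closure (hl x (List.mem_cons_of_mem _ hx)))
      refine ⟨(k : ℕ) :: l', ?_⟩
      rw [List.map_cons, chernSeries, PowerSeries.coeff_mk, dif_pos k.pos]
      rfl
  obtain ⟨l', rfl⟩ := h2
  have h3 := prod_coeff_chernSeries_mem_span fun i : Fin l'.length => l'[i]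
  rwa [← List.prod_ofFn,
    ← Function.comp_def (fun k => PowerSeries.coeff k chernSeries) fun i : Fin l'.length => l'[i],
    ← List.map_ofFn,
    show List.ofFn (fun i : Fin l'.length => l'[i]) = l' from List.ofFn_getElem] at h3

theorem exists_schurC_mul_eq_sum (mu nu : YoungDiagram) :
    ∃ f : YoungDiagram →₀ ℤ, schurC mu * schurC nu = f.sum fun k a => a • schurC k := by
  have h : schurC mu * schurC nu ∈ Submodule.span ℤ (Set.range schurC) := by
    rw [span_range_schurC]
    exact Submodule.mem_top
  obtain ⟨f, hf⟩ := Finsupp.mem_span_range_iff_exists_finsupp.mp h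
  exact ⟨f, hf.symm⟩

theorem map_aeval_chernSeries {A : Type} [CommRing A] {c : PowerSeries A}
    (hc : PowerSeries.constantCoeff c = 1) :
    PowerSeries.map ((aeval fun k : ℕ+ => PowerSeries.coeff (k : ℕ) c) : CRing →ₐ[ℤ] A).toRingHom
      chernSeries = c := by
  ext k
  rw [PowerSeries.coeff_map, chernSeries, PowerSeries.coeff_mk]
  split_ifs with h
  · exact aeval_X _ _
  · rw [map_one, Nat.eq_zero_of_not_pos h, PowerSeries.coeff_zero_eq_constantCoeff_apply, hc]

/-- After multiplication by the Vandermonde alternant, each s_k becomes an alternant or zero, and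
the exponent of lam isolates its own term. In particular the coefficient is independent of the
chosen expansion. -/
theorem lrCoeff_eq_coeff {R : Type} [CommRing R] [IsDomain R] {N : ℕ} {lam : YoungDiagram}
    (hlam : lam.colLen 0 ≤ N) (mu nu : YoungDiagram) :
    (lrCoeff lam mu nu : R) =
      coeff (Finsupp.equivFunOnFinite.symm (shiftedPart N lam.rowLen))
        (schurDet (completeSeries R N) mu * schurDet (completeSeries R N) nu *
          altPoly R (shiftedPart N fun _ => 0)) := by
  classical
  have h := exists_schurC_mul_eq_sum mu nu
  obtain ⟨φ, hφ⟩ : ∃ φ : CRing →+* MvPolynomial (Fin N) R,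
      PowerSeries.map φ chernSeries = completeSeries R N :=
    ⟨_, map_aeval_chernSeries constantCoeff_completeSeries⟩
  have hf := congrArg φ h.choose_spec
  rw [lrCoeff, dif_pos h]
  generalize h.choose = f at hf ⊢
  simp only [map_mul, Finsupp.sum, map_sum, map_zsmul, schurC, map_schurDet, hφ] at hf
  rw [hf, Finset.sum_mul, coeff_sum]
  have key : ∀ k : YoungDiagram, coeff (Finsupp.equivFunOnFinite.symm (shiftedPart N lam.rowLen))
      (f k • schurDet (completeSeries R N) k * altPoly R (shiftedPart N fun _ => 0)) =
      if k = lam then (f lam : R) else 0 := by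
    intro k
    rw [smul_mul_assoc, coeff_smul]
    by_cases hk : k.colLen 0 ≤ N
    · rw [schurDet_completeSeries_mul_altPoly hk,
        coeff_altPoly (strictAnti_shiftedPart (antitone_rowLen _))
          (strictAnti_shiftedPart (antitone_rowLen _))]
      by_cases hkl : k = lam
      · rw [hkl, if_pos rfl, if_pos rfl, zsmul_eq_mul, mul_one]
      · rw [if_neg hkl, if_neg, smul_zero]
        exact fun h => hkl (shiftedPart_inj hk hlam h.symm)
    · rw [schurDet_completeSeries_eq_zero (not_le.mp hk), zero_mul, coeff_zero, smul_zero, if_neg]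
      rintro rfl
      exact hk hlam
  rw [Finset.sum_congr rfl fun k _ => key k, Finset.sum_ite_eq']
  split_ifs with h
  · rfl
  · rw [Finsupp.notMem_support_iff.mp h, Int.cast_zero]

open Classical in
/-- The skew Schur determinant expands in Schur polynomials with Littlewood–Richardson
coefficients. -/
theorem exists_det_chernSeries_eq_sum {N : ℕ} {lam nu : Fin N → ℤ} (hlam : Antitone lam)
    (hnu : Antitone nu) (hlam0 : ∀ i, 0 ≤ lam i) (hnu0 : ∀ i, 0 ≤ nu i) :
    ∃ F : Finset YoungDiagram,
      (∀ mu, lrCoeff (diagramOf lam) mu (diagramOf nu) ≠ 0 → mu ∈ F) ∧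
      Matrix.det (Matrix.of fun i j : Fin N =>
        coeffInt chernSeries (lam i - (i : ℤ) - (nu j - (j : ℤ)))) =
      ∑ mu ∈ F, (lrCoeff (diagramOf lam) mu (diagramOf nu) : CRing) * schurC mu := by
  set l := shiftedPart N (diagramOf lam).rowLen with hl
  set b := shiftedPart N (diagramOf nu).rowLen with hb
  have hlv : ∀ i, (l i : ℤ) = lam i + (N - 1 - i) := fun i => by
    have := hlam0 i
    have := i.2
    rw [hl, shiftedPart, rowLen_diagramOf hlam]
    omega
  have hbv : ∀ i, (b i : ℤ) = nu i + (N - 1 - i) := fun i => by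
    have := hnu0 i
    have := i.2
    rw [hb, shiftedPart, rowLen_diagramOf hnu]
    omega
  have hls : StrictAnti l := strictAnti_shiftedPart (antitone_rowLen _)
  have hbs : StrictAnti b := strictAnti_shiftedPart (antitone_rowLen _)
  set K := ∑ i, l i with hK
  have hlK : ∀ i, l i ≤ K := fun i =>
    Finset.single_le_sum (f := l) (fun _ _ => Nat.zero_le _) (Finset.mem_univ i)
  set S := (Fintype.piFinset fun _ : Fin N => Finset.range (K + 1)).filter StrictAnti with hS
  have hSmem : ∀ s, s ∈ S ↔ (∀ k, s k ≤ K) ∧ StrictAnti s := fun s => by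
    simp only [hS, Finset.mem_filter, Fintype.mem_piFinset, Finset.mem_range, Nat.lt_succ_iff]
  have hlr : ∀ s : Fin N → ℕ, StrictAnti s →
      (lrCoeff (diagramOf lam) (diagramOfShifted s) (diagramOf nu) : CRing) =
      coeff (Finsupp.equivFunOnFinite.symm l)
        (schurDet (completeSeries CRing N) (diagramOf nu) * altPoly CRing s) := fun s hs => by
    rw [lrCoeff_eq_coeff (colLen_diagramOf_le hlam), altPoly_eq_schurDet_mul hs, ← mul_assoc,
      mul_comm (schurDet _ (diagramOf nu))]
  -- Shapes with more than N parts, or with a shifted part exceeding K and hence every l_i, have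
  -- coefficient zero, so this finite set suffices.
  refine ⟨S.image diagramOfShifted, fun mu hmu => ?_, ?_⟩
  · have hcol : mu.colLen 0 ≤ N := by
      by_contra hc
      refine hmu ?_
      have := lrCoeff_eq_coeff (R := ℤ) (colLen_diagramOf_le hlam) mu (diagramOf nu)
      rwa [schurDet_completeSeries_eq_zero (not_le.mp hc), zero_mul, zero_mul, coeff_zero] at this
    have hs : StrictAnti (shiftedPart N mu.rowLen) := strictAnti_shiftedPart (antitone_rowLen mu)
    refine Finset.mem_image.mpr ⟨shiftedPart N mu.rowLen, (hSmem _).mpr ⟨fun k => ?_, hs⟩,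
      diagramOfShifted_shiftedPart hcol⟩
    by_contra hk
    refine hmu ?_
    have h1 := hlr _ hs
    rw [coeff_mul_altPoly_eq_zero _ ⟨k, fun i => (hlK i).trans_lt (not_le.mp hk)⟩,
      diagramOfShifted_shiftedPart hcol] at h1
    exact_mod_cast h1
  · rw [Finset.sum_image]
    swap
    · intro s hs s' hs' h
      rw [← shiftedPart_diagramOfShifted ((hSmem s).mp hs).2, h,
        shiftedPart_diagramOfShifted ((hSmem s').mp hs').2]
    -- The coefficient of z^l in ∏ c(z_i) · a_b is computed in two ways. Here only s = l survives,
    -- which gives the skew determinant.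
    have h1 := congrArg (coeff (Finsupp.equivFunOnFinite.symm l))
      (prod_truncAt_mul_altPoly chernSeries K b (M := K + ∑ i, b i)
        (fun j => Nat.add_le_add_left
          (Finset.single_le_sum (f := b) (fun _ _ => Nat.zero_le _) (Finset.mem_univ j)) _))
    rw [coeff_sum, Finset.sum_eq_single l] at h1
    · rw [coeff_C_mul, coeff_altPoly hls hls, if_pos rfl, mul_one] at h1
      have h2 : Matrix.det (Matrix.of fun i j : Fin N =>
          coeffInt chernSeries (lam i - (i : ℤ) - (nu j - (j : ℤ)))) =
          Matrix.det (Matrix.of fun k j : Fin N =>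
            truncCoeff chernSeries K ((l k : ℤ) - (b j : ℕ))) := by
        congr 1
        ext1 i j
        have := hlK i
        rw [Matrix.of_apply, Matrix.of_apply, truncCoeff, if_pos (by omega), hlv, hbv]
        congr 1
        ring
      -- Second way: write a_b as s_nu times the Vandermonde alternant and expand ∏ c(z_i) against
      -- the latter. The coefficient of each S_mu(c) is then a Littlewood–Richardson coefficient.
      rw [h2, ← h1, hb, ← schurDet_completeSeries_mul_altPoly (colLen_diagramOf_le hnu),
        mul_left_comm, prod_truncAt_mul_altPoly chernSeries K (shiftedPart N fun _ => 0)
          (M := K + N) (fun j => by rw [shiftedPart]; omega), Finset.mul_sum, coeff_sum]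
      symm
      refine Finset.sum_subset_zero_on_sdiff ?_ ?_ ?_
      · intro s hs
        rw [hSmem] at hs
        rw [Finset.mem_filter, Fintype.mem_piFinset]
        exact ⟨fun k => Finset.mem_range.mpr (by have := hs.1 k; omega), hs.2⟩
      · intro s hs
        rw [Finset.mem_sdiff, Finset.mem_filter, hSmem, not_and] at hs
        have h3 : ¬ ∀ k, s k ≤ K := fun h => hs.2 h hs.1.2
        obtain ⟨k, hk⟩ := not_forall.mp h3
        rw [← mul_assoc]
        exact coeff_mul_altPoly_eq_zero _ ⟨k, fun i => (hlK i).trans_lt (not_le.mp hk)⟩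
      · intro s hs
        rw [hSmem] at hs
        rw [det_truncCoeff_eq_schurC hs.2 hs.1, mul_left_comm, coeff_C_mul, hlr s hs.2, mul_comm]
    · intro s hs hsl
      rw [coeff_C_mul, coeff_altPoly (Finset.mem_filter.mp hs).2 hls, if_neg hsl.symm, mul_zero]
    · intro h
      refine absurd (Finset.mem_filter.mpr ⟨Fintype.mem_piFinset.mpr fun k => ?_, hls⟩) h
      exact Finset.mem_range.mpr (by have := hlK k; omega)

end LittlewoodRichardson

/-! ### The determinantal form of the tableau sums -/

section TableauSums

/-- The generating series of the rows of tableaux with bound `q`. -/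
noncomputable def flagY (A : Type) [CommRing A] (q : ℤ) : PowerSeries (MvPolynomial XY A) :=
  flagSeries (fun k => -yVar A (1 - (k : ℤ))) (fun l => yVar A (l : ℤ)) q

/-- The generating series of the rows of dual tableaux with bound `p`. -/
noncomputable def flagX (A : Type) [CommRing A] (p : ℤ) : PowerSeries (MvPolynomial XY A) :=
  flagSeries (fun k => xVar A (k : ℤ)) (fun l => -xVar A (1 - (l : ℤ))) (-p)

/-- The determinant with entries the coefficients of `t^{q_i + 1 - p_j}` in `Y_{q_i} c X_{p_j}`. -/
noncomputable def excedanceDet {A : Type} [CommRing A] (c : PowerSeries (MvPolynomial XY A))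
    {n : ℕ} (p q : Fin n → ℤ) : MvPolynomial XY A :=
  Matrix.det (Matrix.of fun i j : Fin n =>
    coeffInt (flagY A (q i) * (c * flagX A (p j))) (q i + 1 - p j))

variable {A : Type} [CommRing A] {n : ℕ} {p q : Fin n → ℤ}

theorem sum_finsum_weight_eq_excedanceDet (hp : StrictAnti p) (hq : StrictAnti q) :
    ∑ lam ∈ seqBetween (rhoSeq p) (kappaSeq q), (∑ᶠ T ∈ tableaux321 q lam, weightY A T) *
      ∑ᶠ T' ∈ dualTableaux321 p lam, weightX A T' = excedanceDet (1 : PowerSeries _) p q := by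
  have h := det_coeffInt_mul (antitone_kappaSeq hq) (antitone_rhoSeq hp)
    (fun i => flagY A (q i)) (fun j => flagX A (p j))
  simp only [excedanceDet, one_mul]
  have he : ∀ i j : Fin n, kappaSeq q i - (i : ℤ) - (rhoSeq p j - (j : ℤ)) = q i + 1 - p j := by
    intro i j
    rw [kappaSeq, rhoSeq]
    ring
  simp only [he] at h
  rw [h]
  refine Finset.sum_congr rfl fun lam hlam => ?_
  obtain ⟨⟨h1, h2⟩, h3⟩ := mem_seqBetween.mp hlam
  congr 1
  · exact finsum_tableaux321_eq_det _ _ hq h3 h2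
  · exact finsum_dualTableaux321_eq_det _ _ hp h3 h1

theorem sum_sum_finsum_weight_eq_excedanceDet (hp : StrictAnti p) (hq : StrictAnti q)
    (c : PowerSeries (MvPolynomial XY A)) :
    ∑ lam ∈ seqBetween (rhoSeq p) (kappaSeq q), ∑ nu ∈ seqBetween (rhoSeq p) lam,
      (∑ᶠ T ∈ tableaux321 q lam, weightY A T) *
        (Matrix.det (Matrix.of fun i j : Fin n =>
          coeffInt c (lam i - (i : ℤ) - (nu j - (j : ℤ)))) *
        ∑ᶠ T' ∈ dualTableaux321 p nu, weightX A T') = excedanceDet c p q := by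
  have h := det_coeffInt_mul (antitone_kappaSeq hq) (antitone_rhoSeq hp)
    (fun i => flagY A (q i)) (fun j => c * flagX A (p j))
  have he : ∀ i j : Fin n, kappaSeq q i - (i : ℤ) - (rhoSeq p j - (j : ℤ)) = q i + 1 - p j := by
    intro i j
    rw [kappaSeq, rhoSeq]
    ring
  simp only [he] at h
  rw [excedanceDet, h]
  refine Finset.sum_congr rfl fun lam hlam => ?_
  obtain ⟨⟨h1, h2⟩, h3⟩ := mem_seqBetween.mp hlam
  rw [det_coeffInt_mul h3 (antitone_rhoSeq hp) (fun _ => c) (fun j => flagX A (p j)),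
    Finset.mul_sum]
  refine Finset.sum_congr rfl fun nu hnu => ?_
  obtain ⟨⟨h4, h5⟩, h6⟩ := mem_seqBetween.mp hnu
  congr 1
  · exact finsum_tableaux321_eq_det _ _ hq h3 h2
  · congr 1
    exact finsum_dualTableaux321_eq_det _ _ hp h6 h4

theorem finsum_mem_finsum_mem_mul {α β B : Type*} [CommRing B] {s : Set α} {t : Set β}
    (hs : s.Finite) (ht : t.Finite) (f : α → B) (g : β → B) :
    ∑ᶠ a ∈ s, ∑ᶠ b ∈ t, f a * g b = (∑ᶠ a ∈ s, f a) * ∑ᶠ b ∈ t, g b := by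
  rw [finsum_mem_eq_finite_toFinset_sum _ hs, finsum_mem_eq_finite_toFinset_sum _ hs,
    finsum_mem_eq_finite_toFinset_sum _ ht, Finset.sum_mul]
  refine Finset.sum_congr rfl fun a _ => ?_
  rw [finsum_mem_eq_finite_toFinset_sum _ ht, Finset.mul_sum]

/-- The sum over mu collapses to the skew determinant of c. The translation by t only serves to make
the parts nonnegative; it cancels in the differences lam_i - nu_j. -/
theorem finsum_lrCoeff_eq {lam nu : Fin n → ℤ} (hlam : Antitone lam) (hnu : Antitone nu)
    (hle : nu ≤ lam) {t : ℤ} (ht : ∀ i, 0 ≤ nu i + t) :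
    ∑ᶠ mu : YoungDiagram, ∑ᶠ T ∈ tableaux321 q lam, ∑ᶠ T' ∈ dualTableaux321 p nu,
      (lrCoeff (diagramOf fun i => lam i + t) mu (diagramOf fun i => nu i + t) : LambdaXY) *
        (weightY CRing T * weightX CRing T') * C (schurC mu) =
    (∑ᶠ T ∈ tableaux321 q lam, weightY CRing T) *
      (Matrix.det (Matrix.of fun i j : Fin n =>
        coeffInt (PowerSeries.map C chernSeries) (lam i - (i : ℤ) - (nu j - (j : ℤ)))) *
      ∑ᶠ T' ∈ dualTableaux321 p nu, weightX CRing T') := by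
  obtain ⟨F, hF, hdet⟩ := exists_det_chernSeries_eq_sum (lam := fun i => lam i + t)
    (nu := fun i => nu i + t) (hlam.add_const t) (hnu.add_const t)
    (fun i => (ht i).trans (add_le_add_left (hle i) t)) ht
  have hfin : (tableaux321 q lam).Finite := finite_flagTableaux _ _ _
  have hsub : ∀ i j : Fin n, lam i + t - (i : ℤ) - (nu j + t - (j : ℤ)) =
      lam i - (i : ℤ) - (nu j - (j : ℤ)) := fun i j => by ring
  have h1 : ∀ mu : YoungDiagram, ∑ᶠ T ∈ tableaux321 q lam, ∑ᶠ T' ∈ dualTableaux321 p nu,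
      (lrCoeff (diagramOf fun i => lam i + t) mu (diagramOf fun i => nu i + t) : LambdaXY) *
        (weightY CRing T * weightX CRing T') * C (schurC mu) =
      C ((lrCoeff (diagramOf fun i => lam i + t) mu (diagramOf fun i => nu i + t) : CRing) *
        schurC mu) * ((∑ᶠ T ∈ tableaux321 q lam, weightY CRing T) *
          ∑ᶠ T' ∈ dualTableaux321 p nu, weightX CRing T') := by
    intro mu
    rw [← mul_assoc, mul_finsum_mem' _ _ hfin,
      ← finsum_mem_finsum_mem_mul hfin (finite_dualTableaux321 _ _)]
    simp only [map_mul, map_intCast]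
    refine finsum_congr fun T => finsum_congr fun _ => finsum_congr fun T' =>
      finsum_congr fun _ => ?_
    ring
  simp only [h1]
  rw [finsum_eq_sum_of_support_subset (s := F), ← Finset.sum_mul, ← map_sum, ← hdet,
    map_det_coeffInt]
  · simp only [hsub]
    rw [mul_left_comm]
  · intro mu hmu
    refine hF mu fun h0 => hmu ?_
    simp only [h0, Int.cast_zero, zero_mul, map_zero]

theorem sum_lrCoeff_eq_excedanceDet (hp : StrictAnti p) (hq : StrictAnti q) {t : ℤ}
    (ht : ∀ i, 0 ≤ rhoSeq p i + t) :
    ∑ lam ∈ seqBetween (rhoSeq p) (kappaSeq q), ∑ nu ∈ seqBetween (rhoSeq p) lam,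
      ∑ᶠ mu : YoungDiagram, ∑ᶠ T ∈ tableaux321 q lam, ∑ᶠ T' ∈ dualTableaux321 p nu,
        (lrCoeff (diagramOf fun i => lam i + t) mu (diagramOf fun i => nu i + t) : LambdaXY) *
          (weightY CRing T * weightX CRing T') * C (schurC mu) =
      excedanceDet (PowerSeries.map C chernSeries) p q := by
  rw [← sum_sum_finsum_weight_eq_excedanceDet hp hq]
  refine Finset.sum_congr rfl fun lam hlam => Finset.sum_congr rfl fun nu hnu => ?_
  obtain ⟨-, h3⟩ := mem_seqBetween.mp hlam
  obtain ⟨⟨h4, h5⟩, h6⟩ := mem_seqBetween.mp hnu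
  exact finsum_lrCoeff_eq h3 h6 h5 fun i => (ht i).trans (add_le_add_left (h4 i) t)

end TableauSums

/-! ### Specialization -/

section Specialization

theorem map_flagSeries {A B : Type} [CommRing A] [CommRing B] (φ : A →+* B) (u v : ℕ → A) (q : ℤ) :
    PowerSeries.map φ (flagSeries u v q) =
      flagSeries (fun k => φ (u k)) (fun k => φ (v k)) q := by
  simp only [flagSeries, map_mul, map_prod, map_add, map_one, PowerSeries.map_C, PowerSeries.map_X,
    map_geomSeries]

theorem constantCoeff_finiteChern (m : ℕ) : PowerSeries.constantCoeff (finiteChern m) = 1 := by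
  rw [finiteChern, map_prod, Finset.prod_eq_one fun i _ => ?_]
  rw [map_mul, constantCoeff_linear, constantCoeff_geomSeries, one_mul]

theorem specializeC_excedanceDet (m : ℕ) {n : ℕ} (p q : Fin n → ℤ) :
    specializeC m (excedanceDet (PowerSeries.map C chernSeries) p q) =
      excedanceDet (finiteChern m) p q := by
  have hX : ∀ v, specializeC m (X v) = X v := fun v => eval₂Hom_X' _ _ _
  have hc : PowerSeries.map (specializeC m) (PowerSeries.map C chernSeries) = finiteChern m := by
    conv_rhs => rw [← map_aeval_chernSeries (constantCoeff_finiteChern m)]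
    ext1 k
    rw [PowerSeries.coeff_map, PowerSeries.coeff_map, PowerSeries.coeff_map]
    exact eval₂Hom_C _ _ _
  rw [excedanceDet, map_det_coeffInt, excedanceDet]
  simp only [map_mul, flagY, flagX, map_flagSeries, hc, map_neg, xVar, yVar, hX]

/-- Splitting at 0: for q ≥ 0 factors F are added beyond 0, and for q ≤ 0 the surplus factors in (q,
0] are cancelled by their inverses G. -/
theorem prod_Ioc_eq_mul {M : Type*} [CommMonoid M] {F G : ℤ → M} (h : ∀ l, F l * G l = 1) {m q : ℤ}
    (hm : m ≤ 0) (hq : m ≤ q) :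
    ∏ l ∈ Finset.Ioc m q, F l = (∏ l ∈ Finset.Ioc m 0, F l) *
      ((∏ l ∈ Finset.Icc 1 q.toNat, F (l : ℕ)) *
        ∏ k ∈ Finset.Icc 1 (-q).toNat, G (1 - (k : ℕ))) := by
  have hcast : ∀ k : ℕ, ∏ l ∈ Finset.Ioc (0 : ℤ) k, F l = ∏ l ∈ Finset.Icc 1 k, F (l : ℕ) := by
    intro k
    symm
    refine Finset.prod_bij (fun l _ => (l : ℤ)) (fun l hl => ?_) (fun a _ b _ h => ?_)
      (fun b hb => ?_) fun _ _ => rfl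
    · rw [Finset.mem_Icc] at hl
      rw [Finset.mem_Ioc]
      omega
    · exact_mod_cast h
    · rw [Finset.mem_Ioc] at hb
      refine ⟨b.toNat, Finset.mem_Icc.mpr (by omega), by omega⟩
  have hneg : ∀ k : ℕ, ∏ l ∈ Finset.Ioc (-k : ℤ) 0, G l =
      ∏ l ∈ Finset.Icc 1 k, G (1 - (l : ℕ)) := by
    intro k
    symm
    refine Finset.prod_bij (fun l _ => 1 - (l : ℤ)) (fun l hl => ?_) (fun a _ b _ h => ?_)
      (fun b hb => ?_) fun _ _ => rfl
    · rw [Finset.mem_Icc] at hl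
      rw [Finset.mem_Ioc]
      omega
    · omega
    · rw [Finset.mem_Ioc] at hb
      refine ⟨(1 - b).toNat, Finset.mem_Icc.mpr (by omega), by omega⟩
  rw [← hcast, ← hneg]
  rcases le_total 0 q with h0 | h0
  · rw [← Finset.Ioc_union_Ioc_eq_Ioc hm h0,
      Finset.prod_union (Finset.Ioc_disjoint_Ioc_of_le le_rfl),
      Finset.Ioc_eq_empty_of_le (show (0 : ℤ) ≤ -((-q).toNat : ℤ) by omega), Finset.prod_empty,
      mul_one, Int.toNat_of_nonneg h0]
  · rw [← Finset.Ioc_union_Ioc_eq_Ioc hq h0,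
      Finset.prod_union (Finset.Ioc_disjoint_Ioc_of_le le_rfl),
      Finset.Ioc_eq_empty_of_le (show (q.toNat : ℤ) ≤ 0 by omega), Finset.prod_empty, one_mul,
      show -((-q).toNat : ℤ) = q by omega, mul_assoc, ← Finset.prod_mul_distrib,
      Finset.prod_eq_one fun l _ => h l, mul_one]

theorem flagY_mul_finiteChern_mul_flagX {m : ℕ} {p q : ℤ} (hp : -(m : ℤ) ≤ p) (hq : -(m : ℤ) ≤ q) :
    flagY ℤ q * (finiteChern m * flagX ℤ p) =
      (∏ l ∈ Finset.Ioc (-(m : ℤ)) q, (1 + PowerSeries.C (yVar ℤ l) * PowerSeries.X)) *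
        ∏ l ∈ Finset.Ioc (-(m : ℤ)) p, geomSeries (xVar ℤ l) := by
  rw [prod_Ioc_eq_mul (F := fun l => 1 + PowerSeries.C (yVar ℤ l) * PowerSeries.X)
      (G := fun l => geomSeries (-yVar ℤ l)) (fun l => ?_) (by omega) hq,
    prod_Ioc_eq_mul (F := fun l => geomSeries (xVar ℤ l))
      (G := fun l => 1 + PowerSeries.C (-xVar ℤ l) * PowerSeries.X) (fun l => ?_) (by omega) hp,
    finiteChern, Finset.prod_mul_distrib, flagX, flagY, flagSeries, flagSeries, neg_neg]
  · ring
  · rw [mul_comm, linear_mul_geomSeries, add_neg_cancel, map_zero, zero_mul, zero_mul, add_zero]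
  · rw [linear_mul_geomSeries, neg_add_cancel, map_zero, zero_mul, zero_mul, add_zero]

theorem InversionsAt.shiftPerm {n : ℕ} {p : Fin n → ℤ} {w : Equiv.Perm ℤ} (h : InversionsAt p w)
    (m : ℤ) : InversionsAt (fun i => p i + m) (shiftPerm m w) := by
  have hs : ∀ a, _root_.shiftPerm m w a = w (a - m) + m := fun _ => rfl
  refine ⟨fun i j hij => add_lt_add_left (h.strictAnti hij) m, ?_, fun a b hab hlt => ?_⟩
  · refine (h.finite.image fun i => i + m).subset fun i hi => ⟨i - m, fun he => hi ?_, ?_⟩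
    · rw [hs, he]
      ring
    · simp only
      ring
  · rw [hs, hs] at hlt
    obtain ⟨⟨i, hi⟩, h2⟩ := h.inv (a - m) (b - m) (by omega) (by omega)
    exact ⟨⟨i, by omega⟩, fun i hi => h2 i (by omega)⟩

theorem prod_Ioc_add {M : Type*} [CommMonoid M] (F : ℤ → M) (a b m : ℤ) :
    ∏ l ∈ Finset.Ioc a (b + m), F (l - m) = ∏ l ∈ Finset.Ioc (a - m) b, F l := by
  refine Finset.prod_bij (fun l _ => l - m) (fun l hl => ?_) (fun a _ b _ h => ?_)
      (fun b hb => ?_) fun _ _ => rfl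
  · rw [Finset.mem_Ioc] at hl ⊢
    omega
  · omega
  · rw [Finset.mem_Ioc] at hb
    exact ⟨b + m, Finset.mem_Ioc.mpr (by omega), by ring⟩

/-- After translation by m all particles are at positive places, so the determinant formula for
`nilPoly` applies. Undoing the translation turns its products over (0, ·] into products over (-m,
·]. -/
theorem negY_shiftBack_doubleSchubert {w : Equiv.Perm ℤ} {n : ℕ} {p q : Fin n → ℤ}
    (h : InversionsAt p w) (hq : ∀ i, w (p i) = q i + 1) (hpq : ∀ i, p i < w (p i)) {m : ℕ}
    (hm : ∀ i : ℤ, i ≤ -(m : ℤ) → w i = i) :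
    negY (shiftBack m (doubleSchubert (shiftPerm m w))) = excedanceDet (finiteChern m) p q := by
  have hs : ∀ a, shiftPerm m w a = w (a - m) + m := fun _ => rfl
  have hpm : ∀ i, -(m : ℤ) < p i := fun i => by
    by_contra hc
    have := hpq i
    have := hm (p i) (not_lt.mp hc)
    omega
  obtain ⟨K, hK1, hK2⟩ := exists_support_bound h.finite
  obtain ⟨N₀, hN⟩ := doubleSchubert_eq_nilPoly (n := K + m) (w := shiftPerm m w)
    (fun j hj => by rw [hs, hm _ (by omega)]; ring)
    (fun j hj => by rw [hs, hK2 _ (by push_cast at hj; omega)]; ring)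
  obtain ⟨B, hB⟩ : ∃ B : ℕ, ∀ i, w (p i) + m ≤ B := by
    obtain ⟨B, hB⟩ := (Set.finite_range fun i => w (p i) + m).bddAbove
    exact ⟨B.toNat, fun i => (hB ⟨i, rfl⟩).trans (Int.self_le_toNat B)⟩
  have hws : ∀ i, shiftPerm m w (p i + m) = q i + 1 + m := fun i => by
    rw [hs, add_sub_cancel_right, hq]
  rw [hN (max N₀ B) (le_max_left _ _), nilPoly_eq_det _ _ (h.shiftPerm m)
    (fun i => by have := hpm i; omega)
    (fun i => by
      have := hB i
      rw [hws, ← hq]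
      exact this.trans (by exact_mod_cast le_max_right _ _))]
  have hy : ∀ l, (negY.toRingHom.comp (shiftBack m).toRingHom) (yVar ℤ l) = -yVar ℤ (l - m) := by
    intro l
    simp [negY, shiftBack, yVar, xVar]
  have hx : ∀ l, (negY.toRingHom.comp (shiftBack m).toRingHom) (xVar ℤ l) = xVar ℤ (l - m) := by
    intro l
    simp [negY, shiftBack, yVar, xVar]
  refine (map_det_coeffInt (negY.toRingHom.comp (shiftBack m).toRingHom) _ _).trans ?_
  rw [excedanceDet]
  congr 1
  ext1 i j
  rw [Matrix.of_apply, Matrix.of_apply, flagY_mul_finiteChern_mul_flagX (hpm j).le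
    (by have := hpm i; have := hpq i; have := hq i; omega)]
  simp only [map_mul, map_prod, map_add, map_one, map_neg, PowerSeries.map_C, PowerSeries.map_X,
    map_geomSeries, hx, hy, neg_neg, hws]
  rw [show Finset.Ioo 0 (q i + 1 + (m : ℤ)) = Finset.Ioc 0 (q i + m) by
      ext a
      rw [Finset.mem_Ioo, Finset.mem_Ioc]
      omega,
    prod_Ioc_add (fun l => 1 + PowerSeries.C (yVar ℤ l) * PowerSeries.X),
    prod_Ioc_add (fun l => geomSeries (xVar ℤ l)), zero_sub, add_sub_add_right_eq_sub]

theorem isEnrichedSchubert_excedanceDet {w : Equiv.Perm ℤ} {n : ℕ} {p q : Fin n → ℤ}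
    (h : InversionsAt p w) (hq : ∀ i, w (p i) = q i + 1) (hpq : ∀ i, p i < w (p i)) :
    IsEnrichedSchubert w (excedanceDet (PowerSeries.map C chernSeries) p q) := fun m hm => by
  rw [specializeC_excedanceDet, negY_shiftBack_doubleSchubert h hq hpq hm]

theorem negY_doubleSchubert {w : Equiv.Perm ℤ} {n : ℕ} {p q : Fin n → ℤ}
    (h : InversionsAt p w) (hq : ∀ i, w (p i) = q i + 1) (hpq : ∀ i, p i < w (p i))
    (hw : ∀ i : ℤ, i ≤ 0 → w i = i) :
    negY (doubleSchubert w) = excedanceDet (1 : PowerSeries ZXY) p q := by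
  have h1 := negY_shiftBack_doubleSchubert h hq hpq (m := 0) (by simpa using hw)
  have h2 : finiteChern 0 = 1 := by simp [finiteChern]
  have h3 : shiftPerm ((0 : ℕ) : ℤ) w = w := by
    ext i
    simp [shiftPerm]
  have h4 : shiftBack ((0 : ℕ) : ℤ) = AlgHom.id ℤ ZXY := by
    ext v
    rcases v with i | i <;> simp [shiftBack]
  rwa [h2, h3, h4, AlgHom.id_apply] at h1

end Specialization

/-! ### Uniqueness of enriched Schubert polynomials -/

section Uniqueness

/-- Split off one root at a time; the constant term 1 makes every root invertible. If the degree is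
less than d, the missing factors have y_i = 0. -/
theorem exists_eq_prod_linear {K : Type} [Field K] [IsAlgClosed K] (d : ℕ) (Q : Polynomial K)
    (hd : Q.natDegree ≤ d) (h0 : Q.coeff 0 = 1) :
    ∃ y : ℕ → K, Q = ∏ i ∈ Finset.range d, (1 + Polynomial.C (y i) * Polynomial.X) := by
  induction d generalizing Q with
  | zero =>
    refine ⟨0, ?_⟩
    rw [Finset.range_zero, Finset.prod_empty, Polynomial.eq_C_of_natDegree_le_zero hd, h0, map_one]
  | succ d ih =>
    suffices h : ∃ (a : K) (Q' : Polynomial K), Q'.natDegree ≤ d ∧ Q'.coeff 0 = 1 ∧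
        Q = Q' * (1 + Polynomial.C a * Polynomial.X) by
      obtain ⟨a, Q', h1, h2, h3⟩ := h
      obtain ⟨y, hy⟩ := ih Q' h1 h2
      refine ⟨Function.update y d a, ?_⟩
      rw [Finset.prod_range_succ, Function.update_self, h3, hy]
      congr 1
      refine Finset.prod_congr rfl fun i hi => ?_
      rw [Function.update_of_ne (Finset.mem_range.mp hi).ne]
    by_cases hQ : Q.natDegree = 0
    · exact ⟨0, Q, by omega, h0, by simp⟩
    · obtain ⟨r, hr⟩ := IsAlgClosed.exists_root Q fun h =>
        hQ (Polynomial.natDegree_eq_of_degree_eq_some h)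
      obtain ⟨Q', rfl⟩ := Polynomial.dvd_iff_isRoot.mpr hr
      have h1 : -r * Q'.coeff 0 = 1 := by
        simpa [Polynomial.mul_coeff_zero] using h0
      have hr0 : r ≠ 0 := by
        rintro rfl
        simp at h1
      have hQ' : Q' ≠ 0 := by
        rintro rfl
        simp at h1
      refine ⟨-r⁻¹, Polynomial.C (-r) * Q', ?_, by rw [Polynomial.coeff_C_mul, h1], ?_⟩
      · rw [Polynomial.natDegree_mul (Polynomial.X_sub_C_ne_zero r) hQ',
          Polynomial.natDegree_X_sub_C] at hd
        exact (Polynomial.natDegree_C_mul_le _ _).trans (by omega)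
      · have h2 : (Polynomial.C r * Polynomial.C r⁻¹ : Polynomial K) = 1 := by
          rw [← map_mul, mul_inv_cancel₀ hr0, map_one]
        rw [map_neg, map_neg]
        linear_combination (-Q' * Polynomial.X) * h2

theorem exists_coeff_prod_linear_eq {K : Type} [Field K] [IsAlgClosed K] (d : ℕ)
    {f : PowerSeries K} (hf : PowerSeries.constantCoeff f = 1) :
    ∃ y : ℕ → K, ∀ k ≤ d, PowerSeries.coeff k
      (∏ i ∈ Finset.range d, (1 + PowerSeries.C (y i) * PowerSeries.X)) =
        PowerSeries.coeff k f := by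
  obtain ⟨y, hy⟩ := exists_eq_prod_linear d (PowerSeries.trunc (d + 1) f)
    (Nat.lt_succ_iff.mp (PowerSeries.natDegree_trunc_lt f d))
    (by rw [PowerSeries.coeff_trunc, if_pos d.succ_pos,
      PowerSeries.coeff_zero_eq_constantCoeff_apply, hf])
  refine ⟨y, fun k hk => ?_⟩
  have h : (∏ i ∈ Finset.range d, (1 + PowerSeries.C (y i) * PowerSeries.X) : PowerSeries K) =
      ((PowerSeries.trunc (d + 1) f : Polynomial K) : PowerSeries K) := by
    rw [hy, ← Polynomial.coeToPowerSeries.ringHom_apply, map_prod]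
    simp
  rw [h, Polynomial.coeff_coe, PowerSeries.coeff_trunc, if_pos (Nat.lt_succ_of_le hk)]

theorem coeff_mul_congr {A : Type} [CommRing A] {f f' g : PowerSeries A} {k : ℕ}
    (h : ∀ j ≤ k, PowerSeries.coeff j f = PowerSeries.coeff j f') :
    PowerSeries.coeff k (f * g) = PowerSeries.coeff k (f' * g) := by
  rw [PowerSeries.coeff_mul, PowerSeries.coeff_mul]
  refine Finset.sum_congr rfl fun ab hab => ?_
  have := Finset.HasAntidiagonal.mem_antidiagonal.mp hab
  rw [h ab.1 (by omega)]

/-- Any values of finitely many of the variables `x_i`, `y_i`, `c_k` are attained by a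
specialization of the Chern series. -/
theorem exists_eval_finiteChern {K : Type} [Field K] [IsAlgClosed K] (x y : ℤ → K) (c : ℕ+ → K)
    (B d : ℕ) :
    ∃ x' y' : ℤ → K, (∀ i : ℤ, -(B : ℤ) < i → x' i = x i) ∧ (∀ i : ℤ, -(B : ℤ) < i → y' i = y i) ∧
      ∀ k : ℕ+, (k : ℕ) ≤ d → PowerSeries.coeff (k : ℕ)
        (∏ i ∈ Finset.Ioc (-((B + d : ℕ) : ℤ)) 0,
          ((1 + PowerSeries.C (y' i) * PowerSeries.X) * geomSeries (x' i))) = c k := by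
  set g : PowerSeries K := ∏ i ∈ Finset.Ioc (-(B : ℤ)) 0,
    ((1 + PowerSeries.C (y i) * PowerSeries.X) * geomSeries (x i)) with hg
  have hg1 : PowerSeries.constantCoeff g = 1 := by
    rw [hg, map_prod, Finset.prod_eq_one fun i _ => ?_]
    rw [map_mul, constantCoeff_linear, constantCoeff_geomSeries, one_mul]
  set f : PowerSeries K := PowerSeries.mk fun k => if h : 0 < k then c ⟨k, h⟩ else 1 with hf
  have hf1 : PowerSeries.constantCoeff f = 1 := by
    rw [← PowerSeries.coeff_zero_eq_constantCoeff_apply, hf, PowerSeries.coeff_mk,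
      dif_neg (lt_irrefl 0)]
  -- The variables with index in (-B, 0] already contribute g, so d further linear factors are
  -- chosen to realize the quotient f/g up to degree d.
  obtain ⟨z, hz⟩ := exists_coeff_prod_linear_eq d (f := f * g⁻¹) (by
    rw [map_mul, PowerSeries.constantCoeff_inv, hf1, hg1, inv_one, one_mul])
  -- The free variables y_i with i ≤ -B take the values z; the corresponding x_i are set to 0 so
  -- that their geometric series are 1.
  refine ⟨fun i => if -(B : ℤ) < i then x i else 0,
    fun i => if -(B : ℤ) < i then y i else z (-(B : ℤ) - i).toNat,
    fun i hi => if_pos hi, fun i hi => if_pos hi, fun k hk => ?_⟩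
  rw [← Finset.Ioc_union_Ioc_eq_Ioc (show -((B + d : ℕ) : ℤ) ≤ -(B : ℤ) by push_cast; omega)
      (show -(B : ℤ) ≤ 0 by omega),
    Finset.prod_union (Finset.Ioc_disjoint_Ioc_of_le le_rfl)]
  have h1 : ∏ i ∈ Finset.Ioc (-(B : ℤ)) 0,
      ((1 + PowerSeries.C (if -(B : ℤ) < i then y i else z (-(B : ℤ) - i).toNat) * PowerSeries.X) *
        geomSeries (if -(B : ℤ) < i then x i else 0)) = g := by
    refine Finset.prod_congr rfl fun i hi => ?_
    rw [if_pos (Finset.mem_Ioc.mp hi).1, if_pos (Finset.mem_Ioc.mp hi).1]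
  have h2 : ∏ i ∈ Finset.Ioc (-((B + d : ℕ) : ℤ)) (-(B : ℤ)),
      ((1 + PowerSeries.C (if -(B : ℤ) < i then y i else z (-(B : ℤ) - i).toNat) * PowerSeries.X) *
        geomSeries (if -(B : ℤ) < i then x i else 0)) =
      ∏ i ∈ Finset.range d, (1 + PowerSeries.C (z i) * PowerSeries.X) := by
    symm
    refine Finset.prod_bij (fun i _ => -(B : ℤ) - i) (fun i hi => ?_) (fun a _ b _ h => ?_)
      (fun b hb => ?_) (fun i _ => ?_)
    · rw [Finset.mem_range] at hi
      rw [Finset.mem_Ioc]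
      push_cast
      omega
    · omega
    · rw [Finset.mem_Ioc] at hb
      push_cast at hb
      exact ⟨(-(B : ℤ) - b).toNat, Finset.mem_range.mpr (by omega), by omega⟩
    · rw [if_neg (by omega), if_neg (by omega), sub_sub_cancel, Int.toNat_natCast]
      have h3 : geomSeries (0 : K) = 1 := by simpa using one_sub_mul_geomSeries (0 : K)
      rw [h3, mul_one]
  rw [h1, h2, coeff_mul_congr fun j hj => hz j (hj.trans hk), mul_assoc,
    PowerSeries.inv_mul_cancel _ (by rw [hg1]; exact one_ne_zero), mul_one, hf,
    PowerSeries.coeff_mk, dif_pos k.pos]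
  rfl

/-- View f as a polynomial H over ℤ in all of the x, y, c and test it at complex points. Each value
of H is attained through a specialization of the Chern series, hence is zero. -/
theorem eq_zero_of_specializeC_eq_zero {f : LambdaXY} (m₀ : ℕ)
    (h : ∀ m ≥ m₀, specializeC m f = 0) : f = 0 := by
  obtain ⟨H, rfl⟩ := (sumAlgEquiv ℤ XY ℕ+).surjective f
  suffices hH : H = 0 by rw [hH, map_zero]
  refine map_injective (Int.castRingHom ℂ) Int.cast_injective (MvPolynomial.funext fun P => ?_)
  rw [map_zero, map_zero, eval_map]
  set sz : XY ⊕ ℕ+ → ℕ := Sum.elim (Sum.elim Int.natAbs Int.natAbs) fun k => (k : ℕ) with hsz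
  set d := H.vars.sup sz with hd
  have hv : ∀ v ∈ H.vars, sz v ≤ d := fun v hv => Finset.le_sup hv
  -- The number d bounds all indices occurring in H, so the values of the x_i and y_i in H are left
  -- untouched; m₀ is added so that the hypothesis applies to the resulting m.
  obtain ⟨x', y', hx, hy, hc⟩ := exists_eval_finiteChern (fun i => P (.inl (.inl i)))
    (fun i => P (.inl (.inr i))) (fun k => P (.inr k)) (m₀ + d + 1) d
  set ev : ZXY →+* ℂ := eval₂Hom (Int.castRingHom ℂ) (Sum.elim x' y') with hev
  have key : (ev.comp ((specializeC (m₀ + d + 1 + d)).comp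
      (sumAlgEquiv ℤ XY ℕ+).toAlgHom.toRingHom)) H =
      eval₂Hom (Int.castRingHom ℂ) P H := by
    refine hom_congr_vars (RingHom.ext_int _ _) (fun v hvH _ => ?_) rfl
    have hvd := hv v hvH
    rw [eval₂Hom_X']
    rcases v with (i | i) | k
    · have hi : ev (specializeC (m₀ + d + 1 + d) (sumAlgEquiv ℤ XY ℕ+ (X (.inl (.inl i))))) =
          x' i := by
        rw [sumAlgEquiv_X_inl, specializeC, eval₂Hom_X', hev, eval₂Hom_X']
        rfl
      refine hi.trans (hx i ?_)
      simp only [hsz, Sum.elim_inl] at hvd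
      push_cast
      omega
    · have hi : ev (specializeC (m₀ + d + 1 + d) (sumAlgEquiv ℤ XY ℕ+ (X (.inl (.inr i))))) =
          y' i := by
        rw [sumAlgEquiv_X_inl, specializeC, eval₂Hom_X', hev, eval₂Hom_X']
        rfl
      refine hi.trans (hy i ?_)
      simp only [hsz, Sum.elim_inl, Sum.elim_inr] at hvd
      push_cast
      omega
    · have hk : ev (specializeC (m₀ + d + 1 + d) (sumAlgEquiv ℤ XY ℕ+ (X (.inr k)))) =
          ev (PowerSeries.coeff (k : ℕ) (finiteChern (m₀ + d + 1 + d))) := by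
        rw [sumAlgEquiv_X_inr, specializeC, eval₂Hom_C]
        congr 1
        exact aeval_X _ _
      refine hk.trans ?_
      rw [← hc k hvd, ← PowerSeries.coeff_map, finiteChern, map_prod]
      have hxe : ∀ i, ev (xVar ℤ i) = x' i := fun i => eval₂Hom_X' _ _ _
      have hye : ∀ i, ev (yVar ℤ i) = y' i := fun i => eval₂Hom_X' _ _ _
      simp only [map_mul, map_add, map_one, PowerSeries.map_C, PowerSeries.map_X, map_geomSeries,
        hxe, hye]
  refine key.symm.trans ?_
  rw [RingHom.comp_apply, RingHom.comp_apply]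
  exact (congrArg ev (h _ (by omega))).trans (map_zero ev)

theorem IsEnrichedSchubert.unique {w : Equiv.Perm ℤ} (hw : {i : ℤ | w i ≠ i}.Finite)
    {f g : LambdaXY} (hf : IsEnrichedSchubert w f) (hg : IsEnrichedSchubert w g) : f = g := by
  obtain ⟨K, hK, -⟩ := exists_support_bound hw
  refine sub_eq_zero.mp (eq_zero_of_specializeC_eq_zero K fun m hm => ?_)
  have hmK : ∀ i : ℤ, i ≤ -(m : ℤ) → w i = i := fun i hi => hK i (by omega)
  rw [map_sub, hf m hmK, hg m hmK, sub_self]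

end Uniqueness

/-! ### The main theorem -/

theorem mainTheorem6 (w : Equiv.Perm ℤ) (hw : {i : ℤ | w i ≠ i}.Finite)
    (h321 : Is321Avoiding w) (n : ℕ) (p q : Fin n → ℤ) (hp : StrictAnti p)
    (hpw : ∀ a : ℤ, a < w a ↔ ∃ i, p i = a) (hq : ∀ i, w (p i) = q i + 1)
    (t : ℤ) (ht : ∀ i, 0 ≤ rhoSeq p i + t) :
    (∀ f : LambdaXY, IsEnrichedSchubert w f ↔
      f = ∑ lam ∈ seqBetween (rhoSeq p) (kappaSeq q), ∑ nu ∈ seqBetween (rhoSeq p) lam,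
        ∑ᶠ mu : YoungDiagram, ∑ᶠ T ∈ tableaux321 q lam, ∑ᶠ T' ∈ dualTableaux321 p nu,
          (lrCoeff (diagramOf fun i => lam i + t) mu (diagramOf fun i => nu i + t) : LambdaXY) *
            (weightY CRing T * weightX CRing T') * C (schurC mu)) ∧
    ((∀ i : ℤ, i ≤ 0 → w i = i) →
      negY (doubleSchubert w) =
        ∑ lam ∈ seqBetween (rhoSeq p) (kappaSeq q),
          ∑ᶠ T ∈ tableaux321 q lam, ∑ᶠ T' ∈ dualTableaux321 p lam,
            weightY ℤ T * weightX ℤ T') := by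
  have hinv := h321.inversionsAt hw hp hpw
  have hpq : ∀ i, p i < w (p i) := fun i => (hpw _).mpr ⟨i, rfl⟩
  have hqa : StrictAnti q := fun i j hij => by
    have := hinv.apply_lt hij
    rw [hq, hq] at this
    omega
  refine ⟨fun f => ?_, fun hw0 => ?_⟩
  · rw [sum_lrCoeff_eq_excedanceDet hp hqa ht]
    have h := isEnrichedSchubert_excedanceDet hinv hq hpq
    exact ⟨fun hf => hf.unique hw h, fun hf => hf ▸ h⟩
  · rw [negY_doubleSchubert hinv hq hpq hw0, ← sum_finsum_weight_eq_excedanceDet hp hqa]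
    exact Finset.sum_congr rfl fun lam _ => (finsum_mem_finsum_mem_mul
      (finite_flagTableaux _ _ _) (finite_dualTableaux321 _ _) _ _).symm
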